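/- Let $M$ be a smooth manifold of dimension $n\ge 2$ and let $\nabla_a$ be a smooth torsion-free connection on $TM$ that is special, i.e. there is a smooth nowhere vanishing $n$-form $\epsilon_{bc\cdots d}$ with $\nabla_a\epsilon_{bc\cdots d}=0$ (so $M$ is orientable); fix such an $\epsilon$. Write the curvature as $(\nabla_a\nabla_b-\nabla_b\nabla_a)X^c=R_{ab}{}^c{}_dX^d$ and put $$\mathrm{P}_{ab}=\tfrac1{n-1}R_{ca}{}^c{}_b,\qquad W_{ab}{}^c{}_d=R_{ab}{}^c{}_d-\delta_a{}^c\mathrm{P}_{bd}+\delta_b{}^c\mathrm{P}_{ad},\qquad Y_{abc}=\tfrac12(\nabla_a\mathrm{P}_{bc}-\nabla_b\mathrm{P}_{ac}).$$ For smooth sections $(\sigma^{bc},\mu^b,\rho)$ of $\bigodot^2TM\oplus TM\oplus\mathbb{R}$ consider the tractor connection $$\nabla_a\begin{pmatrix}\sigma^{bc}\\ \mu^b\\ \rho\end{pmatrix}=\begin{pmatrix}\nabla_a\sigma^{bc}-\delta_a{}^b\mu^c-\delta_a{}^c\mu^b\\ \nabla_a\mu^b-\delta_a{}^b\rho+\mathrm{P}_{ac}\sigma^{bc}\\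 \nabla_a\rho+2\mathrm{P}_{ab}\mu^b\end{pmatrix}$$ and the modified tractor equation $$\nabla_a\begin{pmatrix}\sigma^{bc}\\ \mu^b\\ \rho\end{pmatrix}-\frac1n\begin{pmatrix}0\\ W_{ac}{}^b{}_d\sigma^{cd}\\ 4Y_{abc}\sigma^{bc}\end{pmatrix}=0.\qquad(*)$$ Two torsion-free connections are projectively equivalent if they have the same geodesics as unparameterised curves. A metric connection is the Levi-Civita connection of a smooth Riemannian metric, and is considered together with that metric. Then the solutions $(\sigma^{bc},\mu^b,\rho)$ of $(*)$ with $\sigma^{bc}$ positive definite are in one-to-one correspondence with the metric connections that are projectively equivalent to $\nabla_a$, that is, with the smooth Riemannian metrics $g$ on $M$ whose Levi-Civita connection is projectively equivalent to $\nabla_a$. The bijection sends $(\sigma^{bc},\mu^b,\rho)$ to the metric with inverse $$g^{ab}=\det(\sigma)\,\sigma^{ab},\qquad \det(\sigma)=\tfrac1{n!}\,\epsilon_{a\cdots b}\,\epsilon_{c\cdots d}\,\sigma^{ac}\cdots\sigma^{bd}.$$ -/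

import Mathlib

open Set Bundle
open scoped Manifold ContDiff

noncomputable section

namespace ProjMetric

variable {n : ℕ} {M : Type*} [TopologicalSpace M] [ChartedSpace (EuclideanSpace ℝ (Fin n)) M]

/-! ### Coordinate frames

Tensor components are taken in the charts `chartAt _ p`, `p : M`, and are only used at points `x` of
the domain of the chart, so that all the coordinate expressions below are the classical ones. -/

variable (n) in
/-- The domain of the chart at `p`. -/
def dom (p : M) : Set M := (chartAt (EuclideanSpace ℝ (Fin n)) p).source

variable [IsManifold (𝓡 n) ∞ M]

/-- The coordinate vector field `∂ᵢ` of the chart at `p`. -/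
def coordVec (p : M) (i : Fin n) (x : M) : TangentSpace (𝓡 n) x :=
  (trivializationAt (EuclideanSpace ℝ (Fin n)) (TangentSpace (𝓡 n)) p).symmL ℝ x
    (EuclideanSpace.single i (1 : ℝ))

/-- The coordinate one-form `dxⁱ` of the chart at `p`. -/
def coordCov (p : M) (i : Fin n) (x : M) : TangentSpace (𝓡 n) x →L[ℝ] ℝ :=
  (EuclideanSpace.proj i).comp
    ((trivializationAt (EuclideanSpace ℝ (Fin n)) (TangentSpace (𝓡 n)) p).continuousLinearMapAt
      ℝ x)

/-- On the domain of the chart, `coordVec p i` is the image of the `i`-th basis vector under the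
derivative of the inverse chart. -/
theorem coordVec_eq {p x : M} (hx : x ∈ dom n p) (i : Fin n) :
    coordVec p i x = mfderivWithin 𝓘(ℝ, EuclideanSpace ℝ (Fin n)) (𝓡 n)
      (extChartAt (𝓡 n) p).symm (range (𝓡 n)) (extChartAt (𝓡 n) p x)
      (EuclideanSpace.single i (1 : ℝ)) := by
  rw [coordVec, TangentBundle.symmL_trivializationAt hx]
  rfl

/-- On the domain of the chart, `coordCov p i` is the `i`-th component of the derivative of the
chart. -/
theorem coordCov_eq {p x : M} (hx : x ∈ dom n p) (i : Fin n)
    (v : TangentSpace (𝓡 n) x) :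
    coordCov p i x v = EuclideanSpace.proj (𝕜 := ℝ) i
      (mfderiv (𝓡 n) 𝓘(ℝ, EuclideanSpace ℝ (Fin n)) (extChartAt (𝓡 n) p) x v) := by
  rw [coordCov, TangentBundle.continuousLinearMapAt_trivializationAt hx]
  rfl

/-- The coordinate derivative `∂ₐ f`. -/
def pd (p : M) (a : Fin n) (f : M → ℝ) (x : M) : ℝ := mvfderiv (𝓡 n) f x (coordVec p a x)

/-- The Kronecker delta. -/
def kron (a b : Fin n) : ℝ := if a = b then 1 else 0

/-! ### Connections and their curvature -/

variable (n M) in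
/-- Connections on the tangent bundle. -/
abbrev Conn : Type _ :=
  CovariantDerivative (𝓡 n) (EuclideanSpace ℝ (Fin n)) (TangentSpace (𝓡 n) : M → Type _)

/-- A smooth torsion-free connection on the tangent bundle. -/
structure IsSmoothTorsionFree
    (D : Conn n M) : Prop where
  smooth : CovariantDerivative.ContMDiffCovariantDerivative D ∞
  torsion_eq_zero : D.torsion = 0

/-- The Christoffel symbols: `∇_{∂ₐ} ∂_b = Σ_c Γ^c_{ab} ∂_c`. -/
def christoffel (D : Conn n M) (p : M) (c a b : Fin n) (x : M) : ℝ :=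
  coordCov p c x (D (coordVec p b) x (coordVec p a x))

/-- The curvature `R_{ab}{}^c{}_d`, with `(∇ₐ∇_b - ∇_b∇ₐ) X^c = R_{ab}{}^c{}_d X^d`. -/
def riem (D : Conn n M) (p : M) (a b c d : Fin n) (x : M) : ℝ :=
  pd p a (christoffel D p c b d) x - pd p b (christoffel D p c a d) x
    + ∑ e, christoffel D p c a e x * christoffel D p e b d x
    - ∑ e, christoffel D p c b e x * christoffel D p e a d x

/-- The projective Schouten tensor `P_{ab}`, with `(n - 1) P_{ab} = R_{ca}{}^c{}_b`. -/
def schouten (D : Conn n M) (p : M) (a b : Fin n) (x : M) : ℝ :=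
  1 / ((n : ℝ) - 1) * ∑ c, riem D p c a c b x

/-- The projective Weyl curvature
`W_{ab}{}^c{}_d = R_{ab}{}^c{}_d - δₐ{}^c P_{bd} + δ_b{}^c P_{ad}`. -/
def weyl (D : Conn n M) (p : M) (a b c d : Fin n) (x : M) : ℝ :=
  riem D p a b c d x - kron a c * schouten D p b d x + kron b c * schouten D p a d x

/-- The covariant derivative `∇ₐ P_{bc}`. -/
def covSchouten (D : Conn n M) (p : M) (a b c : Fin n) (x : M) : ℝ :=
  pd p a (schouten D p b c) x
    - ∑ e, christoffel D p e a b x * schouten D p e c x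
    - ∑ e, christoffel D p e a c x * schouten D p b e x

/-- The Cotton-York tensor `Y_{abc} = ½ (∇ₐ P_{bc} - ∇_b P_{ac})`. -/
def cottonYork (D : Conn n M) (p : M) (a b c : Fin n) (x : M) : ℝ :=
  (covSchouten D p a b c x - covSchouten D p b a c x) / 2

/-! ### Parallel volume forms -/

/-- A smooth nowhere vanishing `n`-form `ε` with `∇ε = 0`. A torsion-free connection that admits
such a form is special. -/
structure IsParallelVolumeForm (D : Conn n M)
    (ε : ∀ x : M, (TangentSpace (𝓡 n) x) [⋀^Fin n]→ₗ[ℝ] ℝ) : Prop where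
  smooth : ∀ p : M, ContMDiffOn (𝓡 n) 𝓘(ℝ, ℝ) ∞
    (fun x ↦ ε x (fun i ↦ coordVec p i x)) (dom n p)
  ne_zero : ∀ x, ε x ≠ 0
  parallel : ∀ (p : M), ∀ x ∈ dom n p, ∀ (a : Fin n) (b : Fin n → Fin n),
    pd p a (fun y ↦ ε y (fun i ↦ coordVec p (b i) y)) x
      - ∑ i, ε x (Function.update (fun j ↦ coordVec p (b j) x) i
          (D (coordVec p (b i)) x (coordVec p a x))) = 0

/-! ### Projective equivalence -/

/-- `γ` is an (affinely parametrised) geodesic of `D` on the open set `J` of times. Twice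
continuously differentiable geodesics are automatically smooth. -/
def IsGeodesicOn (D : Conn n M) (γ : ℝ → M) (J : Set ℝ) : Prop :=
  ContMDiffOn 𝓘(ℝ, ℝ) (𝓡 n) 2 γ J ∧
  ∀ t ∈ J, ∀ p : M, γ t ∈ dom n p → ∀ k : Fin n,
    deriv (deriv fun s ↦ extChartAt (𝓡 n) p (γ s) k) t
      + ∑ i, ∑ j, christoffel D p k i j (γ t)
          * deriv (fun s ↦ extChartAt (𝓡 n) p (γ s) i) t
          * deriv (fun s ↦ extChartAt (𝓡 n) p (γ s) j) t = 0

/-- Every geodesic of `D`, defined on an open interval `J`, becomes a geodesic of `D'` after a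
regular change of parameter `φ : J' → J`. -/
def GeodesicsReparametrise (D D' : Conn n M) : Prop :=
  ∀ (γ : ℝ → M) (J : Set ℝ), IsOpen J → J.OrdConnected → IsGeodesicOn D γ J →
    ∃ (φ : ℝ → ℝ) (J' : Set ℝ), IsOpen J' ∧ J'.OrdConnected ∧ ContDiffOn ℝ 2 φ J' ∧
      (∀ t ∈ J', deriv φ t ≠ 0) ∧ φ '' J' = J ∧ IsGeodesicOn D' (γ ∘ φ) J'

/-- Projective equivalence: `D` and `D'` have the same geodesics as unparameterised curves. -/
def ProjectivelyEquivalent (D D' : Conn n M) : Prop :=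
  GeodesicsReparametrise D D' ∧ GeodesicsReparametrise D' D

/-! ### Metric connections -/

variable (n M) in
/-- Smooth Riemannian metrics on `M`. -/
abbrev Metric : Type _ :=
  ContMDiffRiemannianMetric (𝓡 n) ∞ (EuclideanSpace ℝ (Fin n)) (TangentSpace (𝓡 n) : M → Type _)

/-- `D` is the metric (Levi-Civita) connection of `g`: it is torsion-free and
`v (g(Y, Z)) = g(∇_v Y, Z) + g(Y, ∇_v Z)`. -/
structure IsMetricConnection
    (D : Conn n M) (g : Metric n M) : Prop where
  smoothTorsionFree : IsSmoothTorsionFree D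
  metric : ∀ (x : M) (Y Z : ∀ x : M, TangentSpace (𝓡 n) x) (v : TangentSpace (𝓡 n) x),
    MDifferentiableAt (𝓡 n) (𝓡 n).tangent
      (fun y ↦ (TotalSpace.mk' (EuclideanSpace ℝ (Fin n)) y (Y y) : TangentBundle (𝓡 n) M)) x →
    MDifferentiableAt (𝓡 n) (𝓡 n).tangent
      (fun y ↦ (TotalSpace.mk' (EuclideanSpace ℝ (Fin n)) y (Z y) : TangentBundle (𝓡 n) M)) x →
    mvfderiv (𝓡 n) (fun y ↦ g.inner y (Y y) (Z y)) x v
      = g.inner x (D Y x v) (Z x) + g.inner x (Y x) (D Z x v)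

/-- The metric connections that are projectively equivalent to `D`. A metric connection is given
together with the metric of which it is the Levi-Civita connection, and is determined by it. -/
def MetricConnections
    (D : Conn n M) : Type _ :=
  {g : Metric n M // ∃ D' : Conn n M, IsMetricConnection D' g ∧ ProjectivelyEquivalent D D'}

/-! ### The modified tractor equation -/

variable (n M) in
/-- Smooth sections `(σ^{bc}, μ^b, ρ)` of `⊙²TM ⊕ TM ⊕ ℝ`; here `σ` is regarded as a symmetric
bilinear form on covectors. -/
@[ext]
structure TractorSection where
  σ : ∀ x : M, LinearMap.BilinForm ℝ (TangentSpace (𝓡 n) x →L[ℝ] ℝ)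
  μ : ∀ x : M, TangentSpace (𝓡 n) x
  ρ : M → ℝ
  symm : ∀ x α β, σ x α β = σ x β α
  smooth_σ : ∀ (p : M) (b c : Fin n), ContMDiffOn (𝓡 n) 𝓘(ℝ, ℝ) ∞
    (fun x ↦ σ x (coordCov p b x) (coordCov p c x)) (dom n p)
  smooth_μ : ∀ (p : M) (b : Fin n), ContMDiffOn (𝓡 n) 𝓘(ℝ, ℝ) ∞
    (fun x ↦ coordCov p b x (μ x)) (dom n p)
  smooth_ρ : ContMDiff (𝓡 n) 𝓘(ℝ, ℝ) ∞ ρ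

namespace TractorSection

variable (s : TractorSection n M)

/-- The component `σ^{bc}`. -/
def compσ (p : M) (b c : Fin n) (x : M) : ℝ := s.σ x (coordCov p b x) (coordCov p c x)

/-- The component `μ^b`. -/
def compμ (p : M) (b : Fin n) (x : M) : ℝ := coordCov p b x (s.μ x)

/-- `∇ₐ σ^{bc}`. -/
def covσ (D : Conn n M) (p : M) (a b c : Fin n) (x : M) : ℝ :=
  pd p a (s.compσ p b c) x
    + ∑ d, christoffel D p b a d x * s.compσ p d c x
    + ∑ d, christoffel D p c a d x * s.compσ p b d x

/-- `∇ₐ μ^b`. -/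
def covμ (D : Conn n M) (p : M) (a b : Fin n) (x : M) : ℝ :=
  pd p a (s.compμ p b) x + ∑ d, christoffel D p b a d x * s.compμ p d x

/-- Top slot of the tractor connection. -/
def tractorσ (D : Conn n M) (p : M) (a b c : Fin n) (x : M) : ℝ :=
  s.covσ D p a b c x - kron a b * s.compμ p c x - kron a c * s.compμ p b x

/-- Middle slot of the tractor connection. -/
def tractorμ (D : Conn n M) (p : M) (a b : Fin n) (x : M) : ℝ :=
  s.covμ D p a b x - kron a b * s.ρ x + ∑ c, schouten D p a c x * s.compσ p b c x

/-- Bottom slot of the tractor connection. -/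
def tractorρ (D : Conn n M) (p : M) (a : Fin n) (x : M) : ℝ :=
  pd p a s.ρ x + 2 * ∑ b, schouten D p a b x * s.compμ p b x

/-- The modified tractor equation. -/
structure IsSolution (D : Conn n M) : Prop where
  top : ∀ (p : M), ∀ x ∈ dom n p, ∀ a b c : Fin n, s.tractorσ D p a b c x = 0
  middle : ∀ (p : M), ∀ x ∈ dom n p, ∀ a b : Fin n,
    s.tractorμ D p a b x
      - 1 / (n : ℝ) * ∑ c, ∑ d, weyl D p a c b d x * s.compσ p c d x = 0
  bottom : ∀ (p : M), ∀ x ∈ dom n p, ∀ a : Fin n,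
    s.tractorρ D p a x
      - 1 / (n : ℝ) * ∑ b, ∑ c, 4 * cottonYork D p a b c x * s.compσ p b c x = 0

/-- `σ^{bc}` is positive definite. -/
def IsPosDef : Prop := ∀ (x : M) (α : TangentSpace (𝓡 n) x →L[ℝ] ℝ), α ≠ 0 → 0 < s.σ x α α

/-- The function `det(σ) = (1/n!) ε_{a⋯b} ε_{c⋯d} σ^{ac} ⋯ σ^{bd} = (ε_{1⋯n})² det(σ^{ij})`,
computed in the chart at `p`; its value does not depend on the chart. It is `1` exactly when
`±ε` is the volume form of the metric with inverse `σ^{bc}`. -/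
def det (ε : ∀ x : M, (TangentSpace (𝓡 n) x) [⋀^Fin n]→ₗ[ℝ] ℝ) (p x : M) : ℝ :=
  (ε x fun i ↦ coordVec p i x) ^ 2 * Matrix.det (Matrix.of fun b c ↦ s.compσ p b c x)

end TractorSection

/-- The solutions of the modified tractor equation with positive definite `σ^{bc}`. -/
def PosDefSolutions (D : Conn n M) : Type _ :=
  {s : TractorSection n M // s.IsSolution D ∧ s.IsPosDef}

/-- The component `g_{ab}`. -/
def compMetric (g : Metric n M) (p : M) (a b : Fin n) (x : M) : ℝ :=
  g.inner x (coordVec p a x) (coordVec p b x)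

/-- The inverse of the metric `g` is `g^{ab} = det(σ) σ^{ab}`. -/
def HasInverseDetSmul
    (ε : ∀ x : M, (TangentSpace (𝓡 n) x) [⋀^Fin n]→ₗ[ℝ] ℝ) (s : TractorSection n M)
    (g : Metric n M) : Prop :=
  ∀ (p : M), ∀ x ∈ dom n p, ∀ a b : Fin n,
    ∑ c, compMetric g p a c x * (s.det ε p x * s.compσ p c b x) = kron a b

end ProjMetric

end

set_option linter.unusedSectionVars false

noncomputable section

namespace ProjMetric

variable {n : ℕ} {M : Type*} [TopologicalSpace M] [ChartedSpace (EuclideanSpace ℝ (Fin n)) M]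
variable [IsManifold (𝓡 n) ∞ M]

/-! ### Coordinate frames -/

/-! The geometric core is the equation in the top slot of the tractor system, ∇_a σ^{bc} = δ_a^b μ^c
+ δ_a^c μ^b; the two lower slots are its differential consequences.

From solutions to metrics: let σ be positive definite and put h = -½ log det(σ). Since ε is
parallel, Jacobi's formula applied to the top equation gives μ = -σ(dh, ·) (`IsSolution.compμ_eq`).
The terms in μ can then be absorbed into the connection: the inverse metric det(σ)σ is parallel for
the torsion-free connection ∇ + δ⊗dh + dh⊗δ, which is therefore its Levi-Civita connection
(`isMetricConnection_projChange`). It has the same geodesics as ∇ after the change of parameter φ' =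
exp(-2h) along the curve (`geodesicsReparametrise_of_christoffel`).

From metrics to solutions: if the Levi-Civita connection of g has the same unparametrised geodesics,
the difference of the Christoffel symbols maps (v, v) to a multiple of v, and polarisation makes it
δ⊗υ + υ⊗δ (`exists_parallel`, `eq_of_forall_parallel`). Taking traces and comparing the volume form
of g with ε shows that υ = dh, where det g = e^{2(n+1)h} ε² in components
(`chr_eq_of_geodesicsReparametrise`). Then σ = e^{2h} g⁻¹ and μ = -σ(dh, ·) solve the top equation,
and det(σ) = e^{-2h}, so det(σ)σ = g⁻¹.

The lower slots come from prolongation (`prolongation`). Commuting derivatives of σ determines ∇μ up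
to its trace; the divergence of that formula, combined with the Bianchi identities, determines the
derivative of the trace. The parallel volume form makes the Ricci tensor symmetric, which is needed
here. The component ρ is forced: in the trace of the middle slot the Weyl term vanishes, so nρ = ∇_b
μ^b + P_{bc} σ^{bc}. Chart independence of this expression requires the tensor law of the curvature.

Injectivity: det(g⁻¹) ε² = det(σ)^{n+1} recovers det(σ) from g, hence σ, then μ, then ρ
(`eq_of_toMetric_eq`). -/

omit [IsManifold (𝓡 n) ∞ M] in
theorem isOpen_dom (p : M) : IsOpen (dom n p) := (chartAt (EuclideanSpace ℝ (Fin n)) p).open_source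

omit [IsManifold (𝓡 n) ∞ M] in
theorem mem_dom_self (p : M) : p ∈ dom n p := mem_chart_source _ p

omit [IsManifold (𝓡 n) ∞ M] in
theorem dom_mem_nhds {p x : M} (hx : x ∈ dom n p) : dom n p ∈ nhds x := (isOpen_dom p).mem_nhds hx

theorem mem_baseSet {p x : M} (hx : x ∈ dom n p) :
    x ∈ (trivializationAt (EuclideanSpace ℝ (Fin n)) (TangentSpace (𝓡 n)) p).baseSet := by
  rwa [TangentBundle.trivializationAt_baseSet]

theorem coordCov_coordVec {p x : M} (hx : x ∈ dom n p) (i j : Fin n) :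
    coordCov p i x (coordVec p j x) = kron i j := by
  rw [coordCov, coordVec, ContinuousLinearMap.comp_apply,
    Trivialization.continuousLinearMapAt_symmL _ (mem_baseSet hx)]
  simp [kron, PiLp.single_apply]

theorem sum_coordCov_smul {p x : M} (hx : x ∈ dom n p) (v : TangentSpace (𝓡 n) x) :
    ∑ i, coordCov p i x v • coordVec p i x = v := by
  have h := Trivialization.symmL_continuousLinearMapAt (R := ℝ)
    (trivializationAt (EuclideanSpace ℝ (Fin n)) (TangentSpace (𝓡 n)) p) (mem_baseSet hx) v
  conv_rhs => rw [← h]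
  set w := (trivializationAt (EuclideanSpace ℝ (Fin n)) (TangentSpace (𝓡 n)) p).continuousLinearMapAt
    ℝ x v with hw
  have hsum : w = ∑ i, w i • EuclideanSpace.single i (1 : ℝ) := by
    ext j
    simp [Pi.single_apply]
  conv_rhs => rw [hsum]
  simp only [map_sum, map_smul]
  rfl

/-- The zero default makes coordinate derivatives and Christoffel symbols vanish off the chart.
Identities between functions on all of `M`, as needed for `smoothRing`, then hold there trivially.
-/
theorem coordVec_of_notMem {p x : M} (hx : x ∉ dom n p) (i : Fin n) : coordVec p i x = 0 := by
  have : x ∉ (trivializationAt (EuclideanSpace ℝ (Fin n)) (TangentSpace (𝓡 n)) p).baseSet := by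
    rwa [TangentBundle.trivializationAt_baseSet]
  rw [coordVec, Trivialization.symmL_apply_of_notMem _ this]

theorem coordCov_of_notMem {p x : M} (hx : x ∉ dom n p) (i : Fin n) : coordCov p i x = 0 := by
  have : x ∉ (trivializationAt (EuclideanSpace ℝ (Fin n)) (TangentSpace (𝓡 n)) p).baseSet := by
    rwa [TangentBundle.trivializationAt_baseSet]
  rw [coordCov, Trivialization.continuousLinearMapAt]
  ext v
  simp [Trivialization.linearMapAt_def_of_notMem _ this]

theorem eq_of_coordCov_eq {p x : M} (hx : x ∈ dom n p) {v w : TangentSpace (𝓡 n) x}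
    (h : ∀ i, coordCov p i x v = coordCov p i x w) : v = w := by
  rw [← sum_coordCov_smul hx v, ← sum_coordCov_smul hx w]
  simp [h]

theorem sum_apply_coordVec_smul {p x : M} (hx : x ∈ dom n p) (α : TangentSpace (𝓡 n) x →L[ℝ] ℝ) :
    ∑ i, α (coordVec p i x) • coordCov p i x = α := by
  ext v
  conv_rhs => rw [← sum_coordCov_smul hx v]
  simp [mul_comm]

/-! ### Smooth and differentiable functions and vector fields -/

variable (n) in
/-- `f` is differentiable at `x`. -/
abbrev DiffFn (f : M → ℝ) (x : M) : Prop := MDifferentiableAt (𝓡 n) 𝓘(ℝ, ℝ) f x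

variable (n) in
/-- `f` is smooth near `x`. -/
abbrev SmoothFn (f : M → ℝ) (x : M) : Prop := ContMDiffAt (𝓡 n) 𝓘(ℝ, ℝ) ∞ f x

/-- The vector field `X` is differentiable at `x`. -/
abbrev DiffSec (X : ∀ x : M, TangentSpace (𝓡 n) x) (x : M) : Prop :=
  MDifferentiableAt (𝓡 n) (𝓡 n).tangent
    (fun y ↦ (TotalSpace.mk' (EuclideanSpace ℝ (Fin n)) y (X y) : TangentBundle (𝓡 n) M)) x

/-- The vector field `X` is smooth near `x`. -/
abbrev SmoothSec (X : ∀ x : M, TangentSpace (𝓡 n) x) (x : M) : Prop :=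
  ContMDiffAt (𝓡 n) (𝓡 n).tangent ∞
    (fun y ↦ (TotalSpace.mk' (EuclideanSpace ℝ (Fin n)) y (X y) : TangentBundle (𝓡 n) M)) x

omit [IsManifold (𝓡 n) ∞ M] in
theorem SmoothFn.diff {f : M → ℝ} {x : M} (h : SmoothFn n f x) : DiffFn n f x :=
  h.mdifferentiableAt (by simp)

theorem SmoothSec.diff {X : ∀ x : M, TangentSpace (𝓡 n) x} {x : M} (h : SmoothSec X x) :
    DiffSec X x :=
  h.mdifferentiableAt (by simp)

theorem coordCov_apply_eq {p x : M} (hx : x ∈ dom n p) (i : Fin n) (v : TangentSpace (𝓡 n) x) :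
    coordCov p i x v = (trivializationAt (EuclideanSpace ℝ (Fin n)) (TangentSpace (𝓡 n)) p
      (TotalSpace.mk' (EuclideanSpace ℝ (Fin n)) x v)).2 i := by
  rw [coordCov, ContinuousLinearMap.comp_apply,
    Trivialization.continuousLinearMapAt_apply, Trivialization.coe_linearMapAt_of_mem _ (mem_baseSet hx)]
  rfl

theorem contMDiffAt_euclidean {f : M → EuclideanSpace ℝ (Fin n)} {x : M} :
    ContMDiffAt (𝓡 n) 𝓘(ℝ, EuclideanSpace ℝ (Fin n)) ∞ f x ↔ ∀ i, SmoothFn n (fun y ↦ f y i) x := by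
  refine ⟨fun h i ↦ (EuclideanSpace.proj (𝕜 := ℝ) i).contMDiff.contMDiffAt.comp x h, fun h ↦ ?_⟩
  exact (PiLp.continuousLinearEquiv 2 ℝ (fun _ : Fin n ↦ ℝ)).symm.toContinuousLinearMap.contMDiff.contMDiffAt.comp x
    (contMDiffAt_pi_space.2 h)

theorem mdifferentiableAt_finsetSum {F : Type*} [NormedAddCommGroup F] [NormedSpace ℝ F]
    {ι : Type*} {s : Finset ι} {f : ι → M → F} {x : M}
    (hf : ∀ i ∈ s, MDifferentiableAt (𝓡 n) 𝓘(ℝ, F) (f i) x) :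
    MDifferentiableAt (𝓡 n) 𝓘(ℝ, F) (fun y ↦ ∑ i ∈ s, f i y) x := by
  classical
  induction s using Finset.induction_on with
  | empty => simpa using! mdifferentiableAt_const
  | insert i s hi ih =>
    simp only [Finset.sum_insert hi]
    exact (hf i (Finset.mem_insert_self i s)).add (ih fun j hj ↦ hf j (Finset.mem_insert_of_mem hj))

theorem mdifferentiableAt_euclidean {f : M → EuclideanSpace ℝ (Fin n)} {x : M} :
    MDifferentiableAt (𝓡 n) 𝓘(ℝ, EuclideanSpace ℝ (Fin n)) f x ↔
      ∀ i, DiffFn n (fun y ↦ f y i) x := by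
  refine ⟨fun h i ↦ (EuclideanSpace.proj (𝕜 := ℝ) i).mdifferentiableAt.comp x h, fun h ↦ ?_⟩
  have hsum : f = fun y ↦ ∑ i, ContinuousLinearMap.toSpanSingleton ℝ
      (EuclideanSpace.single i (1 : ℝ)) (f y i) := by
    ext y j
    simp [Pi.single_apply]
  rw [hsum]
  exact mdifferentiableAt_finsetSum fun i _ ↦ (ContinuousLinearMap.toSpanSingleton ℝ
    (EuclideanSpace.single i (1 : ℝ))).mdifferentiableAt.comp x (h i)

theorem smoothSec_iff {p x : M} (hx : x ∈ dom n p) {X : ∀ x : M, TangentSpace (𝓡 n) x} :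
    SmoothSec X x ↔ ∀ i, SmoothFn n (fun y ↦ coordCov p i y (X y)) x := by
  refine (Trivialization.contMDiffAt_section_iff (IB := 𝓡 n) _ (mem_baseSet hx)).trans ?_
  rw [contMDiffAt_euclidean]
  refine forall_congr' fun i ↦ Filter.EventuallyEq.contMDiffAt_iff ?_
  filter_upwards [dom_mem_nhds hx] with y hy
  exact (coordCov_apply_eq hy i (X y)).symm

theorem diffSec_iff {p x : M} (hx : x ∈ dom n p) {X : ∀ x : M, TangentSpace (𝓡 n) x} :
    DiffSec X x ↔ ∀ i, DiffFn n (fun y ↦ coordCov p i y (X y)) x := by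
  refine (Trivialization.mdifferentiableAt_section_iff (𝓡 n) _ X (mem_baseSet hx)).trans ?_
  rw [mdifferentiableAt_euclidean]
  refine forall_congr' fun i ↦ Filter.EventuallyEq.mdifferentiableAt_iff ?_
  filter_upwards [dom_mem_nhds hx] with y hy
  exact (coordCov_apply_eq hy i (X y)).symm

theorem smoothSec_coordVec {p x : M} (hx : x ∈ dom n p) (i : Fin n) :
    SmoothSec (coordVec p i) x := by
  rw [smoothSec_iff hx]
  intro j
  refine (contMDiffAt_const (c := kron j i)).congr_of_eventuallyEq ?_
  filter_upwards [dom_mem_nhds hx] with y hy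
  exact coordCov_coordVec hy j i

/-! ### Coordinate derivatives -/

theorem mvfderiv_congr {f g : M → ℝ} {x : M} (h : f =ᶠ[nhds x] g) :
    mvfderiv (𝓡 n) f x = mvfderiv (𝓡 n) g x := by
  ext v
  simp only [mvfderiv]
  rw [h.mfderiv_eq]
  rfl

theorem pd_congr {f g : M → ℝ} {x : M} (h : f =ᶠ[nhds x] g) (p : M) (a : Fin n) :
    pd p a f x = pd p a g x := by
  rw [pd, pd, mvfderiv_congr h]

theorem pd_congr_dom {f g : M → ℝ} {p x : M} (hx : x ∈ dom n p) (h : ∀ y ∈ dom n p, f y = g y)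
    (a : Fin n) : pd p a f x = pd p a g x :=
  pd_congr (Filter.eventuallyEq_of_mem (dom_mem_nhds hx) h) p a

theorem pd_of_notMem {p x : M} (hx : x ∉ dom n p) (a : Fin n) (f : M → ℝ) : pd p a f x = 0 := by
  rw [pd, coordVec_of_notMem hx, map_zero]

theorem pd_const (p : M) (a : Fin n) (c : ℝ) (x : M) : pd p a (fun _ : M ↦ c) x = 0 := by
  rw [pd, mvfderiv_const]
  rfl

theorem pd_add {f g : M → ℝ} {x : M} (hf : DiffFn n f x) (hg : DiffFn n g x) (p : M) (a : Fin n) :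
    pd p a (fun y ↦ f y + g y) x = pd p a f x + pd p a g x := by
  rw [pd, mvfderiv_fun_add hf hg]; rfl

theorem pd_sub {f g : M → ℝ} {x : M} (hf : DiffFn n f x) (hg : DiffFn n g x) (p : M) (a : Fin n) :
    pd p a (fun y ↦ f y - g y) x = pd p a f x - pd p a g x := by
  rw [pd, mvfderiv_fun_sub hf hg]; rfl

theorem pd_neg (f : M → ℝ) (x p : M) (a : Fin n) :
    pd p a (fun y ↦ - f y) x = - pd p a f x := by
  rw [pd, mvfderiv_fun_neg]; rfl

theorem pd_mul {f g : M → ℝ} {x : M} (hf : DiffFn n f x) (hg : DiffFn n g x) (p : M) (a : Fin n) :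
    pd p a (fun y ↦ f y * g y) x = f x * pd p a g x + g x * pd p a f x := by
  rw [pd, mvfderiv_fun_mul hf hg]; rfl

theorem pd_const_mul {f : M → ℝ} {x : M} (c : ℝ) (hf : DiffFn n f x) (p : M) (a : Fin n) :
    pd p a (fun y ↦ c * f y) x = c * pd p a f x := by
  rw [pd_mul mdifferentiableAt_const hf, pd_const]; ring

theorem pd_sum {ι : Type*} {s : Finset ι} {f : ι → M → ℝ} {x : M}
    (hf : ∀ i ∈ s, DiffFn n (f i) x) (p : M) (a : Fin n) :
    pd p a (fun y ↦ ∑ i ∈ s, f i y) x = ∑ i ∈ s, pd p a (f i) x := by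
  classical
  induction s using Finset.induction_on with
  | empty => simpa using pd_const p a 0 x
  | insert i s hi ih =>
    simp only [Finset.sum_insert hi]
    have h1 : ∀ j ∈ s, DiffFn n (f j) x := fun j hj ↦ hf j (Finset.mem_insert_of_mem hj)
    rw [pd_add (hf i (Finset.mem_insert_self i s)) (mdifferentiableAt_finsetSum h1), ih h1]

theorem mvfderiv_apply {p x : M} (hx : x ∈ dom n p) (f : M → ℝ) (v : TangentSpace (𝓡 n) x) :
    mvfderiv (𝓡 n) f x v = ∑ i, coordCov p i x v * pd p i f x := by
  conv_lhs => rw [← sum_coordCov_smul hx v]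
  simp [pd]

/-- The coordinate function `x^k` of the chart at `p`. -/
def coordFn (p : M) (k : Fin n) (x : M) : ℝ := extChartAt (𝓡 n) p x k

theorem smoothFn_coordFn {p x : M} (hx : x ∈ dom n p) (k : Fin n) : SmoothFn n (coordFn p k) x := by
  have h : ContMDiffAt (𝓡 n) 𝓘(ℝ, EuclideanSpace ℝ (Fin n)) ∞ (extChartAt (𝓡 n) p) x :=
    contMDiffAt_extChartAt' hx
  exact (EuclideanSpace.proj (𝕜 := ℝ) k).contMDiff.contMDiffAt.comp x h

theorem mvfderiv_coordFn {p x : M} (hx : x ∈ dom n p) (k : Fin n) (v : TangentSpace (𝓡 n) x) :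
    mvfderiv (𝓡 n) (coordFn p k) x v = coordCov p k x v := by
  have h : MDifferentiableAt (𝓡 n) 𝓘(ℝ, EuclideanSpace ℝ (Fin n)) (extChartAt (𝓡 n) p) x :=
    mdifferentiableAt_extChartAt hx
  have h2 := mvfderiv_comp_apply (g := EuclideanSpace.proj (𝕜 := ℝ) k) x
    (EuclideanSpace.proj (𝕜 := ℝ) k).mdifferentiableAt h v
  rw [coordCov_eq hx]
  refine h2.trans ?_
  simp only [mvfderiv, ContinuousLinearMap.mfderiv_eq]
  rfl

/-- The coordinate representation of `f` in the chart at `p`. -/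
def chartRep (p : M) (f : M → ℝ) (z : EuclideanSpace ℝ (Fin n)) : ℝ := f ((extChartAt (𝓡 n) p).symm z)

theorem smoothFn_iff {p x : M} (hx : x ∈ dom n p) {f : M → ℝ} :
    SmoothFn n f x ↔ ContDiffAt ℝ ∞ (chartRep p f) (extChartAt (𝓡 n) p x) := by
  have h := contMDiffAt_iff_source_of_mem_source (I := 𝓡 n) (I' := 𝓘(ℝ, ℝ)) (n := ∞) (f := f) hx
  rw [SmoothFn, h, ← contMDiffAt_iff_contDiffAt]
  simp [contMDiffWithinAt_univ]
  rfl

/-- Chain rule for f composed with the inverse chart, whose derivative sends the a-th basis vector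
to ∂ₐ. It moves smoothness and commutation of coordinate derivatives to the model space. -/
theorem pd_eq_fderiv {p x : M} (hx : x ∈ dom n p) {f : M → ℝ} (hf : DiffFn n f x) (a : Fin n) :
    pd p a f x = fderiv ℝ (chartRep p f) (extChartAt (𝓡 n) p x) (EuclideanSpace.single a 1) := by
  have hx' : x ∈ (extChartAt (𝓡 n) p).source := by rwa [extChartAt_source]
  have h1 := (mdifferentiableWithinAt_extChartAt_symm (I := 𝓡 n)
    ((extChartAt (𝓡 n) p).map_source hx'))
  simp only [ModelWithCorners.range_eq_univ, mdifferentiableWithinAt_univ] at h1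
  have hinv := (extChartAt (𝓡 n) p).left_inv hx'
  have h2 := mfderiv_comp_apply_of_eq (I := 𝓘(ℝ, EuclideanSpace ℝ (Fin n))) (I' := 𝓡 n) (I'' := 𝓘(ℝ, ℝ)) (g := f) _ hf h1 hinv (EuclideanSpace.single a 1)
  have h3 : pd p a f x = mfderiv (𝓡 n) 𝓘(ℝ, ℝ) f x (coordVec p a x) := rfl
  have h4 : mfderiv 𝓘(ℝ, EuclideanSpace ℝ (Fin n)) 𝓘(ℝ, ℝ) (f ∘ (extChartAt (𝓡 n) p).symm)
      (extChartAt (𝓡 n) p x) = fderiv ℝ (chartRep p f) (extChartAt (𝓡 n) p x) := by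
    rw [mfderiv_eq_fderiv]; rfl
  rw [h3, coordVec_eq hx, ModelWithCorners.range_eq_univ, mfderivWithin_univ]
  rw [h4] at h2
  refine Eq.trans ?_ h2.symm
  congr 2

theorem SmoothFn.eventually_diff {f : M → ℝ} {x : M} (h : SmoothFn n f x) :
    ∀ᶠ y in nhds x, DiffFn n f y := by
  have h0 : ContMDiffAt (𝓡 n) 𝓘(ℝ, ℝ) 1 f x := h.of_le (by simp)
  have h1 := (contMDiffAt_iff_contMDiffAt_nhds (I := 𝓡 n) (I' := 𝓘(ℝ, ℝ)) (by simp)).1 h0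
  filter_upwards [h1] with y hy using hy.mdifferentiableAt (by simp)

theorem chartRep_pd {p x : M} (hx : x ∈ dom n p) {f : M → ℝ} (hf : SmoothFn n f x) (a : Fin n) :
    chartRep p (pd p a f) =ᶠ[nhds (extChartAt (𝓡 n) p x)]
      fun z ↦ fderiv ℝ (chartRep p f) z (EuclideanSpace.single a 1) := by
  have hx' : x ∈ (extChartAt (𝓡 n) p).source := by rwa [extChartAt_source]
  have hinv := (extChartAt (𝓡 n) p).left_inv hx'
  have hc : ContinuousAt (extChartAt (𝓡 n) p).symm (extChartAt (𝓡 n) p x) :=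
    continuousAt_extChartAt_symm' hx'
  have hev := hf.eventually_diff.and (dom_mem_nhds hx)
  rw [← hinv] at hev
  filter_upwards [hc.eventually hev, extChartAt_target_mem_nhds' ((extChartAt (𝓡 n) p).map_source hx')] with z hz hzt
  have := pd_eq_fderiv hz.2 hz.1 a
  rw [(extChartAt (𝓡 n) p).right_inv hzt] at this
  exact this

theorem SmoothFn.pd {p x : M} (hx : x ∈ dom n p) {f : M → ℝ} (hf : SmoothFn n f x) (a : Fin n) :
    SmoothFn n (pd p a f) x := by
  rw [smoothFn_iff hx]
  refine ContDiffAt.congr_of_eventuallyEq ?_ (chartRep_pd hx hf a)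
  exact (((smoothFn_iff hx).1 hf).fderiv_right (m := ∞) (by simp)).clm_apply contDiffAt_const

theorem pd_comm {p x : M} (hx : x ∈ dom n p) {f : M → ℝ} (hf : SmoothFn n f x) (a b : Fin n) :
    pd p a (pd p b f) x = pd p b (pd p a f) x := by
  have hF := (smoothFn_iff hx).1 hf
  have hd : DifferentiableAt ℝ (fderiv ℝ (chartRep p f)) (extChartAt (𝓡 n) p x) :=
    (hF.fderiv_right (m := ∞) (by simp)).differentiableAt (by simp)
  -- An iterated coordinate derivative is the second Fréchet derivative of the chart representation
  -- on two basis vectors, and that is symmetric.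
  have key : ∀ a b : Fin n, ProjMetric.pd p a (ProjMetric.pd p b f) x =
      fderiv ℝ (fderiv ℝ (chartRep p f)) (extChartAt (𝓡 n) p x) (EuclideanSpace.single a 1)
        (EuclideanSpace.single b 1) := by
    intro a b
    rw [pd_eq_fderiv hx (hf.pd hx b).diff, (chartRep_pd hx hf b).fderiv_eq,
      fderiv_clm_apply hd (differentiableAt_const _)]
    simp
  rw [key, key]
  exact (hF.isSymmSndFDerivAt (by simpa using WithTop.coe_le_coe.2 (le_top : (2 : ℕ∞) ≤ ⊤))) _ _

end ProjMetric
end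

noncomputable section

namespace ProjMetric

variable {n : ℕ} {M : Type*} [TopologicalSpace M] [ChartedSpace (EuclideanSpace ℝ (Fin n)) M]
variable [IsManifold (𝓡 n) ∞ M]

/-! ### Connections in coordinates -/

theorem DiffSec.smul {f : M → ℝ} {X : ∀ x : M, TangentSpace (𝓡 n) x} {x : M} (hf : DiffFn n f x)
    (hX : DiffSec X x) : DiffSec (f • X) x := by
  rw [diffSec_iff (mem_dom_self x)] at *
  exact fun i ↦ (hf.mul (hX i)).congr_of_eventuallyEq (.of_forall fun y ↦ by simp)

theorem DiffSec.sum {ι : Type*} (s : Finset ι) {X : ι → ∀ x : M, TangentSpace (𝓡 n) x} {x : M}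
    (hX : ∀ i ∈ s, DiffSec (X i) x) : DiffSec (∑ i ∈ s, X i) x := by
  rw [diffSec_iff (mem_dom_self x)]
  intro j
  refine (mdifferentiableAt_finsetSum (s := s) (f := fun i y ↦ coordCov x j y (X i y))
    fun i hi ↦ (diffSec_iff (mem_dom_self x)).1 (hX i hi) j).congr_of_eventuallyEq (.of_forall fun y ↦ ?_)
  simp

theorem conn_congr (D : Conn n M) {X Y : ∀ x : M, TangentSpace (𝓡 n) x} {x : M}
    (hX : DiffSec X x) (hY : DiffSec Y x) (h : ∀ᶠ y in nhds x, X y = Y y) : D X x = D Y x :=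
  D.isCovariantDerivativeOnUniv.congr_of_eventuallyEq hX hY Filter.univ_mem h

theorem conn_sum (D : Conn n M) {ι : Type*} (s : Finset ι) {X : ι → ∀ x : M, TangentSpace (𝓡 n) x}
    {x : M} (hX : ∀ i ∈ s, DiffSec (X i) x) : D (∑ i ∈ s, X i) x = ∑ i ∈ s, D (X i) x := by
  classical
  induction s using Finset.induction_on with
  | empty => simp
  | insert i s hi ih =>
    have h1 : ∀ j ∈ s, DiffSec (X j) x := fun j hj ↦ hX j (Finset.mem_insert_of_mem hj)
    rw [Finset.sum_insert hi, Finset.sum_insert hi, D.isCovariantDerivativeOnUniv.add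
      (hX i (Finset.mem_insert_self i s)) (DiffSec.sum s h1) (mem_univ x), ih h1]

theorem conn_smul (D : Conn n M) {f : M → ℝ} {X : ∀ x : M, TangentSpace (𝓡 n) x} {x : M}
    (hf : DiffFn n f x) (hX : DiffSec X x) (v : TangentSpace (𝓡 n) x) :
    D (f • X) x v = f x • D X x v + mvfderiv (𝓡 n) f x v • X x := by
  rw [D.isCovariantDerivativeOnUniv.leibniz hX hf (mem_univ x)]
  simp

theorem coordCov_conn_coordVec (D : Conn n M) (p : M) {x : M} (hx : x ∈ dom n p) (b c : Fin n)
    (v : TangentSpace (𝓡 n) x) :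
    coordCov p c x (D (coordVec p b) x v) = ∑ a, christoffel D p c a b x * coordCov p a x v := by
  conv_lhs => rw [← sum_coordCov_smul hx v]
  simp [christoffel, mul_comm]

theorem eventually_eq_sum_coordVec {p x : M} (hx : x ∈ dom n p) (X : ∀ x : M, TangentSpace (𝓡 n) x) :
    ∀ᶠ y in nhds x, X y = (∑ i, (fun y ↦ coordCov p i y (X y)) • coordVec p i) y := by
  filter_upwards [dom_mem_nhds hx] with y hy
  conv_lhs => rw [← sum_coordCov_smul hy (X y)]
  simp

/-- The components of the covariant derivative of a vector field. -/
theorem coordCov_conn (D : Conn n M) {p x : M} (hx : x ∈ dom n p)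
    {X : ∀ x : M, TangentSpace (𝓡 n) x} (hX : DiffSec X x) (c : Fin n) (v : TangentSpace (𝓡 n) x) :
    coordCov p c x (D X x v) = mvfderiv (𝓡 n) (fun y ↦ coordCov p c y (X y)) x v
      + ∑ a, ∑ b, christoffel D p c a b x * coordCov p a x v * coordCov p b x (X x) := by
  have hf := (diffSec_iff hx).1 hX
  have hi : ∀ i ∈ Finset.univ, DiffSec ((fun y ↦ coordCov p i y (X y)) • coordVec p i) x :=
    fun i _ ↦ DiffSec.smul (hf i) (smoothSec_coordVec hx i).diff
  -- `D` depends only on the germ of the field, so `X` may be replaced by its frame expansion, to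
  -- which the Leibniz rule applies.
  rw [conn_congr D hX (DiffSec.sum _ hi) (eventually_eq_sum_coordVec hx X), conn_sum D _ hi]
  simp only [sum_apply, map_sum, conn_smul D (hf _) (smoothSec_coordVec hx _).diff,
    map_add, map_smul, smul_eq_mul, Finset.sum_add_distrib, coordCov_coordVec hx,
    coordCov_conn_coordVec D p hx]
  rw [add_comm]
  congr 1
  · simp [kron]
  · rw [Finset.sum_comm]
    simp only [Finset.mul_sum]
    exact Finset.sum_congr rfl fun i _ ↦ Finset.sum_congr rfl fun j _ ↦ by ring

theorem conn_apply_coordVec (D : Conn n M) {p x : M} (hx : x ∈ dom n p)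
    {X : ∀ x : M, TangentSpace (𝓡 n) x} (hX : DiffSec X x) (a c : Fin n) :
    coordCov p c x (D X x (coordVec p a x)) = pd p a (fun y ↦ coordCov p c y (X y)) x
      + ∑ b, christoffel D p c a b x * coordCov p b x (X x) := by
  rw [coordCov_conn D hx hX]
  simp [coordCov_coordVec hx, kron, pd]

theorem christoffel_of_notMem (D : Conn n M) {p x : M} (hx : x ∉ dom n p) (c a b : Fin n) :
    christoffel D p c a b x = 0 := by
  simp [christoffel, coordCov_of_notMem hx]

/-- The transformation law of the Christoffel symbols. -/
theorem christoffel_change (D : Conn n M) {p q x : M} (hp : x ∈ dom n p) (hq : x ∈ dom n q)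
    (i j c : Fin n) :
    ∑ l, christoffel D p l i j x * pd p l (coordFn q c) x =
      pd p i (pd p j (coordFn q c)) x
        + ∑ a, ∑ b, christoffel D q c a b x * pd p i (coordFn q a) x * pd p j (coordFn q b) x := by
  -- The field ∂ⱼ of the chart at `p` is differentiated in the chart at `q`, where its components
  -- are the entries of the Jacobian.
  have h := coordCov_conn D hq (smoothSec_coordVec hp j).diff c (coordVec p i x)
  have hJ : ∀ {y} (hy : y ∈ dom n q) (a b), coordCov q a y (coordVec p b y) = pd p b (coordFn q a) y :=
    fun hy a b ↦ (mvfderiv_coordFn hy a _).symm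
  rw [← mvfderiv_coordFn hq, mvfderiv_apply hp] at h
  simp only [hJ hq] at h
  refine Eq.trans h ?_
  congr 1
  refine pd_congr ?_ p i
  filter_upwards [dom_mem_nhds hq] with y hy using hJ hy c j

/-- The constant vector field on the model space. -/
def constField (w : EuclideanSpace ℝ (Fin n)) :
    ∀ z : EuclideanSpace ℝ (Fin n), TangentSpace 𝓘(ℝ, EuclideanSpace ℝ (Fin n)) z := fun _ ↦ w

theorem mlieBracket_constField (v w : EuclideanSpace ℝ (Fin n)) :
    VectorField.mlieBracket 𝓘(ℝ, EuclideanSpace ℝ (Fin n)) (constField v) (constField w) = 0 := by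
  rw [← VectorField.mlieBracketWithin_univ, VectorField.mlieBracketWithin_eq_lieBracketWithin]
  ext1 z
  simp only [VectorField.lieBracketWithin]
  have h : ∀ v : EuclideanSpace ℝ (Fin n), fderivWithin ℝ (constField v) univ z = 0 := fun v ↦
    fderivWithin_const_apply (𝕜 := ℝ) (E := EuclideanSpace ℝ (Fin n)) v
  have h1 := congrArg (fun L ↦ L v) (h w)
  have h2 := congrArg (fun L ↦ L w) (h v)
  exact (congrArg₂ (· - ·) h1 h2).trans (sub_zero (0 : EuclideanSpace ℝ (Fin n)))

/-- Coordinate fields are pullbacks of constant fields; naturality of the Lie bracket then makes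
them commute. -/
theorem mpullback_extChartAt {p x : M} (hx : x ∈ dom n p) (i : Fin n) :
    VectorField.mpullback (𝓡 n) 𝓘(ℝ, EuclideanSpace ℝ (Fin n)) (extChartAt (𝓡 n) p)
      (constField (EuclideanSpace.single i (1 : ℝ))) x = coordVec p i x := by
  have hx' : x ∈ (extChartAt (𝓡 n) p).source := by rwa [extChartAt_source]
  have hinv := isInvertible_mfderiv_extChartAt (I := 𝓡 n) hx'
  rw [VectorField.mpullback_apply, hinv.inverse_apply_eq]
  refine (PiLp.ext fun k ↦ ?_ : (_ : EuclideanSpace ℝ (Fin n)) = _)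
  have := coordCov_eq hx k (coordVec p i x)
  rw [coordCov_coordVec hx] at this
  refine Eq.trans ?_ this
  simp [kron, constField]

theorem mlieBracket_coordVec {p x : M} (hx : x ∈ dom n p) (i j : Fin n) :
    VectorField.mlieBracket (𝓡 n) (coordVec p i) (coordVec p j) x = 0 := by
  have : IsManifold (𝓡 n) (minSmoothness ℝ 2) M := by
    rw [minSmoothness_of_isRCLikeNormedField]; infer_instance
  have hev : ∀ i, (VectorField.mpullback (𝓡 n) 𝓘(ℝ, EuclideanSpace ℝ (Fin n)) (extChartAt (𝓡 n) p)
      (constField (EuclideanSpace.single i (1 : ℝ)))) =ᶠ[nhds x] coordVec p i := fun i ↦ by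
    filter_upwards [dom_mem_nhds hx] with y hy using mpullback_extChartAt hy i
  rw [← Filter.EventuallyEq.mlieBracket_vectorField_eq (hev i) (hev j)]
  have hc : ∀ i : Fin n, MDifferentiableAt 𝓘(ℝ, EuclideanSpace ℝ (Fin n)) 𝓘(ℝ, EuclideanSpace ℝ (Fin n)).tangent
      (fun z ↦ (TotalSpace.mk' (EuclideanSpace ℝ (Fin n)) z (constField (EuclideanSpace.single i (1 : ℝ)) z) :
        TangentBundle 𝓘(ℝ, EuclideanSpace ℝ (Fin n)) (EuclideanSpace ℝ (Fin n))))
      (extChartAt (𝓡 n) p x) := fun i ↦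
    ((contMDiffAt_vectorSpace_iff_contDiffAt (n := 1)).2 contDiffAt_const).mdifferentiableAt (by simp)
  have h := VectorField.mpullback_mlieBracket (n := ∞) (hc i) (hc j)
    (contMDiffAt_extChartAt' (I := 𝓡 n) (n := ∞) hx) (by simpa using WithTop.coe_le_coe.2 (le_top : (2 : ℕ∞) ≤ ⊤))
  rw [← h, mlieBracket_constField, VectorField.mpullback_zero]
  rfl

/-- Vanishing torsion is evaluated on two coordinate fields, whose bracket is zero; off the chart
both sides are zero. -/
theorem christoffel_symm {D : Conn n M} (hD : D.torsion = 0) (p : M) (c a b : Fin n) (x : M) :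
    christoffel D p c a b x = christoffel D p c b a x := by
  by_cases hx : x ∈ dom n p
  · have h := (CovariantDerivative.torsion_eq_zero_iff D).1 hD (smoothSec_coordVec hx a).diff
      (smoothSec_coordVec hx b).diff
    rw [mlieBracket_coordVec hx, sub_eq_zero] at h
    simp only [christoffel, h]
  · simp only [christoffel_of_notMem D hx]

/-- Smoothness of a connection is tested on smooth fields defined on all of `M`, so ∂_b is cut off
by a bump function before the connection is applied to it. The Hausdorff property enters here. -/
theorem exists_smooth_extension [T2Space M] {p x : M} (hx : x ∈ dom n p) (b : Fin n) :
    ∃ X : ∀ x : M, TangentSpace (𝓡 n) x, (∀ y, SmoothSec X y) ∧ ∀ᶠ y in nhds x, X y = coordVec p b y := by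
  obtain ⟨f, hf, -⟩ := (SmoothBumpFunction.nhds_basis_support (I := 𝓡 n) (dom_mem_nhds hx)).mem_iff.1
    Filter.univ_mem
  refine ⟨(f : M → ℝ) • coordVec p b, fun y ↦ ?_, ?_⟩
  · exact ContMDiffOn.smul_section_of_tsupport (u := dom n p) f.contMDiff.contMDiffOn (isOpen_dom p) hf
      (fun z hz ↦ (smoothSec_coordVec hz b).contMDiffWithinAt) y
  · filter_upwards [f.eventuallyEq_one] with y hy
    simp [hy]

theorem smoothFn_christoffel [T2Space M] {D : Conn n M}
    (hD : CovariantDerivative.ContMDiffCovariantDerivative D ∞)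
    {p x : M} (hx : x ∈ dom n p) (c a b : Fin n) : SmoothFn n (christoffel D p c a b) x := by
  obtain ⟨X, hX, hXb⟩ := exists_smooth_extension hx b
  have h1 := (hD.contMDiff.contMDiff (σ := X) (fun y _ ↦ (hX y).contMDiffWithinAt)).contMDiffAt
    (x := x) Filter.univ_mem
  have h2 := ContMDiffAt.clm_bundle_apply h1 (smoothSec_coordVec hx a)
  refine ((smoothSec_iff hx).1 h2 c).congr_of_eventuallyEq ?_
  filter_upwards [hXb.eventually_nhds, dom_mem_nhds hx] with y hy hyd
  rw [christoffel, conn_congr D (hX y).diff (smoothSec_coordVec hyd b).diff hy]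

end ProjMetric
end

noncomputable section

namespace ProjMetric

variable {n : ℕ} {M : Type*} [TopologicalSpace M] [ChartedSpace (EuclideanSpace ℝ (Fin n)) M]
variable [IsManifold (𝓡 n) ∞ M]

/-! ### Smooth sections of bundles of linear maps -/

theorem contMDiffAt_clm {F : Type*} [NormedAddCommGroup F] [NormedSpace ℝ F] {x : M}
    {f : M → EuclideanSpace ℝ (Fin n) →L[ℝ] F}
    (h : ∀ i, ContMDiffAt (𝓡 n) 𝓘(ℝ, F) ∞ (fun y ↦ f y (EuclideanSpace.single i (1 : ℝ))) x) :
    ContMDiffAt (𝓡 n) 𝓘(ℝ, EuclideanSpace ℝ (Fin n) →L[ℝ] F) ∞ f x := by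
  have hf : f = fun y ↦ ∑ i, ContinuousLinearMap.smulRightL ℝ (EuclideanSpace ℝ (Fin n)) F
      (EuclideanSpace.proj i) (f y (EuclideanSpace.single i (1 : ℝ))) := by
    ext y v
    have hv : v = ∑ i, v i • EuclideanSpace.single i (1 : ℝ) := by
      ext j; simp [Pi.single_apply]
    conv_lhs => rw [hv]
    simp
  rw [hf]
  exact contMDiffAt_finsetSum fun i _ ↦ (ContinuousLinearMap.contMDiff _).contMDiffAt.comp x (h i)

theorem symmL_single {p x : M} (i : Fin n) :
    (trivializationAt (EuclideanSpace ℝ (Fin n)) (TangentSpace (𝓡 n)) p).symmL ℝ x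
      (EuclideanSpace.single i (1 : ℝ)) = coordVec p i x := rfl

theorem contMDiffAt_endSection {x : M} {L : ∀ x : M, TangentSpace (𝓡 n) x →L[ℝ] TangentSpace (𝓡 n) x}
    (h : ∀ a c, SmoothFn n (fun y ↦ coordCov x c y (L y (coordVec x a y))) x) :
    ContMDiffAt (𝓡 n) ((𝓡 n).prod 𝓘(ℝ, EuclideanSpace ℝ (Fin n) →L[ℝ] EuclideanSpace ℝ (Fin n))) ∞
      (fun y ↦ TotalSpace.mk' (EuclideanSpace ℝ (Fin n) →L[ℝ] EuclideanSpace ℝ (Fin n))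
        (E := fun x : M ↦ (TangentSpace (𝓡 n) x →L[ℝ] TangentSpace (𝓡 n) x)) y (L y)) x := by
  rw [contMDiffAt_hom_bundle]
  refine ⟨contMDiffAt_id, contMDiffAt_clm fun a ↦ contMDiffAt_euclidean.2 fun c ↦ ?_⟩
  exact h a c

theorem contMDiffAt_bilinSection {x : M} {g : ∀ x : M, TangentSpace (𝓡 n) x →L[ℝ] TangentSpace (𝓡 n) x →L[ℝ] ℝ}
    (h : ∀ a b, SmoothFn n (fun y ↦ g y (coordVec x a y) (coordVec x b y)) x) :
    ContMDiffAt (𝓡 n) ((𝓡 n).prod 𝓘(ℝ, EuclideanSpace ℝ (Fin n) →L[ℝ] EuclideanSpace ℝ (Fin n) →L[ℝ] ℝ)) ∞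
      (fun y ↦ TotalSpace.mk' (EuclideanSpace ℝ (Fin n) →L[ℝ] EuclideanSpace ℝ (Fin n) →L[ℝ] ℝ)
        (E := fun x : M ↦ (TangentSpace (𝓡 n) x →L[ℝ] TangentSpace (𝓡 n) x →L[ℝ] ℝ)) y (g y)) x := by
  rw [contMDiffAt_hom_bundle]
  refine ⟨contMDiffAt_id, contMDiffAt_clm fun a ↦ contMDiffAt_clm fun b ↦ ?_⟩
  refine (h a b).congr_of_eventuallyEq ?_
  filter_upwards [dom_mem_nhds (n := n) (mem_dom_self x)] with y hy
  simp [ContinuousLinearMap.inCoordinates, symmL_single]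
  rw [Trivialization.coe_linearMapAt_of_mem]
  · simp [hom_trivializationAt_apply, ContinuousLinearMap.inCoordinates, symmL_single]
  · rw [hom_trivializationAt_baseSet]
    exact ⟨mem_baseSet hy, mem_univ _⟩

theorem smoothFn_compMetric (g : Metric n M) {p x : M} (hx : x ∈ dom n p) (a b : Fin n) :
    SmoothFn n (compMetric g p a b) x := by
  have : ContMDiffAt (𝓡 n) ((𝓡 n).prod 𝓘(ℝ, ℝ)) ∞
      (fun y ↦ TotalSpace.mk' ℝ (E := Bundle.Trivial M ℝ) y (compMetric g p a b y)) x :=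
    ContMDiffAt.clm_bundle_apply₂ (g.contMDiff x) (smoothSec_coordVec hx a) (smoothSec_coordVec hx b)
  simp only [contMDiffAt_totalSpace] at this
  exact this.2

theorem inner_apply (g : Metric n M) {p x : M} (hx : x ∈ dom n p) (v w : TangentSpace (𝓡 n) x) :
    g.inner x v w = ∑ a, ∑ b, compMetric g p a b x * coordCov p a x v * coordCov p b x w := by
  conv_lhs => rw [← sum_coordCov_smul hx v, ← sum_coordCov_smul hx w]
  simp only [map_sum, map_smul, sum_apply, smul_apply, smul_eq_mul, compMetric, Finset.mul_sum]
  rw [Finset.sum_comm]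
  refine Finset.sum_congr rfl fun i _ ↦ Finset.sum_congr rfl fun j _ ↦ by ring

/-- By compactness B attains a positive minimum c on the unit sphere, and homogeneity gives B(v, v)
≥ c‖v‖². The zero space, whose sphere is empty, is treated apart. -/
theorem isVonNBounded_of_pos {E : Type*} [NormedAddCommGroup E] [NormedSpace ℝ E] [FiniteDimensional ℝ E]
    (B : E →L[ℝ] E →L[ℝ] ℝ) (pos : ∀ v, v ≠ 0 → 0 < B v v) :
    Bornology.IsVonNBounded ℝ {v : E | B v v < 1} := by
  rw [NormedSpace.isVonNBounded_iff ℝ]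
  have hc : ∃ c > 0, ∀ v, c * ‖v‖ ^ 2 ≤ B v v := by
    rcases subsingleton_or_nontrivial E with h | h
    · exact ⟨1, one_pos, fun v ↦ by simp [Subsingleton.elim v 0]⟩
    obtain ⟨u, hu, hmin⟩ := (isCompact_sphere (0 : E) 1).exists_isMinOn
      (NormedSpace.sphere_nonempty.2 zero_le_one) (f := fun v ↦ B v v)
      (B.continuous.clm_apply continuous_id).continuousOn
    have hu0 : u ≠ 0 := fun h ↦ by simp [h] at hu
    refine ⟨B u u, pos u hu0, fun v ↦ ?_⟩
    rcases eq_or_ne v 0 with rfl | hv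
    · simp
    have hv' : ‖v‖ ≠ 0 := norm_ne_zero_iff.2 hv
    have h1 : (‖v‖⁻¹ • v) ∈ Metric.sphere (0 : E) 1 := by simp [norm_smul, hv']
    have h2 : B u u ≤ B (‖v‖⁻¹ • v) (‖v‖⁻¹ • v) := hmin h1
    simp only [map_smul, smul_apply, smul_eq_mul] at h2
    calc B u u * ‖v‖ ^ 2 ≤ (‖v‖⁻¹ * (‖v‖⁻¹ * B v v)) * ‖v‖ ^ 2 := by gcongr
      _ = B v v := by field_simp
  obtain ⟨c, hc, hB⟩ := hc
  -- This radius avoids a square root: 2‖v‖ ≤ 1 + ‖v‖² < 1 + 1/c.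
  refine (Metric.isBounded_closedBall (x := (0 : E)) (r := 1 + 1 / c)).subset fun v hv ↦ ?_
  have h1 : c * ‖v‖ ^ 2 < 1 := (hB v).trans_lt hv
  have h2 : ‖v‖ ^ 2 < 1 / c := by rw [lt_div_iff₀ hc]; linarith
  rw [mem_closedBall_zero_iff]
  nlinarith [sq_nonneg (‖v‖ - 1)]

/-- A family of inner products with smooth components is a smooth metric. -/
def metricOfComponents (B : ∀ x : M, TangentSpace (𝓡 n) x →L[ℝ] TangentSpace (𝓡 n) x →L[ℝ] ℝ)
    (symm : ∀ x v w, B x v w = B x w v) (pos : ∀ x v, v ≠ 0 → 0 < B x v v)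
    (smooth : ∀ x a b, SmoothFn n (fun y ↦ B y (coordVec x a y) (coordVec x b y)) x) : Metric n M where
  inner := B
  symm := symm
  pos := pos
  isVonNBounded x := isVonNBounded_of_pos (E := EuclideanSpace ℝ (Fin n)) (B x) (pos x)
  contMDiff x := contMDiffAt_bilinSection (smooth x)

/-! ### The Levi-Civita condition in components. -/

theorem IsMetricConnection.pd_compMetric {D : Conn n M} {g : Metric n M} (h : IsMetricConnection D g)
    {p x : M} (hx : x ∈ dom n p) (a b c : Fin n) :
    pd p a (compMetric g p b c) x = ∑ d, christoffel D p d a b x * compMetric g p d c x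
      + ∑ d, christoffel D p d a c x * compMetric g p b d x := by
  have := h.metric x (coordVec p b) (coordVec p c) (coordVec p a x) (smoothSec_coordVec hx b).diff
    (smoothSec_coordVec hx c).diff
  refine this.trans ?_
  rw [inner_apply g hx, inner_apply g hx]
  simp only [coordCov_coordVec hx, kron]
  simp only [mul_ite, mul_one, mul_zero, ite_mul, zero_mul, Finset.sum_ite_eq', Finset.mem_univ, if_true]
  congr 1
  · refine Finset.sum_congr rfl fun d _ ↦ mul_comm _ _
  · rw [Finset.sum_comm]
    simp only [Finset.sum_ite_eq', Finset.mem_univ, if_true]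
    refine Finset.sum_congr rfl fun d _ ↦ mul_comm _ _

/-- Metric compatibility is tensorial. After expansion by the Leibniz rule the derivatives of the
components of Y and Z agree on both sides, and what remains is the identity for coordinate fields.
-/
theorem isMetricConnection_of_pd_compMetric {D : Conn n M} (hD : IsSmoothTorsionFree D) {g : Metric n M}
    (h : ∀ p : M, ∀ x ∈ dom n p, ∀ a b c, pd p a (compMetric g p b c) x =
      ∑ d, christoffel D p d a b x * compMetric g p d c x
        + ∑ d, christoffel D p d a c x * compMetric g p b d x) : IsMetricConnection D g := by
  refine ⟨hD, fun x Y Z v hY hZ ↦ ?_⟩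
  have hx := mem_dom_self (n := n) x
  have hY' := (diffSec_iff hx).1 hY
  have hZ' := (diffSec_iff hx).1 hZ
  have key : ∀ a, mvfderiv (𝓡 n) (fun y ↦ g.inner y (Y y) (Z y)) x (coordVec x a x)
      = g.inner x (D Y x (coordVec x a x)) (Z x) + g.inner x (Y x) (D Z x (coordVec x a x)) := by
    intro a
    have hg := fun b c ↦ (smoothFn_compMetric g hx b c).diff
    have h1 : ∀ b c, DiffFn n (fun y ↦ compMetric g x b c y * coordCov x b y (Y y)) x :=
      fun b c ↦ (hg b c).mul (hY' b)
    have h2 : ∀ b c, DiffFn n (fun y ↦ compMetric g x b c y * coordCov x b y (Y y) *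
        coordCov x c y (Z y)) x := fun b c ↦ (h1 b c).mul (hZ' c)
    have e1 : mvfderiv (𝓡 n) (fun y ↦ g.inner y (Y y) (Z y)) x (coordVec x a x) = pd x a (fun y ↦
        ∑ b, ∑ c, compMetric g x b c y * coordCov x b y (Y y) * coordCov x c y (Z y)) x := by
      rw [← pd]
      exact pd_congr_dom hx (fun y hy ↦ inner_apply g hy _ _) a
    rw [e1, pd_sum (fun b _ ↦ mdifferentiableAt_finsetSum fun c _ ↦ h2 b c)]
    have e2 : ∀ b, pd x a (fun y ↦ ∑ c, compMetric g x b c y * coordCov x b y (Y y) * coordCov x c y (Z y)) x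
        = ∑ c, pd x a (fun y ↦ compMetric g x b c y * coordCov x b y (Y y) * coordCov x c y (Z y)) x :=
      fun b ↦ pd_sum (fun c _ ↦ h2 b c) _ _
    simp only [e2]
    simp only [pd_mul (h1 _ _) (hZ' _), pd_mul (hg _ _) (hY' _), h x x hx]
    rw [inner_apply g hx, inner_apply g hx]
    simp only [conn_apply_coordVec D hx hY, conn_apply_coordVec D hx hZ]
    simp only [mul_add, add_mul, Finset.sum_add_distrib, Finset.sum_mul, Finset.mul_sum]
    have s1 : ∑ b, ∑ c, ∑ d, coordCov x c x (Z x) * (coordCov x b x (Y x) *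
          (christoffel D x d a b x * compMetric g x d c x))
        = ∑ b, ∑ c, ∑ d, compMetric g x b c x * (christoffel D x b a d x * coordCov x d x (Y x)) *
          coordCov x c x (Z x) := by
      rw [Finset.sum_comm, Finset.sum_comm (s := Finset.univ) (f := fun b c ↦ ∑ d, compMetric g x b c x *
        (christoffel D x b a d x * coordCov x d x (Y x)) * coordCov x c x (Z x))]
      refine Finset.sum_congr rfl fun c _ ↦ ?_
      rw [Finset.sum_comm]
      refine Finset.sum_congr rfl fun d _ ↦ Finset.sum_congr rfl fun b _ ↦ by ring
    have s2 : ∑ b, ∑ c, ∑ d, coordCov x c x (Z x) * (coordCov x b x (Y x) *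
          (christoffel D x d a c x * compMetric g x b d x))
        = ∑ b, ∑ c, ∑ d, compMetric g x b c x * coordCov x b x (Y x) *
          (christoffel D x c a d x * coordCov x d x (Z x)) := by
      refine Finset.sum_congr rfl fun b _ ↦ ?_
      rw [Finset.sum_comm]
      refine Finset.sum_congr rfl fun d _ ↦ Finset.sum_congr rfl fun c _ ↦ by ring
    rw [s1, s2]
    have s3 : ∑ b, ∑ c, compMetric g x b c x * coordCov x b x (Y x) * pd x a (fun y ↦ coordCov x c y (Z y)) x
       + ∑ b, ∑ c, coordCov x c x (Z x) * (compMetric g x b c x * pd x a (fun y ↦ coordCov x b y (Y y)) x)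
       = ∑ b, ∑ c, compMetric g x b c x * pd x a (fun y ↦ coordCov x b y (Y y)) x * coordCov x c x (Z x)
       + ∑ b, ∑ c, compMetric g x b c x * coordCov x b x (Y x) * pd x a (fun y ↦ coordCov x c y (Z y)) x := by
      rw [add_comm]
      congr 1
      refine Finset.sum_congr rfl fun b _ ↦ Finset.sum_congr rfl fun c _ ↦ by ring
    linarith
  conv_lhs => rw [← sum_coordCov_smul hx v]
  conv_rhs => rw [← sum_coordCov_smul hx v]
  simp only [map_sum, map_smul, sum_apply, smul_apply, key, ← Finset.sum_add_distrib, smul_add]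

end ProjMetric
end

noncomputable section

namespace ProjMetric

variable {n : ℕ} {M : Type*} [TopologicalSpace M] [ChartedSpace (EuclideanSpace ℝ (Fin n)) M]
variable [IsManifold (𝓡 n) ∞ M]

/-! ### Projective change of a connection by an exact one-form -/

/-- The endomorphism-valued one-form `φ ⊗ id + id ⊗ φ`. -/
def projTensor {E : Type*} [NormedAddCommGroup E] [NormedSpace ℝ E] (φ : E →L[ℝ] ℝ) :
    E →L[ℝ] E →L[ℝ] E :=
  ContinuousLinearMap.smulRightL ℝ E E φ + φ.smulRight (ContinuousLinearMap.id ℝ E)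

theorem projTensor_apply {E : Type*} [NormedAddCommGroup E] [NormedSpace ℝ E] (φ : E →L[ℝ] ℝ)
    (Y v : E) : projTensor φ Y v = φ v • Y + φ Y • v := by
  simp [projTensor]

/-- The one-form with values in endomorphisms by which `projChange` differs. -/
def projForm (h : M → ℝ) (x : M) :
    TangentSpace (𝓡 n) x →L[ℝ] TangentSpace (𝓡 n) x →L[ℝ] TangentSpace (𝓡 n) x :=
  projTensor (E := EuclideanSpace ℝ (Fin n)) (mvfderiv (𝓡 n) h x)

theorem projForm_apply (h : M → ℝ) (x : M) (Y v : TangentSpace (𝓡 n) x) :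
    projForm h x Y v = mvfderiv (𝓡 n) h x v • Y + mvfderiv (𝓡 n) h x Y • v :=
  projTensor_apply (E := EuclideanSpace ℝ (Fin n)) (mvfderiv (𝓡 n) h x) Y v

/-- The connection `∇_v Y + dh(v) Y + dh(Y) v`. -/
def projChange (D : Conn n M) (h : M → ℝ) : Conn n M := D.addOneForm (projForm h)

theorem projChange_apply (D : Conn n M) (h : M → ℝ) (Y : ∀ x : M, TangentSpace (𝓡 n) x) (x : M)
    (v : TangentSpace (𝓡 n) x) : projChange D h Y x v =
      D Y x v + (mvfderiv (𝓡 n) h x v • Y x + mvfderiv (𝓡 n) h x (Y x) • v) := by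
  rw [← projForm_apply]; rfl

theorem christoffel_projChange (D : Conn n M) (h : M → ℝ) {p x : M} (hx : x ∈ dom n p)
    (c a b : Fin n) : christoffel (projChange D h) p c a b x =
      christoffel D p c a b x + kron c b * pd p a h x + kron c a * pd p b h x := by
  rw [christoffel, projChange_apply, map_add, map_add, map_smul, map_smul, coordCov_coordVec hx,
    coordCov_coordVec hx, christoffel, pd, pd]
  simp only [smul_eq_mul]
  ring

/-- The added form is symmetric in its two arguments, so the torsion does not change. -/
theorem isSmoothTorsionFree_projChange {D : Conn n M} (hD : IsSmoothTorsionFree D) {h : M → ℝ}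
    (hh : ∀ x, SmoothFn n h x) : IsSmoothTorsionFree (projChange D h) := by
  refine ⟨⟨⟨fun {X} hX x _ ↦ ContMDiffAt.contMDiffWithinAt ?_⟩⟩, ?_⟩
  · have hXs : ∀ x, SmoothSec X x := fun x ↦ hX.contMDiffAt Filter.univ_mem
    have h1 := (hD.smooth.contMDiff.contMDiff (σ := X) (fun y _ ↦ (hXs y).contMDiffWithinAt)).contMDiffAt
      (x := x) Filter.univ_mem
    have hx := mem_dom_self (n := n) x
    refine ContMDiffAt.add_section h1 (contMDiffAt_endSection (L := fun y ↦ projForm h y (X y)) fun a c ↦ ?_)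
    have hXc := (smoothSec_iff hx).1 (hXs x)
    refine ((((hh x).pd hx a).mul (hXc c)).add (ContMDiffAt.mul
      (contMDiffAt_finsetSum (t := Finset.univ) (f := fun i y ↦ coordCov x i y (X y) * pd x i h y) fun i _ ↦ (hXc i).mul ((hh x).pd hx i))
      (contMDiffAt_const (c := kron c a)))).congr_of_eventuallyEq ?_
    filter_upwards [dom_mem_nhds hx] with y hy
    rw [projForm_apply, map_add, map_smul, map_smul, coordCov_coordVec hy, mvfderiv_apply hy h (X y)]
    rfl
  · rw [CovariantDerivative.torsion_eq_zero_iff]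
    intro X Y x hX hY
    rw [← (CovariantDerivative.torsion_eq_zero_iff D).1 hD.torsion_eq_zero hX hY,
      projChange_apply, projChange_apply]
    abel

end ProjMetric
end

noncomputable section

namespace ProjMetric

variable {n : ℕ} {M : Type*} [TopologicalSpace M] [ChartedSpace (EuclideanSpace ℝ (Fin n)) M]
variable [IsManifold (𝓡 n) ∞ M]

/-! ### Curves -/

/-- The chain rule for a function along a curve, in coordinates. -/
theorem hasDerivAt_comp_curve {γ : ℝ → M} {t : ℝ} {p : M}
    (hγ : ContMDiffAt 𝓘(ℝ, ℝ) (𝓡 n) 1 γ t) (ht : γ t ∈ dom n p) {f : M → ℝ} (hf : DiffFn n f (γ t)) :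
    HasDerivAt (fun s ↦ f (γ s))
      (∑ i : Fin n, pd p i f (γ t) * deriv (fun s ↦ coordFn p i (γ s)) t) t := by
  have hγ' : MDifferentiableAt 𝓘(ℝ, ℝ) (𝓡 n) γ t := hγ.mdifferentiableAt (by simp)
  have key : ∀ {f : M → ℝ}, DiffFn n f (γ t) → HasDerivAt (fun s ↦ f (γ s))
      (mvfderiv (𝓡 n) f (γ t) (mfderiv 𝓘(ℝ, ℝ) (𝓡 n) γ t (1 : ℝ))) t := by
    intro f hf
    have h1 := (hf.comp t hγ').differentiableAt.hasDerivAt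
    convert! h1 using 1
    have h2 := mfderiv_comp_apply (I := 𝓘(ℝ, ℝ)) (I' := 𝓡 n) (I'' := 𝓘(ℝ, ℝ)) t hf hγ' (1 : ℝ)
    rw [mfderiv_eq_fderiv] at h2
    exact h2.symm
  convert! key hf using 1
  rw [mvfderiv_apply ht]
  refine Finset.sum_congr rfl fun i _ ↦ ?_
  rw [(key (smoothFn_coordFn ht i).diff).deriv, mvfderiv_coordFn ht, mul_comm]

theorem contDiffAt_comp_curve {γ : ℝ → M} {t : ℝ} (hγ : ContMDiffAt 𝓘(ℝ, ℝ) (𝓡 n) 2 γ t)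
    {f : M → ℝ} (hf : SmoothFn n f (γ t)) : ContDiffAt ℝ 2 (fun s ↦ f (γ s)) t :=
  (ContMDiffAt.comp t (hf.of_le (by simpa using WithTop.coe_le_coe.2 (le_top : (2 : ℕ∞) ≤ ⊤))) hγ).contDiffAt

theorem ContDiffAt.hasDerivAt_deriv {c : ℝ → ℝ} {t : ℝ} (hc : ContDiffAt ℝ 2 c t) :
    HasDerivAt (deriv c) (deriv (deriv c) t) t := by
  have h : ContDiffAt ℝ 1 (deriv c) t := (hc.fderiv_right (m := 1) (by norm_num)).clm_apply contDiffAt_const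
  exact (h.differentiableAt (by simp)).hasDerivAt

theorem ContDiffAt.eventually_hasDerivAt {c : ℝ → ℝ} {t : ℝ} (hc : ContDiffAt ℝ 2 c t) :
    ∀ᶠ s in nhds t, HasDerivAt c (deriv c s) s := by
  filter_upwards [hc.eventually (by simp)] with s hs using (hs.differentiableAt (by simp)).hasDerivAt

theorem deriv_deriv_comp {c φ : ℝ → ℝ} {t : ℝ} (hc : ContDiffAt ℝ 2 c (φ t)) (hφ : ContDiffAt ℝ 2 φ t) :
    deriv (fun s ↦ c (φ s)) t = deriv c (φ t) * deriv φ t ∧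
    deriv (deriv fun s ↦ c (φ s)) t =
      deriv (deriv c) (φ t) * deriv φ t ^ 2 + deriv c (φ t) * deriv (deriv φ) t := by
  have hev : (deriv fun s ↦ c (φ s)) =ᶠ[nhds t] fun s ↦ deriv c (φ s) * deriv φ s := by
    filter_upwards [hφ.continuousAt.eventually (ContDiffAt.eventually_hasDerivAt hc),
      ContDiffAt.eventually_hasDerivAt hφ] with s h1 h2
    exact (h1.comp s h2).deriv
  refine ⟨hev.eq_of_nhds, ?_⟩
  rw [hev.deriv_eq]
  have h1 : HasDerivAt (fun s ↦ deriv c (φ s)) (deriv (deriv c) (φ t) * deriv φ t) t :=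
    (ContDiffAt.hasDerivAt_deriv hc).comp t (ContDiffAt.eventually_hasDerivAt hφ).self_of_nhds
  refine (h1.mul (ContDiffAt.hasDerivAt_deriv hφ)).deriv.trans ?_
  ring

/-- The left-hand side of the geodesic equation. -/
def geodAccel (D : Conn n M) (γ : ℝ → M) (p : M) (k : Fin n) (t : ℝ) : ℝ :=
  deriv (deriv fun s ↦ coordFn p k (γ s)) t
    + ∑ i, ∑ j, christoffel D p k i j (γ t)
      * deriv (fun s ↦ coordFn p i (γ s)) t * deriv (fun s ↦ coordFn p j (γ s)) t

/-- The second derivative of a function along a curve. -/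
theorem deriv_deriv_comp_curve {γ : ℝ → M} {t : ℝ} {p : M}
    (hγ : ContMDiffAt 𝓘(ℝ, ℝ) (𝓡 n) 2 γ t) (ht : γ t ∈ dom n p) {f : M → ℝ}
    (hf : SmoothFn n f (γ t)) :
    deriv (deriv fun s ↦ f (γ s)) t =
      ∑ i : Fin n, ∑ j : Fin n, pd p j (pd p i f) (γ t) * deriv (fun s ↦ coordFn p i (γ s)) t
          * deriv (fun s ↦ coordFn p j (γ s)) t
        + ∑ i : Fin n, pd p i f (γ t) * deriv (deriv fun s ↦ coordFn p i (γ s)) t := by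
  have hγc := hγ.continuousAt
  have hγ1 : ∀ᶠ s in nhds t, ContMDiffAt 𝓘(ℝ, ℝ) (𝓡 n) 1 γ s := by
    filter_upwards [(contMDiffAt_iff_contMDiffAt_nhds (by simp)).1 hγ] with s hs
    exact hs.of_le (by norm_num)
  have hev : (deriv fun s ↦ f (γ s)) =ᶠ[nhds t]
      fun s ↦ ∑ i : Fin n, pd p i f (γ s) * deriv (fun s ↦ coordFn p i (γ s)) s := by
    filter_upwards [hγ1, hγc.eventually (dom_mem_nhds ht), hγc.eventually hf.eventually_diff]
      with s h1 h2 h3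
    exact (hasDerivAt_comp_curve h1 h2 h3).deriv
  rw [hev.deriv_eq]
  have h1 : ∀ i, HasDerivAt (fun s ↦ pd p i f (γ s) * deriv (fun s ↦ coordFn p i (γ s)) s)
      ((∑ j, pd p j (pd p i f) (γ t) * deriv (fun s ↦ coordFn p j (γ s)) t)
        * deriv (fun s ↦ coordFn p i (γ s)) t
        + pd p i f (γ t) * deriv (deriv fun s ↦ coordFn p i (γ s)) t) t := fun i ↦
    (hasDerivAt_comp_curve hγ1.self_of_nhds ht (hf.pd ht i).diff).mul
      (ContDiffAt.hasDerivAt_deriv (contDiffAt_comp_curve hγ (smoothFn_coordFn ht i)))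
  have h2 := (HasDerivAt.fun_sum fun i (_ : i ∈ Finset.univ) ↦ h1 i).deriv
  rw [h2, Finset.sum_add_distrib]
  congr 1
  refine Finset.sum_congr rfl fun i _ ↦ ?_
  rw [Finset.sum_mul]
  exact Finset.sum_congr rfl fun j _ ↦ by ring

/-- The geodesic equation in one chart implies it in all charts. -/
theorem geodAccel_eq_zero_of_chart (D : Conn n M) {γ : ℝ → M} {t : ℝ} {p q : M}
    (hγ : ContMDiffAt 𝓘(ℝ, ℝ) (𝓡 n) 2 γ t) (hp : γ t ∈ dom n p) (hq : γ t ∈ dom n q)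
    (h : ∀ k, geodAccel D γ p k t = 0) (k : Fin n) : geodAccel D γ q k t = 0 := by
  have hγ1 : ContMDiffAt 𝓘(ℝ, ℝ) (𝓡 n) 1 γ t := hγ.of_le (by norm_num)
  have hd : ∀ a, deriv (fun s ↦ coordFn q a (γ s)) t =
      ∑ i, pd p i (coordFn q a) (γ t) * deriv (fun s ↦ coordFn p i (γ s)) t := fun a ↦
    (hasDerivAt_comp_curve hγ1 hp (smoothFn_coordFn hq a).diff).deriv
  rw [geodAccel, deriv_deriv_comp_curve hγ hp (smoothFn_coordFn hq k)]
  have hdd : ∀ l, deriv (deriv fun s ↦ coordFn p l (γ s)) t =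
      - ∑ i, ∑ j, christoffel D p l i j (γ t)
      * deriv (fun s ↦ coordFn p i (γ s)) t * deriv (fun s ↦ coordFn p j (γ s)) t := fun l ↦
    eq_neg_of_add_eq_zero_left (h l)
  simp only [hdd, hd]
  set c : Fin n → ℝ := fun i ↦ deriv (fun s ↦ coordFn p i (γ s)) t with hc
  have hc' : ∀ i : Fin n, deriv (fun s ↦ coordFn p i (γ s)) t = c i := fun i ↦ rfl
  simp only [hc']
  have e1 : ∑ l, pd p l (coordFn q k) (γ t) * -∑ i, ∑ j, christoffel D p l i j (γ t) * c i * c j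
      = - ∑ i, ∑ j, (∑ l, christoffel D p l i j (γ t) * pd p l (coordFn q k) (γ t)) * (c i * c j) := by
    simp only [mul_neg, Finset.sum_neg_distrib, Finset.mul_sum, Finset.sum_mul]
    rw [Finset.sum_comm]
    congr 1
    refine Finset.sum_congr rfl fun i _ ↦ ?_
    rw [Finset.sum_comm]
    exact Finset.sum_congr rfl fun j _ ↦ Finset.sum_congr rfl fun l _ ↦ by ring
  have e2 : ∑ a, ∑ b, christoffel D q k a b (γ t) * (∑ i, pd p i (coordFn q a) (γ t) * c i)
        * (∑ j, pd p j (coordFn q b) (γ t) * c j)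
      = ∑ i, ∑ j, (∑ a, ∑ b, christoffel D q k a b (γ t) * pd p i (coordFn q a) (γ t)
        * pd p j (coordFn q b) (γ t)) * (c i * c j) := by
    simp only [Finset.mul_sum, Finset.sum_mul]
    have : ∀ F : Fin n → Fin n → Fin n → Fin n → ℝ,
        ∑ a, ∑ b, ∑ j, ∑ i, F a b i j = ∑ i, ∑ j, ∑ a, ∑ b, F a b i j := by
      intro F
      simp only [← Finset.sum_product']
      exact Finset.sum_bij' (fun x _ ↦ ⟨x.2.2.2, x.2.2.1, x.1, x.2.1⟩) (fun x _ ↦ ⟨x.2.2.1, x.2.2.2, x.2.1, x.1⟩)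
        (by simp) (by simp) (by simp) (by simp) (by simp)
    refine Eq.trans ?_ (this _)
    refine Finset.sum_congr rfl fun a _ ↦ Finset.sum_congr rfl fun b _ ↦ Finset.sum_congr rfl fun i _ ↦
      Finset.sum_congr rfl fun j _ ↦ by ring
  rw [e1, e2]
  -- The inhomogeneous term of the transformation law cancels the second derivatives of the
  -- coordinate change produced by the chain rule.
  simp only [christoffel_change D hp hq, add_mul, Finset.sum_add_distrib]
  have e3 : ∑ i, ∑ j, pd p j (pd p i (coordFn q k)) (γ t) * c i * c j =
      ∑ i, ∑ j, pd p i (pd p j (coordFn q k)) (γ t) * (c i * c j) :=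
    Finset.sum_congr rfl fun i _ ↦ Finset.sum_congr rfl fun j _ ↦ by
      rw [pd_comm hp (smoothFn_coordFn hq k)]; ring
  rw [e3]
  ring

end ProjMetric
end

noncomputable section

namespace ProjMetric

variable {n : ℕ} {M : Type*} [TopologicalSpace M] [ChartedSpace (EuclideanSpace ℝ (Fin n)) M]
variable [IsManifold (𝓡 n) ∞ M]

/-! ### Projectively related connections have the same unparametrised geodesics -/

/-- A solution of the autonomous equation `φ' = u ∘ φ` that runs through the whole interval on which
`u` is positive. -/
theorem exists_reparametrisation {J : Set ℝ} (hJ : IsOpen J) (hJc : J.OrdConnected) {t₀ : ℝ}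
    (ht₀ : t₀ ∈ J) {u : ℝ → ℝ} (hu : ContDiffOn ℝ 1 u J) (hpos : ∀ t ∈ J, 0 < u t) :
    ∃ (φ : ℝ → ℝ) (J' : Set ℝ), IsOpen J' ∧ J'.OrdConnected ∧ φ '' J' = J ∧ ContDiffOn ℝ 2 φ J' ∧
      ∀ t ∈ J', HasDerivAt φ (u (φ t)) t := by
  have hc : ContinuousOn (fun s ↦ (u s)⁻¹) J := hu.continuousOn.inv₀ fun t ht ↦ (hpos t ht).ne'
  -- Separation of variables: ψ is strictly increasing, and its inverse solves φ' = u ∘ φ.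
  set ψ : ℝ → ℝ := fun t ↦ ∫ s in t₀..t, (u s)⁻¹ with hψ
  have hder : ∀ t ∈ J, HasStrictDerivAt ψ (u t)⁻¹ t := fun t ht ↦
    intervalIntegral.integral_hasStrictDerivAt_right
      ((hc.mono (hJc.uIcc_subset ht₀ ht)).intervalIntegrable)
      (hc.stronglyMeasurableAtFilter hJ t ht) (hc.continuousAt (hJ.mem_nhds ht))
  have hψc : ContinuousOn ψ J := fun t ht ↦ (hder t ht).hasDerivAt.continuousAt.continuousWithinAt
  have hmono : StrictMonoOn ψ J := by
    refine strictMonoOn_of_deriv_pos hJc.convex hψc fun t ht ↦ ?_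
    rw [hJ.interior_eq] at ht
    rw [(hder t ht).hasDerivAt.deriv]
    exact inv_pos.2 (hpos t ht)
  have hnhds : ∀ t ∈ J, ψ '' J ∈ nhds (ψ t) := fun t ht ↦ by
    rw [← (hder t ht).map_nhds_eq (inv_pos.2 (hpos t ht)).ne']
    exact Filter.image_mem_map (hJ.mem_nhds ht)
  set φ : ℝ → ℝ := Function.invFunOn ψ J with hφ
  have hφJ : ∀ y ∈ ψ '' J, φ y ∈ J := fun y hy ↦ Function.invFunOn_mem hy
  have hψφ : ∀ y ∈ ψ '' J, ψ (φ y) = y := fun y hy ↦ Function.invFunOn_eq hy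
  have hφψ : ∀ t ∈ J, φ (ψ t) = t := hmono.injOn.leftInvOn_invFunOn
  have himg : φ '' (ψ '' J) = J := by
    ext t
    constructor
    · rintro ⟨y, hy, rfl⟩; exact hφJ y hy
    · intro ht; exact ⟨ψ t, ⟨t, ht, rfl⟩, hφψ t ht⟩
  have hopen : IsOpen (ψ '' J) := isOpen_iff_mem_nhds.2 fun y ⟨t, ht, hty⟩ ↦ hty ▸ hnhds t ht
  have hφmono : MonotoneOn φ (ψ '' J) := fun y hy z hz hyz ↦ by
    by_contra! hlt
    have := hmono (hφJ z hz) (hφJ y hy) hlt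
    rw [hψφ z hz, hψφ y hy] at this
    linarith
  have hφc : ∀ y ∈ ψ '' J, ContinuousAt φ y := fun y hy ↦
    continuousAt_of_monotoneOn_of_image_mem_nhds hφmono (hopen.mem_nhds hy)
      (by rw [himg]; exact hJ.mem_nhds (hφJ y hy))
  have hφd : ∀ y ∈ ψ '' J, HasDerivAt φ (u (φ y)) y := fun y hy ↦ by
    have := HasDerivAt.of_local_left_inverse (hφc y hy) (hder _ (hφJ y hy)).hasDerivAt
      (inv_pos.2 (hpos _ (hφJ y hy))).ne'
      (Filter.eventually_of_mem (hopen.mem_nhds hy) hψφ)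
    rwa [inv_inv] at this
  have hφ' : EqOn (deriv φ) (fun y ↦ u (φ y)) (ψ '' J) := fun y hy ↦ (hφd y hy).deriv
  have hφco : ContinuousOn φ (ψ '' J) := fun y hy ↦ (hφc y hy).continuousWithinAt
  have hφdiff : DifferentiableOn ℝ φ (ψ '' J) := fun y hy ↦
    (hφd y hy).differentiableAt.differentiableWithinAt
  -- Bootstrapping in φ' = u ∘ φ: continuity of φ gives C¹, and C¹ with u ∈ C¹ gives C².
  have hφ1 : ContDiffOn ℝ 1 φ (ψ '' J) := by
    rw [show (1 : WithTop ℕ∞) = 0 + 1 by norm_num, contDiffOn_succ_iff_deriv_of_isOpen hopen]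
    refine ⟨hφdiff, by simp, contDiffOn_zero.2 ?_⟩
    exact (hu.continuousOn.comp hφco hφJ).congr hφ'
  refine ⟨φ, ψ '' J, hopen, (hJc.isPreconnected.image ψ hψc).ordConnected, himg, ?_, hφd⟩
  rw [show (2 : WithTop ℕ∞) = 1 + 1 by norm_num, contDiffOn_succ_iff_deriv_of_isOpen hopen]
  exact ⟨hφdiff, by simp, (hu.comp hφ1 hφJ).congr hφ'⟩

/-- The new connection adds 2 dh(γ')γ' to the acceleration. A change of parameter adds a multiple
φ'' of γ', and the choice φ' = exp(-2h(γ(φ))) makes the two cancel. -/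
theorem geodesicsReparametrise_of_christoffel {D D' : Conn n M} {h : M → ℝ}
    (hh : ∀ x, SmoothFn n h x) (hΓ : ∀ p : M, ∀ x ∈ dom n p, ∀ c a b, christoffel D' p c a b x =
      christoffel D p c a b x + kron c b * pd p a h x + kron c a * pd p b h x) :
    GeodesicsReparametrise D D' := by
  intro γ J hJ hJc hγ
  rcases J.eq_empty_or_nonempty with rfl | ⟨t₀, ht₀⟩
  · exact ⟨id, ∅, isOpen_empty, Set.ordConnected_empty, contDiffOn_empty, by simp, by simp,
      contMDiffOn_empty, by simp⟩
  have hγ2 : ∀ t ∈ J, ContMDiffAt 𝓘(ℝ, ℝ) (𝓡 n) 2 γ t := fun t ht ↦ hγ.1.contMDiffAt (hJ.mem_nhds ht)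
  set u : ℝ → ℝ := fun t ↦ Real.exp (-2 * h (γ t)) with hu
  have hu2 : ∀ t ∈ J, ContDiffAt ℝ 2 u t := fun t ht ↦
    (contDiffAt_const.mul (contDiffAt_comp_curve (hγ2 t ht) (hh _))).exp
  obtain ⟨φ, J', hJ', hJc', himg, hφ2, hφd⟩ := exists_reparametrisation hJ hJc ht₀
    (fun t ht ↦ ((hu2 t ht).of_le (by norm_num)).contDiffWithinAt) (fun t _ ↦ Real.exp_pos _)
  have hφJ : ∀ t ∈ J', φ t ∈ J := fun t ht ↦ himg ▸ mem_image_of_mem φ ht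
  refine ⟨φ, J', hJ', hJc', hφ2, fun t ht ↦ ?_, himg, ?_, fun t ht p hp k ↦ ?_⟩
  · rw [(hφd t ht).deriv]; exact (Real.exp_pos _).ne'
  · exact hγ.1.comp hφ2.contMDiffOn hφJ
  change geodAccel D' (γ ∘ φ) p k t = 0
  have hφt : ContDiffAt ℝ 2 φ t := hφ2.contDiffAt (hJ'.mem_nhds ht)
  have hs := hφJ t ht
  have hpk : γ (φ t) ∈ dom n p := hp
  have hc : ∀ i : Fin n, ContDiffAt ℝ 2 (fun s ↦ coordFn p i (γ s)) (φ t) := fun i ↦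
    contDiffAt_comp_curve (hγ2 _ hs) (smoothFn_coordFn hpk i)
  have hd := fun i : Fin n ↦ deriv_deriv_comp (hc i) hφt
  have hφ' : (deriv φ) =ᶠ[nhds t] fun y ↦ u (φ y) :=
    Filter.eventually_of_mem (hJ'.mem_nhds ht) fun y hy ↦ (hφd y hy).deriv
  have hhγ := hasDerivAt_comp_curve ((hγ2 _ hs).of_le (by norm_num)) hpk (hh (γ (φ t))).diff
  have hφ'' : deriv (deriv φ) t = -2 * u (φ t) ^ 2 *
      ∑ i : Fin n, pd p i h (γ (φ t)) * deriv (fun s ↦ coordFn p i (γ s)) (φ t) := by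
    rw [hφ'.deriv_eq]
    have h1 : HasDerivAt u _ (φ t) := (hhγ.const_mul (-2)).exp
    refine ((h1.comp t (hφd t ht)).deriv).trans ?_
    simp only [hu]
    ring
  have hgeo : geodAccel D γ p k (φ t) = 0 := hγ.2 _ hs p hpk k
  simp only [geodAccel, Function.comp_apply] at hgeo ⊢
  simp only [(hd _).1, (hd _).2, hφ'', (hφd t ht).deriv]
  have hacc := eq_neg_of_add_eq_zero_left hgeo
  rw [hacc]
  simp only [hΓ p _ hpk]
  set c : Fin n → ℝ := fun i ↦ deriv (fun s ↦ coordFn p i (γ s)) (φ t) with hcdef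
  have hc' : ∀ i : Fin n, deriv (fun s ↦ coordFn p i (γ s)) (φ t) = c i := fun i ↦ rfl
  simp only [hc']
  have e1 : ∑ i, ∑ j, (christoffel D p k i j (γ (φ t)) + kron k j * pd p i h (γ (φ t))
        + kron k i * pd p j h (γ (φ t))) * (c i * u (φ t)) * (c j * u (φ t))
      = (∑ i, ∑ j, christoffel D p k i j (γ (φ t)) * c i * c j) * u (φ t) ^ 2
        + 2 * c k * u (φ t) ^ 2 * ∑ i, pd p i h (γ (φ t)) * c i := by
    simp only [kron, add_mul, Finset.sum_add_distrib]
    simp only [ite_mul, one_mul, zero_mul, Finset.sum_ite_eq, Finset.mem_univ, if_true]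
    rw [Finset.sum_comm (f := fun i j ↦ if k = i then pd p j h (γ (φ t)) * (c i * u (φ t)) * (c j * u (φ t)) else 0)]
    simp only [Finset.sum_ite_eq, Finset.mem_univ, if_true, Finset.mul_sum, Finset.sum_mul]
    rw [add_assoc, ← Finset.sum_add_distrib]
    congr 1
    · exact Finset.sum_congr rfl fun i _ ↦ Finset.sum_congr rfl fun j _ ↦ by ring
    · exact Finset.sum_congr rfl fun i _ ↦ by ring
  rw [e1]
  ring

end ProjMetric
end

noncomputable section

namespace ProjMetric

variable {n : ℕ} {M : Type*} [TopologicalSpace M] [ChartedSpace (EuclideanSpace ℝ (Fin n)) M]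
variable [IsManifold (𝓡 n) ∞ M]

/-! ### Connections with the same unparametrised geodesics are projectively related -/

/-- Picard–Lindelöf in the chart at `p`, for the first-order system z' = w, w' = -Γ(z)(w, w). -/
theorem exists_geodesic [T2Space M] {D : Conn n M} (hD : IsSmoothTorsionFree D) {p x : M}
    (hx : x ∈ dom n p) (v : Fin n → ℝ) :
    ∃ (γ : ℝ → M) (J : Set ℝ), IsOpen J ∧ J.OrdConnected ∧ 0 ∈ J ∧ γ 0 = x ∧ IsGeodesicOn D γ J ∧
      ∀ k, deriv (fun s ↦ coordFn p k (γ s)) 0 = v k := by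
  let E := EuclideanSpace ℝ (Fin n)
  let Γ : Fin n → Fin n → Fin n → E → ℝ := fun k i j ↦ chartRep p (christoffel D p k i j)
  have htgt : IsOpen (extChartAt (𝓡 n) p).target := isOpen_extChartAt_target p
  have hsymm : ∀ z ∈ (extChartAt (𝓡 n) p).target, (extChartAt (𝓡 n) p).symm z ∈ dom n p := fun z hz ↦ by
    have := (extChartAt (𝓡 n) p).map_target hz
    rwa [extChartAt_source] at this
  have hΓ : ∀ z ∈ (extChartAt (𝓡 n) p).target, ∀ k i j, ContDiffAt ℝ ∞ (Γ k i j) z := fun z hz k i j ↦ by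
    have h1 := (smoothFn_iff (hsymm z hz)).1 (smoothFn_christoffel hD.smooth (hsymm z hz) k i j)
    rwa [(extChartAt (𝓡 n) p).right_inv hz] at h1
  let acc : E × E → E := fun y ↦ WithLp.toLp 2 fun k ↦ -∑ i, ∑ j, Γ k i j y.1 * y.2 i * y.2 j
  have hacc : ∀ y : E × E, y.1 ∈ (extChartAt (𝓡 n) p).target → ContDiffAt ℝ 1 acc y := fun y hy ↦ by
    rw [contDiffAt_euclidean]
    intro k
    refine (ContDiffAt.sum fun i _ ↦ ContDiffAt.sum fun j _ ↦ ?_).neg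
    have h1 : ContDiffAt ℝ 1 (fun y : E × E ↦ Γ k i j y.1) y :=
      ContDiffAt.comp (g := Γ k i j) (f := Prod.fst) y
        ((hΓ _ hy k i j).of_le (by exact_mod_cast le_top)) contDiffAt_fst
    have h2 : ∀ i : Fin n, ContDiffAt ℝ 1 (fun y : E × E ↦ y.2 i) y := fun i ↦
      contDiffAt_euclidean.1 contDiffAt_snd i
    exact (h1.mul (h2 i)).mul (h2 j)
  have hx' : extChartAt (𝓡 n) p x ∈ (extChartAt (𝓡 n) p).target :=
    (extChartAt (𝓡 n) p).map_source (by rwa [extChartAt_source])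
  obtain ⟨α, hα0, ε, hε, hα⟩ := ContDiffAt.exists_forall_mem_closedBall_exists_eq_forall_mem_Ioo_hasDerivAt₀
    (f := fun y : E × E ↦ (y.2, acc y)) (x₀ := (extChartAt (𝓡 n) p x, WithLp.toLp 2 v))
    (contDiffAt_snd.prodMk (hacc _ hx')) 0
  simp only [zero_sub, zero_add] at hα
  have hz : ∀ t ∈ Ioo (-ε) ε, HasDerivAt (fun t ↦ (α t).1) (α t).2 t := fun t ht ↦
    (ContinuousLinearMap.fst ℝ E E).hasFDerivAt.comp_hasDerivAt t (hα t ht)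
  have hw : ∀ t ∈ Ioo (-ε) ε, HasDerivAt (fun t ↦ (α t).2) (acc (α t)) t := fun t ht ↦
    (ContinuousLinearMap.snd ℝ E E).hasFDerivAt.comp_hasDerivAt t (hα t ht)
  have h0 : (0 : ℝ) ∈ Ioo (-ε) ε := ⟨by linarith, hε⟩
  -- The time interval is shrunk so that the solution stays in the target of the chart, where the
  -- inverse chart and the Christoffel symbols are smooth.
  have hev : ∀ᶠ t in nhds (0 : ℝ), t ∈ Ioo (-ε) ε ∧ (α t).1 ∈ (extChartAt (𝓡 n) p).target := by
    refine Filter.Eventually.and (isOpen_Ioo.mem_nhds h0) ?_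
    exact (hz 0 h0).continuousAt.eventually (htgt.mem_nhds (by change (α 0).1 ∈ _; rw [hα0]; exact hx'))
  obtain ⟨δ, hδ, hball⟩ := Metric.eventually_nhds_iff_ball.1 hev
  rw [Real.ball_eq_Ioo, zero_sub, zero_add] at hball
  have hJ : IsOpen (Ioo (-δ) δ) := isOpen_Ioo
  have hz2 : ContDiffOn ℝ 2 (fun t ↦ (α t).1) (Ioo (-δ) δ) := by
    have hd : ∀ t ∈ Ioo (-δ) δ, deriv (fun t ↦ (α t).1) t = (α t).2 := fun t ht ↦
      (hz t (hball t ht).1).deriv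
    have hd2 : ∀ t ∈ Ioo (-δ) δ, deriv (fun t ↦ (α t).2) t = acc (α t) := fun t ht ↦
      (hw t (hball t ht).1).deriv
    rw [show (2 : WithTop ℕ∞) = 1 + 1 by norm_num, contDiffOn_succ_iff_deriv_of_isOpen hJ]
    refine ⟨fun t ht ↦ (hz t (hball t ht).1).differentiableAt.differentiableWithinAt, by simp, ?_⟩
    refine ContDiffOn.congr ?_ hd
    rw [show (1 : WithTop ℕ∞) = 0 + 1 by norm_num, contDiffOn_succ_iff_deriv_of_isOpen hJ]
    refine ⟨fun t ht ↦ (hw t (hball t ht).1).differentiableAt.differentiableWithinAt, by simp, ?_⟩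
    refine contDiffOn_zero.2 (ContinuousOn.congr (fun t ht ↦ ?_) hd2)
    exact ((hacc _ (hball t ht).2).continuousAt.comp (hα t (hball t ht).1).continuousAt).continuousWithinAt
  let γ : ℝ → M := fun t ↦ (extChartAt (𝓡 n) p).symm (α t).1
  have hγ : ContMDiffOn 𝓘(ℝ, ℝ) (𝓡 n) 2 γ (Ioo (-δ) δ) :=
    ((contMDiffOn_extChartAt_symm (n := ∞) p).of_le (WithTop.coe_le_coe.2 le_top)).comp hz2.contMDiffOn
      fun t ht ↦ (hball t ht).2
  have hc : ∀ k, ∀ t ∈ Ioo (-δ) δ, coordFn p k (γ t) = (α t).1 k := fun k t ht ↦ by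
    simp only [coordFn, γ]
    rw [(extChartAt (𝓡 n) p).right_inv (hball t ht).2]
  have hzk : ∀ k : Fin n, ∀ t ∈ Ioo (-δ) δ, HasDerivAt (fun t ↦ (α t).1 k) ((α t).2 k) t := fun k t ht ↦
    (EuclideanSpace.proj (𝕜 := ℝ) k).hasFDerivAt.comp_hasDerivAt t (hz t (hball t ht).1)
  have hwk : ∀ k : Fin n, ∀ t ∈ Ioo (-δ) δ, HasDerivAt (fun t ↦ (α t).2 k) (acc (α t) k) t := fun k t ht ↦
    (EuclideanSpace.proj (𝕜 := ℝ) k).hasFDerivAt.comp_hasDerivAt t (hw t (hball t ht).1)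
  have hd1 : ∀ k, ∀ t ∈ Ioo (-δ) δ, deriv (fun s ↦ coordFn p k (γ s)) t = (α t).2 k := fun k t ht ↦ by
    rw [Filter.EventuallyEq.deriv_eq (Filter.eventually_of_mem (hJ.mem_nhds ht) (hc k))]
    exact (hzk k t ht).deriv
  have hd2 : ∀ k, ∀ t ∈ Ioo (-δ) δ, deriv (deriv fun s ↦ coordFn p k (γ s)) t = acc (α t) k :=
    fun k t ht ↦ by
      rw [Filter.EventuallyEq.deriv_eq (Filter.eventually_of_mem (hJ.mem_nhds ht) (hd1 k))]
      exact (hwk k t ht).deriv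
  have h0δ : (0 : ℝ) ∈ Ioo (-δ) δ := ⟨by linarith, hδ⟩
  refine ⟨γ, Ioo (-δ) δ, hJ, ordConnected_Ioo, h0δ, ?_, ⟨hγ, fun t ht q hq k ↦ ?_⟩, fun k ↦ ?_⟩
  · simp only [γ, hα0]
    exact (extChartAt (𝓡 n) p).left_inv (by rwa [extChartAt_source])
  · refine geodAccel_eq_zero_of_chart D (hγ.contMDiffAt (hJ.mem_nhds ht)) (hsymm _ (hball t ht).2) hq
      (fun l ↦ ?_) k
    simp only [geodAccel, hd2 l t ht, hd1 _ t ht]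
    simp only [acc, Γ, chartRep, γ]
    ring
  · rw [hd1 k 0 h0δ, hα0]

/-- The geodesic through x with velocity v satisfies one equation for `D` and, reparametrised, one
for `D'`. Eliminating the second derivative leaves the difference tensor on (v, v), balanced by the
tangential term from φ''. -/
theorem GeodesicsReparametrise.exists_parallel [T2Space M] {D D' : Conn n M}
    (hD : IsSmoothTorsionFree D) (h : GeodesicsReparametrise D D') {p x : M} (hx : x ∈ dom n p)
    (v : Fin n → ℝ) : ∃ l : ℝ, ∀ k, ∑ i, ∑ j,
      (christoffel D' p k i j x - christoffel D p k i j x) * v i * v j = l * v k := by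
  obtain ⟨γ, J, hJ, hJc, h0, rfl, hγ, hv⟩ := exists_geodesic hD hx v
  obtain ⟨φ, J', hJ', -, hφ, hφ', himg, hγ'⟩ := h γ J hJ hJc hγ
  obtain ⟨t, ht, hφt⟩ : (0 : ℝ) ∈ φ '' J' := himg ▸ h0
  have hφ0 := hφ' t ht
  have hφc : ContDiffAt ℝ 2 φ t := hφ.contDiffAt (hJ'.mem_nhds ht)
  have hc : ∀ i : Fin n, ContDiffAt ℝ 2 (fun s ↦ coordFn p i (γ s)) (φ t) := fun i ↦ by
    rw [hφt]
    exact contDiffAt_comp_curve (hγ.1.contMDiffAt (hJ.mem_nhds h0)) (smoothFn_coordFn hx i)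
  -- The equation for γ ∘ φ reads c''φ'² + c'φ'' + Γ'(c', c')φ'² = 0; c'' = -Γ(c', c') is
  -- substituted and φ'² divided out.
  refine ⟨- deriv (deriv φ) t / deriv φ t ^ 2, fun k ↦ ?_⟩
  have h1 : geodAccel D γ p k 0 = 0 := hγ.2 0 h0 p hx k
  have h2 : geodAccel D' (γ ∘ φ) p k t = 0 :=
    hγ'.2 t ht p (by simpa only [Function.comp_apply, hφt] using hx) k
  simp only [geodAccel, Function.comp_apply] at h1 h2
  simp only [(deriv_deriv_comp (hc _) hφc).1, (deriv_deriv_comp (hc _) hφc).2, hφt, hv] at h1 h2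
  have e1 : ∑ i, ∑ j, christoffel D' p k i j (γ 0) * (v i * deriv φ t) * (v j * deriv φ t)
      = (∑ i, ∑ j, christoffel D' p k i j (γ 0) * v i * v j) * deriv φ t ^ 2 := by
    simp only [Finset.sum_mul]
    exact Finset.sum_congr rfl fun i _ ↦ Finset.sum_congr rfl fun j _ ↦ by ring
  rw [e1, eq_neg_of_add_eq_zero_left h1] at h2
  simp only [sub_mul, Finset.sum_sub_distrib]
  field_simp
  linear_combination h2

end ProjMetric
end

noncomputable section

namespace ProjMetric

variable {n : ℕ} {M : Type*} [TopologicalSpace M] [ChartedSpace (EuclideanSpace ℝ (Fin n)) M]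
variable [IsManifold (𝓡 n) ∞ M]

/-! ### Determinants -/

theorem pd_comp {x : M} {φ : ℝ → ℝ} {φ' : ℝ} {f : M → ℝ}
    (hφ : HasDerivAt φ φ' (f x)) (hf : DiffFn n f x) (p : M) (a : Fin n) :
    pd p a (fun y ↦ φ (f y)) x = φ' * pd p a f x := by
  have h := mfderiv_comp_apply (I := 𝓡 n) (I' := 𝓘(ℝ, ℝ)) (I'' := 𝓘(ℝ, ℝ)) (g := φ) x
    hφ.differentiableAt.mdifferentiableAt hf (coordVec p a x)
  rw [mfderiv_eq_fderiv] at h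
  refine Eq.trans (b := fderiv ℝ φ (f x) (pd p a f x)) h ?_
  rw [hφ.hasFDerivAt.fderiv]
  simp [mul_comm]

theorem SmoothFn.comp {x : M} {φ : ℝ → ℝ} {f : M → ℝ}
    (hφ : ContDiffAt ℝ ∞ φ (f x)) (hf : SmoothFn n f x) : SmoothFn n (fun y ↦ φ (f y)) x :=
  hφ.contMDiffAt.comp x hf

theorem SmoothFn.sum {ι : Type*} {s : Finset ι} {f : ι → M → ℝ} {x : M}
    (hf : ∀ i ∈ s, SmoothFn n (f i) x) : SmoothFn n (fun y ↦ ∑ i ∈ s, f i y) x := by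
  exact contMDiffAt_finsetSum hf

theorem SmoothFn.prod {ι : Type*} {s : Finset ι} {f : ι → M → ℝ} {x : M}
    (hf : ∀ i ∈ s, SmoothFn n (f i) x) : SmoothFn n (fun y ↦ ∏ i ∈ s, f i y) x := by
  exact contMDiffAt_finsetProd hf

theorem SmoothFn.mul {f g : M → ℝ} {x : M}
    (hf : SmoothFn n f x) (hg : SmoothFn n g x) : SmoothFn n (fun y ↦ f y * g y) x :=
  ContMDiffAt.mul hf hg

theorem SmoothFn.det {G : M → Matrix (Fin n) (Fin n) ℝ} {x : M}
    (hG : ∀ i j, SmoothFn n (fun y ↦ G y i j) x) : SmoothFn n (fun y ↦ (G y).det) x := by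
  simp only [Matrix.det_apply']
  exact SmoothFn.sum fun σ _ ↦ SmoothFn.mul contMDiffAt_const (SmoothFn.prod fun i _ ↦ hG _ _)

theorem pd_prod {ι : Type*} [DecidableEq ι] {s : Finset ι} {f : ι → M → ℝ} {x : M}
    (hf : ∀ i ∈ s, SmoothFn n (f i) x) (p : M) (a : Fin n) :
    pd p a (fun y ↦ ∏ i ∈ s, f i y) x = ∑ i ∈ s, (∏ j ∈ s.erase i, f j x) * pd p a (f i) x := by
  induction s using Finset.induction_on with
  | empty => simp [pd_const]
  | insert i s hi ih =>
    simp only [Finset.prod_insert hi]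
    rw [pd_mul (hf i (by simp)).diff (SmoothFn.prod fun j hj ↦ hf j (by simp [hj])).diff,
      ih fun j hj ↦ hf j (by simp [hj]), Finset.sum_insert hi, Finset.erase_insert hi, add_comm,
      Finset.mul_sum]
    refine congrArg₂ _ rfl (Finset.sum_congr rfl fun j hj ↦ ?_)
    have hij : i ≠ j := fun h ↦ hi (h ▸ hj)
    rw [Finset.erase_insert_of_ne hij, Finset.prod_insert (by simp [hi]), mul_assoc]

/-- Jacobi's formula. -/
theorem pd_det {G : M → Matrix (Fin n) (Fin n) ℝ} {x : M}
    (hG : ∀ i j, SmoothFn n (fun y ↦ G y i j) x) (p : M) (a : Fin n) :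
    pd p a (fun y ↦ (G y).det) x =
      ((G x).adjugate * Matrix.of fun i j ↦ pd p a (fun y ↦ G y i j) x).trace := by
  simp only [Matrix.det_apply']
  rw [pd_sum fun σ _ ↦ (SmoothFn.mul contMDiffAt_const (SmoothFn.prod fun i _ ↦ hG _ _)).diff]
  -- Differentiating the j-th factor replaces the j-th column of G by its derivative; the sum over
  -- permutations is then a Cramer determinant.
  have h1 : ∀ σ : Equiv.Perm (Fin n), pd p a (fun y ↦ ((Equiv.Perm.sign σ : ℤ) : ℝ) * ∏ i, G y (σ i) i) x
      = ∑ j, ((Equiv.Perm.sign σ : ℤ) : ℝ) * ∏ i,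
        (G x).updateCol j (fun i ↦ pd p a (fun y ↦ G y i j) x) (σ i) i := fun σ ↦ by
    rw [pd_const_mul _ (SmoothFn.prod fun i _ ↦ hG _ _).diff, pd_prod fun i _ ↦ hG _ _, Finset.mul_sum]
    refine Finset.sum_congr rfl fun j _ ↦ ?_
    rw [← Finset.mul_prod_erase Finset.univ _ (Finset.mem_univ j)]
    simp only [Matrix.updateCol_self]
    rw [mul_comm (∏ _ ∈ _, _)]
    congr 2
    exact Finset.prod_congr rfl fun i hi ↦ (Matrix.updateCol_ne (Finset.ne_of_mem_erase hi)).symm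
  simp only [h1]
  rw [Finset.sum_comm]
  simp only [← Matrix.det_apply', Matrix.trace, Matrix.diag, ← Matrix.cramer_apply,
    Matrix.cramer_eq_adjugate_mulVec]
  rfl

/-- In Jacobi's formula adj(G) cancels G against det G, cyclically under the trace. It serves both
for the metric and for σ. -/
theorem pd_det_of_eq {G : M → Matrix (Fin n) (Fin n) ℝ} {A : Matrix (Fin n) (Fin n) ℝ} {x : M}
    (hG : ∀ i j, SmoothFn n (fun y ↦ G y i j) x) (p : M) (a : Fin n)
    (h : (Matrix.of fun i j ↦ pd p a (fun y ↦ G y i j) x) = A.transpose * G x + G x * A) :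
    pd p a (fun y ↦ (G y).det) x = 2 * A.trace * (G x).det := by
  rw [pd_det hG, h, mul_add, Matrix.trace_add, ← mul_assoc, ← mul_assoc, Matrix.adjugate_mul,
    Matrix.trace_mul_cycle, Matrix.mul_adjugate]
  simp
  ring

/-- The frame `∂₁, …, ∂ₙ` of the chart at `p`. -/
def coordBasis {p x : M} (hx : x ∈ dom n p) : Module.Basis (Fin n) ℝ (TangentSpace (𝓡 n) x) :=
  Module.Basis.ofEquivFun
    { toFun := fun v i ↦ coordCov p i x v
      invFun := fun c ↦ ∑ i, c i • coordVec p i x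
      map_add' := fun v w ↦ by ext i; simp
      map_smul' := fun c v ↦ by ext i; simp
      left_inv := fun v ↦ sum_coordCov_smul hx v
      right_inv := fun c ↦ by ext i; simp [coordCov_coordVec hx, kron] }

theorem coordBasis_apply {p x : M} (hx : x ∈ dom n p) (i : Fin n) : coordBasis hx i = coordVec p i x := by
  rw [coordBasis, Module.Basis.coe_ofEquivFun]
  change ∑ j, (Pi.single i (1 : ℝ) : Fin n → ℝ) j • coordVec p j x = _
  simp [Pi.single_apply]

theorem coordBasis_repr {p x : M} (hx : x ∈ dom n p) (v : TangentSpace (𝓡 n) x) (i : Fin n) :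
    (coordBasis hx).repr v i = coordCov p i x v := rfl

/-- The Jacobian matrix. -/
def jac (q p x : M) : Matrix (Fin n) (Fin n) ℝ :=
  Matrix.of fun b i ↦ coordCov q b x (coordVec p i x)

/-- The component of an `n`-form in the chart at `p`. -/
def volComp (ε : ∀ x : M, (TangentSpace (𝓡 n) x) [⋀^Fin n]→ₗ[ℝ] ℝ) (p x : M) : ℝ :=
  ε x fun i ↦ coordVec p i x

/-! ### Parallel volume forms in a chart. -/

variable {ε : ∀ x : M, (TangentSpace (𝓡 n) x) [⋀^Fin n]→ₗ[ℝ] ℝ}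

theorem volComp_change {p q x : M} (hq : x ∈ dom n q) :
    volComp ε p x = (jac q p x : Matrix (Fin n) (Fin n) ℝ).det * volComp ε q x := by
  have h := congrArg (fun f ↦ f fun i ↦ coordVec p i x) ((ε x).eq_smul_basis_det (coordBasis hq))
  have h2 : (⇑(coordBasis hq) : Fin n → _) = fun i ↦ coordVec q i x := funext (coordBasis_apply hq)
  have h3 : (coordBasis hq).toMatrix (fun i ↦ coordVec p i x) = jac q p x := by
    ext b i
    rfl
  simp only [AlternatingMap.smul_apply, Module.Basis.det_apply, smul_eq_mul, h2, h3] at h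
  rw [mul_comm]
  exact h

theorem volComp_ne_zero (hε : ∀ x, ε x ≠ 0) {p x : M} (hx : x ∈ dom n p) : volComp ε p x ≠ 0 := by
  intro h
  refine hε x ?_
  rw [(ε x).eq_smul_basis_det (coordBasis hx)]
  have : (⇑(coordBasis hx) : Fin n → _) = fun i ↦ coordVec p i x := funext (coordBasis_apply hx)
  rw [this]
  change volComp ε p x • _ = _
  rw [h, zero_smul]

theorem IsParallelVolumeForm.smoothFn_volComp {D : Conn n M} (hε : IsParallelVolumeForm D ε) {p x : M}
    (hx : x ∈ dom n p) : SmoothFn n (volComp ε p) x :=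
  (hε.smooth p).contMDiffAt (dom_mem_nhds hx)

theorem IsParallelVolumeForm.pd_volComp {D : Conn n M} (hε : IsParallelVolumeForm D ε) {p x : M}
    (hx : x ∈ dom n p) (a : Fin n) :
    pd p a (volComp ε p) x = (∑ b, christoffel D p b a b x) * volComp ε p x := by
  have h := hε.parallel p x hx a id
  rw [sub_eq_zero] at h
  rw [show volComp ε p = fun y ↦ ε y (fun i ↦ coordVec p (id i) y) from rfl, h, Finset.sum_mul]
  refine Finset.sum_congr rfl fun i _ ↦ ?_
  rw [← sum_coordCov_smul hx (D (coordVec p (id i)) x (coordVec p a x)), AlternatingMap.map_update_sum]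
  -- Only the ∂ᵢ-component of ∇∂ᵢ survives: every other component repeats an argument of the
  -- alternating form.
  rw [Finset.sum_eq_single i]
  · rw [AlternatingMap.map_update_smul]
    exact congrArg (fun v ↦ coordCov p i x (D (coordVec p i) x (coordVec p a x)) • ε x v)
      (Function.update_eq_self i (fun j ↦ coordVec p j x))
  · intro j _ hj
    rw [AlternatingMap.map_update_smul]
    have := (ε x).map_update_self (v := fun j ↦ coordVec p (id j) x) hj.symm
    simp only [id] at this ⊢
    rw [this, smul_zero]
  · simp

end ProjMetric
end

noncomputable section

namespace ProjMetric

variable {n : ℕ} {M : Type*} [TopologicalSpace M] [ChartedSpace (EuclideanSpace ℝ (Fin n)) M]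
variable [IsManifold (𝓡 n) ∞ M]

open Matrix

variable {ε : ∀ x : M, (TangentSpace (𝓡 n) x) [⋀^Fin n]→ₗ[ℝ] ℝ}

/-! ### Change of charts -/

theorem jac_mul_jac {p q r x : M} (hp : x ∈ dom n p) :
    (jac q p x : Matrix (Fin n) (Fin n) ℝ) * jac p r x = jac q r x := by
  ext b c
  simp only [Matrix.mul_apply, jac, Matrix.of_apply]
  conv_rhs => rw [← sum_coordCov_smul hp (coordVec r c x)]
  simp [mul_comm]

theorem jac_self {p x : M} (hp : x ∈ dom n p) : (jac p p x : Matrix (Fin n) (Fin n) ℝ) = 1 := by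
  ext b c
  simp [jac, coordCov_coordVec hp, kron, Matrix.one_apply]

theorem isUnit_jac {p q x : M} (hp : x ∈ dom n p) (hq : x ∈ dom n q) :
    IsUnit (jac q p x : Matrix (Fin n) (Fin n) ℝ) :=
  IsUnit.of_mul_eq_one (jac p q x) (by rw [jac_mul_jac hp, jac_self hq])

theorem coordCov_change {p x : M} (hp : x ∈ dom n p) (q : M) (b : Fin n) :
    coordCov q b x = ∑ i, (jac q p x : Matrix (Fin n) (Fin n) ℝ) b i • coordCov p i x :=
  (sum_apply_coordVec_smul hp _).symm

theorem coordVec_change {q x : M} (hq : x ∈ dom n q) (p : M) (i : Fin n) :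
    coordVec p i x = ∑ b, (jac q p x : Matrix (Fin n) (Fin n) ℝ) b i • coordVec q b x :=
  (sum_coordCov_smul hq _).symm

/-- The matrix of a bilinear form on covectors. -/
def upMat {x : M} (B : LinearMap.BilinForm ℝ (TangentSpace (𝓡 n) x →L[ℝ] ℝ)) (p : M) :
    Matrix (Fin n) (Fin n) ℝ := Matrix.of fun b c ↦ B (coordCov p b x) (coordCov p c x)

theorem upMat_change {p x : M} (hp : x ∈ dom n p) (q : M)
    (B : LinearMap.BilinForm ℝ (TangentSpace (𝓡 n) x →L[ℝ] ℝ)) :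
    upMat B q = (jac q p x : Matrix (Fin n) (Fin n) ℝ) * upMat B p * (jac q p x)ᵀ := by
  ext b c
  simp only [upMat, Matrix.of_apply, Matrix.mul_apply, Matrix.transpose_apply]
  rw [coordCov_change hp q b, coordCov_change hp q c]
  simp only [map_sum, map_smul, LinearMap.sum_apply, LinearMap.smul_apply, smul_eq_mul, Finset.sum_mul]
  simp only [Finset.mul_sum]
  exact Finset.sum_congr rfl fun i _ ↦ Finset.sum_congr rfl fun j _ ↦ by ring

/-- The matrix of a bilinear form on vectors. -/
def loMat {x : M} (B : TangentSpace (𝓡 n) x →L[ℝ] TangentSpace (𝓡 n) x →L[ℝ] ℝ) (p : M) :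
    Matrix (Fin n) (Fin n) ℝ := Matrix.of fun b c ↦ B (coordVec p b x) (coordVec p c x)

theorem loMat_change {q x : M} (hq : x ∈ dom n q) (p : M)
    (B : TangentSpace (𝓡 n) x →L[ℝ] TangentSpace (𝓡 n) x →L[ℝ] ℝ) :
    loMat B p = (jac q p x : Matrix (Fin n) (Fin n) ℝ)ᵀ * loMat B q * jac q p x := by
  ext b c
  simp only [loMat, Matrix.of_apply, Matrix.mul_apply, Matrix.transpose_apply]
  rw [coordVec_change hq p b, coordVec_change hq p c]
  simp only [map_sum, map_smul, _root_.sum_apply, _root_.smul_apply, smul_eq_mul, Finset.sum_mul]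
  simp only [Finset.mul_sum]
  exact Finset.sum_congr rfl fun i _ ↦ Finset.sum_congr rfl fun j _ ↦ by ring

/-- The bilinear form on covectors with a given matrix. -/
def upForm (p : M) {x : M} (A : Matrix (Fin n) (Fin n) ℝ) :
    LinearMap.BilinForm ℝ (TangentSpace (𝓡 n) x →L[ℝ] ℝ) :=
  LinearMap.mk₂ ℝ (fun α β ↦ ∑ a, ∑ b, A a b * α (coordVec p a x) * β (coordVec p b x))
    (fun α α' β ↦ by simp only [_root_.add_apply, mul_add, add_mul, Finset.sum_add_distrib])
    (fun c α β ↦ by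
      simp only [_root_.smul_apply, smul_eq_mul, Finset.mul_sum]
      exact Finset.sum_congr rfl fun a _ ↦ Finset.sum_congr rfl fun b _ ↦ by ring)
    (fun α β β' ↦ by simp only [_root_.add_apply, mul_add, Finset.sum_add_distrib])
    (fun c α β ↦ by
      simp only [_root_.smul_apply, smul_eq_mul, Finset.mul_sum]
      exact Finset.sum_congr rfl fun a _ ↦ Finset.sum_congr rfl fun b _ ↦ by ring)

theorem upForm_apply (p : M) {x : M} (A : Matrix (Fin n) (Fin n) ℝ) (α β : TangentSpace (𝓡 n) x →L[ℝ] ℝ) :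
    upForm p A α β = (fun a ↦ α (coordVec p a x)) ⬝ᵥ (A *ᵥ fun b ↦ β (coordVec p b x)) := by
  simp only [upForm, LinearMap.mk₂_apply, dotProduct, Matrix.mulVec, Finset.mul_sum]
  exact Finset.sum_congr rfl fun a _ ↦ Finset.sum_congr rfl fun b _ ↦ by ring

theorem upMat_upForm {p x : M} (hp : x ∈ dom n p) (A : Matrix (Fin n) (Fin n) ℝ) :
    upMat (upForm p A : LinearMap.BilinForm ℝ (TangentSpace (𝓡 n) x →L[ℝ] ℝ)) p = A := by
  ext b c
  simp [upMat, upForm, coordCov_coordVec hp, kron]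

/-- Inversion exchanges the transformation laws of lower and upper indices, so a tensor defined by a
matrix inverse in one chart is given by the inverse in every chart. -/
theorem upMat_upForm_inv {p q x : M} (hp : x ∈ dom n p) (hq : x ∈ dom n q) {A B : Matrix (Fin n) (Fin n) ℝ}
    (h : A = (jac q p x : Matrix (Fin n) (Fin n) ℝ)ᵀ * B * jac q p x) :
    upMat (upForm q B⁻¹ : LinearMap.BilinForm ℝ (TangentSpace (𝓡 n) x →L[ℝ] ℝ)) p = A⁻¹ := by
  have hJ := (isUnit_jac hp hq).map Matrix.detMonoidHom
  rw [upMat_change hq, upMat_upForm hq, h, Matrix.mul_inv_rev, Matrix.mul_inv_rev]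
  have h1 : (jac q p x : Matrix (Fin n) (Fin n) ℝ)⁻¹ = jac p q x :=
    Matrix.inv_eq_left_inv (by rw [jac_mul_jac hq, jac_self hp])
  rw [← Matrix.transpose_nonsing_inv, h1, mul_assoc]

/-- The bilinear form on vectors with a given matrix. -/
def loForm (p : M) {x : M} (A : Matrix (Fin n) (Fin n) ℝ) :
    TangentSpace (𝓡 n) x →L[ℝ] TangentSpace (𝓡 n) x →L[ℝ] ℝ :=
  ∑ a, ∑ b, A a b • (coordCov p a x).smulRight (coordCov p b x)

theorem loForm_apply (p : M) {x : M} (A : Matrix (Fin n) (Fin n) ℝ) (v w : TangentSpace (𝓡 n) x) :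
    loForm p A v w = (fun a ↦ coordCov p a x v) ⬝ᵥ (A *ᵥ fun b ↦ coordCov p b x w) := by
  simp only [loForm, _root_.sum_apply, _root_.smul_apply, ContinuousLinearMap.smulRight_apply,
    smul_eq_mul, dotProduct, Matrix.mulVec, Finset.mul_sum]
  exact Finset.sum_congr rfl fun a _ ↦ Finset.sum_congr rfl fun b _ ↦ by ring

theorem loMat_loForm {p x : M} (hp : x ∈ dom n p) (A : Matrix (Fin n) (Fin n) ℝ) :
    loMat (loForm p A : TangentSpace (𝓡 n) x →L[ℝ] TangentSpace (𝓡 n) x →L[ℝ] ℝ) p = A := by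
  ext b c
  simp [loMat, loForm_apply, dotProduct, mulVec, coordCov_coordVec hp, kron]

theorem loMat_loForm_inv {p q x : M} (hp : x ∈ dom n p) (hq : x ∈ dom n q) {A B : Matrix (Fin n) (Fin n) ℝ}
    (h : B = (jac q p x : Matrix (Fin n) (Fin n) ℝ) * A * (jac q p x)ᵀ) :
    loMat (loForm q B⁻¹ : TangentSpace (𝓡 n) x →L[ℝ] TangentSpace (𝓡 n) x →L[ℝ] ℝ) p = A⁻¹ := by
  rw [loMat_change hq, loMat_loForm hq, h, Matrix.mul_inv_rev, Matrix.mul_inv_rev]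
  have h1 : (jac q p x : Matrix (Fin n) (Fin n) ℝ)⁻¹ = jac p q x :=
    Matrix.inv_eq_left_inv (by rw [jac_mul_jac hq, jac_self hp])
  have h2 : (jac p q x : Matrix (Fin n) (Fin n) ℝ) * jac q p x = 1 := by rw [jac_mul_jac hq, jac_self hp]
  rw [← Matrix.transpose_nonsing_inv, h1, mul_assoc, mul_assoc, mul_assoc, h2, mul_one, ← mul_assoc,
    ← Matrix.transpose_mul, h2, Matrix.transpose_one, one_mul]

/-- Global functions are defined by evaluating a chart expression at y in the chart centred at y.
Chart independence identifies them near x with the expression in one fixed chart, so they can be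
differentiated. -/
theorem diag_eventuallyEq {F : M → M → ℝ} (hF : ∀ p q y, y ∈ dom n p → y ∈ dom n q → F p y = F q y)
    {p x : M} (hx : x ∈ dom n p) : (fun y ↦ F y y) =ᶠ[nhds x] F p :=
  Filter.eventually_of_mem (dom_mem_nhds hx) fun y hy ↦ hF y p y (mem_dom_self y) hy

/-! ### Matrices of functions -/

/-- The derivative of a matrix of functions. -/
def pdM (p : M) (a : Fin n) (G : M → Matrix (Fin n) (Fin n) ℝ) (x : M) : Matrix (Fin n) (Fin n) ℝ :=
  Matrix.of fun i j ↦ pd p a (fun y ↦ G y i j) x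

variable (n) in
/-- A matrix of functions that are smooth near a point. -/
def SmoothMat (G : M → Matrix (Fin n) (Fin n) ℝ) (x : M) : Prop := ∀ i j, SmoothFn n (fun y ↦ G y i j) x

theorem SmoothMat.mul {G H : M → Matrix (Fin n) (Fin n) ℝ} {x : M} (hG : SmoothMat n G x)
    (hH : SmoothMat n H x) : SmoothMat n (fun y ↦ G y * H y) x := fun i j ↦ by
  simp only [Matrix.mul_apply]
  exact SmoothFn.sum fun k _ ↦ (hG i k).mul (hH k j)

theorem pdM_mul {G H : M → Matrix (Fin n) (Fin n) ℝ} {x : M} (hG : SmoothMat n G x)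
    (hH : SmoothMat n H x) (p : M) (a : Fin n) :
    pdM p a (fun y ↦ G y * H y) x = pdM p a G x * H x + G x * pdM p a H x := by
  ext i j
  simp only [pdM, Matrix.of_apply, Matrix.mul_apply, Matrix.add_apply]
  rw [pd_sum fun k _ ↦ ((hG i k).mul (hH k j)).diff, ← Finset.sum_add_distrib]
  refine Finset.sum_congr rfl fun k _ ↦ ?_
  rw [pd_mul (hG i k).diff (hH k j).diff]
  ring

theorem pdM_const (p : M) (a : Fin n) (A : Matrix (Fin n) (Fin n) ℝ) (x : M) :
    pdM p a (fun _ : M ↦ A) x = 0 := by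
  ext i j
  exact pd_const p a _ x

theorem pdM_congr {G H : M → Matrix (Fin n) (Fin n) ℝ} {x : M} (h : G =ᶠ[nhds x] H) (p : M) (a : Fin n) :
    pdM p a G x = pdM p a H x := by
  ext i j
  exact pd_congr (h.mono fun y hy ↦ by rw [hy]) p a

theorem SmoothMat.inv {G : M → Matrix (Fin n) (Fin n) ℝ} {x : M} (hG : SmoothMat n G x)
    (h : (G x).det ≠ 0) : SmoothMat n (fun y ↦ (G y)⁻¹) x := fun i j ↦ by
  simp only [Matrix.inv_def, Matrix.smul_apply, Ring.inverse_eq_inv', smul_eq_mul, Matrix.adjugate_apply]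
  refine SmoothFn.mul (SmoothFn.comp (contDiffAt_inv ℝ h) (SmoothFn.det hG)) (SmoothFn.det fun k l ↦ ?_)
  simp only [Matrix.updateRow_apply]
  split_ifs
  · exact contMDiffAt_const
  · exact hG k l

theorem SmoothMat.eventually_isUnit_det {G : M → Matrix (Fin n) (Fin n) ℝ} {x : M} (hG : SmoothMat n G x)
    (h : (G x).det ≠ 0) : ∀ᶠ y in nhds x, IsUnit (G y).det := by
  filter_upwards [(SmoothFn.det hG).continuousAt.eventually_ne h] with y hy using isUnit_iff_ne_zero.2 hy

/-- Differentiation of G⁻¹G = 1, which holds near x. -/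
theorem pdM_inv {G : M → Matrix (Fin n) (Fin n) ℝ} {x : M} (hG : SmoothMat n G x)
    (h : (G x).det ≠ 0) (p : M) (a : Fin n) :
    pdM p a (fun y ↦ (G y)⁻¹) x = - ((G x)⁻¹ * pdM p a G x * (G x)⁻¹) := by
  have h1 := pdM_mul (hG.inv h) hG p a
  have h2 : (fun y ↦ (G y)⁻¹ * G y) =ᶠ[nhds x] fun _ ↦ 1 := by
    filter_upwards [hG.eventually_isUnit_det h] with y hy using Matrix.nonsing_inv_mul _ hy
  rw [pdM_congr h2, pdM_const] at h1
  have h3 := congrArg (· * (G x)⁻¹) (eq_neg_of_add_eq_zero_left h1.symm)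
  simp only [mul_assoc, neg_mul, Matrix.mul_nonsing_inv _ (isUnit_iff_ne_zero.2 h), mul_one] at h3
  rw [h3, mul_assoc]

theorem pdM_smul {f : M → ℝ} {G : M → Matrix (Fin n) (Fin n) ℝ} {x : M} (hf : SmoothFn n f x)
    (hG : SmoothMat n G x) (p : M) (a : Fin n) :
    pdM p a (fun y ↦ f y • G y) x = f x • pdM p a G x + pd p a f x • G x := by
  ext i j
  simp only [pdM, Matrix.of_apply, Matrix.add_apply, Matrix.smul_apply, smul_eq_mul]
  rw [pd_mul hf.diff (hG i j).diff]
  ring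

theorem SmoothMat.smul {f : M → ℝ} {G : M → Matrix (Fin n) (Fin n) ℝ} {x : M} (hf : SmoothFn n f x)
    (hG : SmoothMat n G x) : SmoothMat n (fun y ↦ f y • G y) x := fun i j ↦ hf.mul (hG i j)

/-- The connection matrices. -/
def chr (D : Conn n M) (p : M) (a : Fin n) (x : M) : Matrix (Fin n) (Fin n) ℝ :=
  Matrix.of fun c b ↦ christoffel D p c a b x

/-- If `G` is parallel up to a weight, so is its inverse. -/
theorem pdM_inv_of_eq {G : M → Matrix (Fin n) (Fin n) ℝ} {x : M} (hG : SmoothMat n G x)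
    (h : (G x).det ≠ 0) {p : M} {a : Fin n} {A : Matrix (Fin n) (Fin n) ℝ}
    (hA : pdM p a G x = Aᵀ * G x + G x * A) :
    pdM p a (fun y ↦ (G y)⁻¹) x = - (A * (G x)⁻¹) - (G x)⁻¹ * Aᵀ := by
  have hu := isUnit_iff_ne_zero.2 h
  rw [pdM_inv hG h, hA, mul_add, add_mul, mul_assoc, mul_assoc, Matrix.mul_nonsing_inv _ hu, mul_one,
    Matrix.nonsing_inv_mul_cancel_left _ _ hu]
  abel

end ProjMetric
end

noncomputable section

namespace ProjMetric

namespace TensorCalculus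

open Matrix

/-! ### Tensor calculus over a ring with commuting derivations

Here `∂` is a family of commuting derivations and `A a c b` is the Christoffel symbol
`Γ^c_{ab}`. -/

variable {R : Type*} [CommRing R] {n : ℕ} (δ : Fin n → Derivation ℤ R R)
  (A : Fin n → Matrix (Fin n) (Fin n) R)

/-- The entrywise derivative of a matrix. -/
def dM (a : Fin n) (X : Matrix (Fin n) (Fin n) R) : Matrix (Fin n) (Fin n) R := X.map (δ a)

/-- The entrywise derivative of a vector. -/
def dV (a : Fin n) (v : Fin n → R) : Fin n → R := fun i ↦ δ a (v i)

theorem dM_add (a : Fin n) (X Y : Matrix (Fin n) (Fin n) R) : dM δ a (X + Y) = dM δ a X + dM δ a Y := by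
  ext i j; simp [dM]

theorem dM_sub (a : Fin n) (X Y : Matrix (Fin n) (Fin n) R) : dM δ a (X - Y) = dM δ a X - dM δ a Y := by
  ext i j; simp [dM]

theorem dM_mul (a : Fin n) (X Y : Matrix (Fin n) (Fin n) R) :
    dM δ a (X * Y) = dM δ a X * Y + X * dM δ a Y := by
  ext i j
  simp only [dM, Matrix.map_apply, Matrix.mul_apply, Matrix.add_apply, map_sum, Derivation.leibniz,
    smul_eq_mul, ← Finset.sum_add_distrib]
  exact Finset.sum_congr rfl fun k _ ↦ by ring

theorem dM_transpose (a : Fin n) (X : Matrix (Fin n) (Fin n) R) : dM δ a Xᵀ = (dM δ a X)ᵀ := rfl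

theorem dV_add (a : Fin n) (v w : Fin n → R) : dV δ a (v + w) = dV δ a v + dV δ a w := by
  ext i; simp [dV]

theorem dV_mulVec (a : Fin n) (X : Matrix (Fin n) (Fin n) R) (v : Fin n → R) :
    dV δ a (X *ᵥ v) = dM δ a X *ᵥ v + X *ᵥ dV δ a v := by
  ext i
  simp only [dV, dM, Matrix.mulVec, dotProduct, map_sum, Derivation.leibniz, smul_eq_mul, Pi.add_apply,
    ← Finset.sum_add_distrib, Matrix.map_apply]
  exact Finset.sum_congr rfl fun k _ ↦ by ring

/-- The curvature. -/
def curv (a b : Fin n) : Matrix (Fin n) (Fin n) R :=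
  dM δ a (A b) - dM δ b (A a) + A a * A b - A b * A a

/-- The Ricci tensor. -/
def ric (a b : Fin n) : R := ∑ c, curv δ A c a c b

/-- The derivative of a section of `TM ⊗ TM`. -/
def covUp (a : Fin n) (X : Matrix (Fin n) (Fin n) R) : Matrix (Fin n) (Fin n) R :=
  dM δ a X + A a * X + X * (A a)ᵀ

/-- The derivative of a section of `TM`. -/
def covVec (a : Fin n) (v : Fin n → R) : Fin n → R := dV δ a v + A a *ᵥ v

/-- The derivative of a section of `End TM`. -/
def covEnd (a : Fin n) (X : Matrix (Fin n) (Fin n) R) : Matrix (Fin n) (Fin n) R :=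
  dM δ a X + A a * X - X * A a

theorem curv_antisymm (a b : Fin n) : curv δ A a b = - curv δ A b a := by
  simp only [curv]; abel

variable {δ}

theorem dM_comm (hδ : ∀ a b f, δ a (δ b f) = δ b (δ a f)) (a b : Fin n) (X : Matrix (Fin n) (Fin n) R) :
    dM δ a (dM δ b X) = dM δ b (dM δ a X) := by
  ext i j; exact hδ _ _ _

/-- The Ricci identity. The indices a and b are directions of commuting derivations and are not
themselves differentiated, so no torsion term appears. -/
theorem covUp_comm (hδ : ∀ a b f, δ a (δ b f) = δ b (δ a f)) (a b : Fin n) (X : Matrix (Fin n) (Fin n) R) :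
    covUp δ A a (covUp δ A b X) - covUp δ A b (covUp δ A a X) =
      curv δ A a b * X + X * (curv δ A a b)ᵀ := by
  simp only [covUp, curv, dM_add, dM_mul, dM_transpose, Matrix.transpose_add, Matrix.transpose_sub,
    Matrix.transpose_mul]
  rw [dM_comm hδ a b X]
  noncomm_ring

theorem covVec_comm (hδ : ∀ a b f, δ a (δ b f) = δ b (δ a f)) (a b : Fin n) (v : Fin n → R) :
    covVec δ A a (covVec δ A b v) - covVec δ A b (covVec δ A a v) = curv δ A a b *ᵥ v := by
  have h : dV δ a (dV δ b v) = dV δ b (dV δ a v) := by ext i; exact hδ _ _ _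
  simp only [covVec, curv, dV_add, dV_mulVec, Matrix.mulVec_add, Matrix.add_mulVec, Matrix.sub_mulVec,
    Matrix.mulVec_mulVec, h]
  abel

/-- The second Bianchi identity, that is, the Jacobi identity for the operators ∂ₐ + Aₐ, whose
commutators are the curvature. -/
theorem covEnd_curv (hδ : ∀ a b f, δ a (δ b f) = δ b (δ a f)) (a b c : Fin n) :
    covEnd δ A a (curv δ A b c) + covEnd δ A b (curv δ A c a) + covEnd δ A c (curv δ A a b) = 0 := by
  simp only [covEnd, curv, dM_add, dM_sub, dM_mul]
  rw [dM_comm hδ b a, dM_comm hδ c a, dM_comm hδ c b]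
  noncomm_ring

variable {A}

/-- The first Bianchi identity; `hA` is the vanishing of the torsion. -/
theorem curv_cyclic (hA : ∀ a b c, A a c b = A b c a) (a b d c : Fin n) :
    curv δ A a b c d + curv δ A b d c a + curv δ A d a c b = 0 := by
  simp only [curv, Matrix.add_apply, Matrix.sub_apply, dM, Matrix.map_apply, Matrix.mul_apply]
  rw [hA b d c, hA a d c, hA a b c]
  have h1 : ∑ j, A a c j * A b j d = ∑ j, A a c j * A d j b := by simp only [hA b d]
  have h2 : ∑ j, A b c j * A a j d = ∑ j, A b c j * A d j a := by simp only [hA a d]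
  have h3 : ∑ j, A d c j * A b j a = ∑ j, A d c j * A a j b := by simp only [hA b a]
  rw [h1, h2, h3]
  ring

/-- The quadratic part is a commutator, hence trace-free. The rest is the exterior derivative of the
trace of the connection, which a parallel volume form makes closed. -/
theorem trace_curv (htr : ∀ a b, δ a (A b).trace = δ b (A a).trace) (a b : Fin n) :
    ∑ c, curv δ A a b c c = 0 := by
  have h : (curv δ A a b).trace = 0 := by
    simp only [curv, Matrix.trace_add, Matrix.trace_sub]
    rw [Matrix.trace_mul_comm (A a) (A b)]
    have h1 : ∀ a b, (dM δ a (A b)).trace = δ a (A b).trace := fun a b ↦ by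
      simp [Matrix.trace, dM]
    rw [h1, h1, htr a b]
    ring
  exact h

/-- Contraction of the first Bianchi identity: the skew part of the Ricci tensor is, up to sign, the
trace of the curvature on its endomorphism indices. -/
theorem ric_symm (hA : ∀ a b c, A a c b = A b c a) (htr : ∀ a b, δ a (A b).trace = δ b (A a).trace)
    (a b : Fin n) : ric δ A a b = ric δ A b a := by
  rw [← sub_eq_zero, ric, ric, ← Finset.sum_sub_distrib, ← neg_eq_zero, ← trace_curv htr a b,
    ← Finset.sum_neg_distrib]
  refine Finset.sum_congr rfl fun c _ ↦ ?_
  have h1 := curv_cyclic hA a b c c (δ := δ)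
  have h2 := congrFun (congrFun (curv_antisymm δ A b c) c) a
  simp only [Matrix.neg_apply] at h2
  linear_combination -h1 + h2

theorem sum_curv_eq_neg_ric (a b : Fin n) : ∑ c, curv δ A a c c b = - ric δ A a b := by
  rw [ric, ← Finset.sum_neg_distrib]
  exact Finset.sum_congr rfl fun c _ ↦ by rw [curv_antisymm]; rfl

variable (δ A) in
/-- The covariant derivative of the Ricci tensor. -/
def covRic (e b f : Fin n) : R :=
  δ e (ric δ A b f) - ∑ g, A e g b * ric δ A g f - ∑ g, A e g f * ric δ A b g

/-- The contracted Bianchi identity. -/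
theorem sum_covEnd_curv (hδ : ∀ a b f, δ a (δ b f) = δ b (δ a f)) (hA : ∀ a b c, A a c b = A b c a)
    (e b f : Fin n) :
    ∑ a, covEnd δ A a (curv δ A e b) a f = covRic δ A e b f - covRic δ A b e f
      - ∑ a, ∑ g, A e a g * curv δ A b a g f - ∑ a, ∑ g, A b a g * curv δ A a e g f := by
  have h1 : ∀ a, covEnd δ A a (curv δ A e b) a f =
      - covEnd δ A e (curv δ A b a) a f - covEnd δ A b (curv δ A a e) a f := fun a ↦ by
    have := congrFun (congrFun (covEnd_curv A hδ a e b) a) f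
    simp only [Matrix.add_apply, Matrix.zero_apply] at this
    linear_combination this
  simp only [h1, Finset.sum_sub_distrib, Finset.sum_neg_distrib]
  -- `covEnd` does not differentiate the form indices of the curvature, so the contraction over a
  -- leaves an uncompensated Christoffel term. These terms are kept in the statement and cancel in
  -- `divEnd_curvContr`.
  have h2 : ∀ e b, ∑ a, covEnd δ A e (curv δ A b a) a f =
      - δ e (ric δ A b f) + ∑ a, ∑ g, A e a g * curv δ A b a g f + ∑ g, A e g f * ric δ A b g := by
    intro e b
    simp only [covEnd, Matrix.sub_apply, Matrix.add_apply, Matrix.mul_apply, Finset.sum_sub_distrib,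
      Finset.sum_add_distrib, dM, Matrix.map_apply]
    rw [← map_sum, sum_curv_eq_neg_ric, map_neg, Finset.sum_comm (f := fun a g ↦ curv δ A b a a g * A e g f)]
    simp only [← Finset.sum_mul, sum_curv_eq_neg_ric]
    simp only [neg_mul, Finset.sum_neg_distrib, sub_neg_eq_add]
    simp only [mul_comm]
  have h3 : ∑ a, covEnd δ A b (curv δ A a e) a f =
      δ b (ric δ A e f) + ∑ a, ∑ g, A b a g * curv δ A a e g f - ∑ g, A b g f * ric δ A e g := by
    simp only [covEnd, Matrix.sub_apply, Matrix.add_apply, Matrix.mul_apply, Finset.sum_sub_distrib,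
      Finset.sum_add_distrib, dM, Matrix.map_apply]
    rw [← map_sum, ← ric, Finset.sum_comm (f := fun a g ↦ curv δ A a e a g * A b g f)]
    simp only [← Finset.sum_mul]
    simp only [mul_comm]
    rfl
  rw [h2, h3, covRic, covRic]
  simp only [hA e b]
  ring

end TensorCalculus

end ProjMetric
end

noncomputable section

namespace ProjMetric

namespace TensorCalculus

open Matrix

/-! ### Prolongation of the metrisability equation -/

variable {R : Type*} [CommRing R] {n : ℕ} {δ : Fin n → Derivation ℤ R R}
  {A : Fin n → Matrix (Fin n) (Fin n) R} {S : Matrix (Fin n) (Fin n) R} {μ : Fin n → R}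

variable (δ A S μ) in
/-- The first equation of the prolongation. -/
def IsMetrisability : Prop :=
  ∀ a b c, covUp δ A a S b c = (if a = b then μ c else 0) + if a = c then μ b else 0

variable (δ A) in
/-- The divergence on the second index of a section of `T*M ⊗ TM`. -/
def divEnd (T : Fin n → Fin n → R) (e : Fin n) : R :=
  ∑ a, δ a (T e a) + ∑ a, ∑ g, A a a g * T e g - ∑ a, ∑ g, A a g e * T g a

variable (δ A S) in
/-- The contraction of the curvature with `S`. -/
def curvContr (e a : Fin n) : R := ∑ b, ∑ f, curv δ A e b a f * S f b

variable (δ A S) in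
/-- The product of the Ricci tensor with `S`. -/
def ricMul (e a : Fin n) : R := ∑ f, ric δ A e f * S f a

/-- The Christoffel terms appear because the index b of the Kronecker deltas is held fixed. They are
symmetric in a and b when the torsion vanishes and drop out of the commutator. -/
theorem covUp_covUp (h : IsMetrisability δ A S μ) (a b c d : Fin n) :
    covUp δ A a (covUp δ A b S) c d = (if b = c then covVec δ A a μ d else 0)
      + (if b = d then covVec δ A a μ c else 0) + A a c b * μ d + A a d b * μ c := by
  have hb : covUp δ A b S = Matrix.of fun c d ↦ (if b = c then μ d else 0) + if b = d then μ c else 0 := by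
    ext c d; exact h b c d
  rw [hb]
  simp only [covUp, Matrix.add_apply, dM, Matrix.map_apply, Matrix.mul_apply, Matrix.transpose_apply]
  simp only [Matrix.of_apply, mul_add, add_mul, Finset.sum_add_distrib, mul_ite, ite_mul, zero_mul,
    mul_zero, Finset.sum_ite_eq, Finset.mem_univ, if_true, map_add, covVec, Pi.add_apply, dV,
    Matrix.mulVec, dotProduct]
  have h1 : ∀ c d, δ a (if b = c then μ d else 0) = if b = c then δ a (μ d) else 0 := fun c d ↦ by
    split_ifs <;> simp
  rw [h1, h1]
  split_ifs <;> simp only [Finset.sum_const_zero, mul_comm (μ _) (A _ _ _)] <;> ring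

theorem IsMetrisability.curv_mul (hδ : ∀ a b f, δ a (δ b f) = δ b (δ a f))
    (hA : ∀ a b c, A a c b = A b c a) (h : IsMetrisability δ A S μ) (a b c d : Fin n) :
    ∑ f, curv δ A a b c f * S f d + ∑ f, curv δ A a b d f * S c f =
      (if b = c then covVec δ A a μ d else 0) + (if b = d then covVec δ A a μ c else 0)
      - (if a = c then covVec δ A b μ d else 0) - (if a = d then covVec δ A b μ c else 0) := by
  have h1 := congrFun (congrFun (covUp_comm A hδ a b S) c) d
  simp only [Matrix.sub_apply, covUp_covUp h, Matrix.add_apply, Matrix.mul_apply,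
    Matrix.transpose_apply] at h1
  have h2 : ∑ f, curv δ A a b d f * S c f = ∑ f, S c f * curv δ A a b d f :=
    Finset.sum_congr rfl fun f _ ↦ mul_comm _ _
  rw [h2, ← h1, hA a b c, hA a b d]
  ring

/-- The trace-free part of `∇μ` is determined by the curvature. -/
theorem IsMetrisability.natCast_mul_covVec (hδ : ∀ a b f, δ a (δ b f) = δ b (δ a f))
    (hA : ∀ a b c, A a c b = A b c a) (hS : ∀ a b, S a b = S b a)
    (h : IsMetrisability δ A S μ) (a d : Fin n) :
    (n : R) * covVec δ A a μ d = (if a = d then ∑ b, covVec δ A b μ b else 0)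
      - ricMul δ A S a d + curvContr δ A S a d := by
  -- The integrability condition `curv_mul` is contracted over its second form index and first upper
  -- index.
  have h1 := Finset.sum_congr (rfl : (Finset.univ : Finset (Fin n)) = _)
    fun b _ ↦ h.curv_mul hδ hA a b b d
  simp only [Finset.sum_add_distrib, Finset.sum_sub_distrib, Finset.sum_ite_eq, Finset.sum_ite_eq',
    Finset.mem_univ, if_true, Finset.sum_const, Finset.card_univ, Fintype.card_fin, nsmul_eq_mul] at h1
  have h2 : ∑ b, ∑ f, curv δ A a b b f * S f d = - ricMul δ A S a d := by
    rw [Finset.sum_comm]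
    simp only [← Finset.sum_mul, sum_curv_eq_neg_ric, neg_mul, Finset.sum_neg_distrib, ricMul]
  have h3 : ∑ b, ∑ f, curv δ A a b d f * S b f = curvContr δ A S a d := by
    simp only [curvContr]
    exact Finset.sum_congr rfl fun b _ ↦ Finset.sum_congr rfl fun f _ ↦ by rw [hS]
  have h4 : ∑ b, (if a = d then covVec δ A b μ b else 0) = if a = d then ∑ b, covVec δ A b μ b else 0 := by
    split_ifs <;> simp
  rw [h2, h3, h4] at h1
  linear_combination -h1

/-- Trace of the Ricci identity for μ. It compares the derivative of the divergence of μ with the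
divergence of ∇μ. -/
theorem divEnd_covVec (hδ : ∀ a b f, δ a (δ b f) = δ b (δ a f)) (hA : ∀ a b c, A a c b = A b c a)
    (e : Fin n) :
    δ e (∑ b, covVec δ A b μ b) - divEnd δ A (fun a ↦ covVec δ A a μ) e = - ∑ f, ric δ A e f * μ f := by
  have h1 : ∑ b, (covVec δ A e (covVec δ A b μ) b - covVec δ A b (covVec δ A e μ) b) =
      ∑ b, (curv δ A e b *ᵥ μ) b := Finset.sum_congr rfl fun b _ ↦
    congrFun (covVec_comm A hδ e b μ) b
  have h2 : ∑ b, (curv δ A e b *ᵥ μ) b = - ∑ f, ric δ A e f * μ f := by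
    simp only [Matrix.mulVec, dotProduct]
    rw [Finset.sum_comm]
    simp only [← Finset.sum_mul, sum_curv_eq_neg_ric, neg_mul, Finset.sum_neg_distrib]
  have h3 : ∀ a b (v : Fin n → R), covVec δ A a v b = δ a (v b) + ∑ g, A a b g * v g := fun a b v ↦ rfl
  rw [← h2, ← h1, Finset.sum_sub_distrib]
  simp only [h3 _ _ (covVec δ A _ μ), Finset.sum_add_distrib, divEnd, map_sum]
  have h4 : ∑ a, ∑ g, A a g e * covVec δ A g μ a = ∑ b, ∑ g, A e b g * covVec δ A b μ g := by
    rw [Finset.sum_comm]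
    exact Finset.sum_congr rfl fun b _ ↦ Finset.sum_congr rfl fun g _ ↦ by rw [hA]
  rw [h4]
  ring

theorem divEnd_add (T U : Fin n → Fin n → R) (e : Fin n) :
    divEnd δ A (fun a d ↦ T a d + U a d) e = divEnd δ A T e + divEnd δ A U e := by
  simp only [divEnd, map_add, mul_add, Finset.sum_add_distrib]; ring

theorem divEnd_sub (T U : Fin n → Fin n → R) (e : Fin n) :
    divEnd δ A (fun a d ↦ T a d - U a d) e = divEnd δ A T e - divEnd δ A U e := by
  simp only [divEnd, map_sub, mul_sub, Finset.sum_sub_distrib]; ring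

theorem divEnd_natCast_mul (T : Fin n → Fin n → R) (e : Fin n) :
    divEnd δ A (fun a d ↦ (n : R) * T a d) e = n * divEnd δ A T e := by
  simp only [divEnd, Derivation.leibniz, Derivation.map_natCast, smul_eq_mul, mul_zero, add_zero,
    mul_left_comm _ (n : R), ← Finset.mul_sum]
  ring

theorem divEnd_scalar (φ : R) (e : Fin n) :
    divEnd δ A (fun a d ↦ if a = d then φ else 0) e = δ e φ := by
  have h1 : ∀ a, δ a (if e = a then φ else 0) = if e = a then δ a φ else 0 := fun a ↦ by
    split_ifs <;> simp
  simp only [divEnd, h1, mul_ite, mul_zero, Finset.sum_ite_eq, Finset.sum_ite_eq', Finset.mem_univ, if_true]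
  ring

theorem IsMetrisability.sum_covUp (h : IsMetrisability δ A S μ) (f : Fin n) :
    ∑ a, covUp δ A a S f a = (n + 1) * μ f := by
  have h1 : ∀ a, covUp δ A a S f a = (if a = f then μ a else 0) + μ f := fun a ↦ by
    rw [h a f a]; simp
  simp only [h1, Finset.sum_add_distrib, Finset.sum_ite_eq', Finset.mem_univ, if_true, Finset.sum_const,
    Finset.card_univ, Fintype.card_fin, nsmul_eq_mul]
  ring

theorem IsMetrisability.divEnd_ricMul (h : IsMetrisability δ A S μ) (e : Fin n) :
    divEnd δ A (ricMul δ A S) e = ∑ a, ∑ f, covRic δ A a e f * S f a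
      + (n + 1) * ∑ f, ric δ A e f * μ f := by
  have h1 : ∀ a, δ a (ricMul δ A S e a) = ∑ f, covRic δ A a e f * S f a
      + ∑ f, ric δ A e f * covUp δ A a S f a + ∑ g, A a g e * ricMul δ A S g a
      - ∑ g, A a a g * ricMul δ A S e g := by
    intro a
    have e1 : ∀ f, δ a (ric δ A e f) = covRic δ A a e f + ∑ g, A a g e * ric δ A g f
        + ∑ g, A a g f * ric δ A e g := fun f ↦ by rw [covRic]; ring
    have e2 : ∀ f, δ a (S f a) = covUp δ A a S f a - ∑ g, A a f g * S g a - ∑ g, S f g * A a a g := fun f ↦ by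
      simp only [covUp, Matrix.add_apply, Matrix.mul_apply, Matrix.transpose_apply, dM, Matrix.map_apply]
      ring
    simp only [ricMul, map_sum, Derivation.leibniz, smul_eq_mul, e1, e2, mul_add, mul_sub,
      Finset.sum_add_distrib, Finset.sum_sub_distrib, Finset.mul_sum]
    have e3 : ∑ f, ∑ g, S f a * (A a g e * ric δ A g f) = ∑ g, ∑ f, A a g e * (ric δ A g f * S f a) := by
      rw [Finset.sum_comm]
      exact Finset.sum_congr rfl fun _ _ ↦ Finset.sum_congr rfl fun _ _ ↦ by ring
    have e4 : ∑ f, ∑ g, ric δ A e f * (A a f g * S g a) = ∑ f, ∑ g, S f a * (A a g f * ric δ A e g) := by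
      rw [Finset.sum_comm]
      exact Finset.sum_congr rfl fun _ _ ↦ Finset.sum_congr rfl fun _ _ ↦ by ring
    have e5 : ∑ f, ∑ g, ric δ A e f * (S f g * A a a g) = ∑ g, ∑ f, A a a g * (ric δ A e f * S f g) := by
      rw [Finset.sum_comm]
      exact Finset.sum_congr rfl fun _ _ ↦ Finset.sum_congr rfl fun _ _ ↦ by ring
    rw [e3, e4, e5]
    simp only [mul_comm (S _ a) (covRic δ A _ _ _)]
    ring
  simp only [divEnd, h1, Finset.sum_add_distrib, Finset.sum_sub_distrib]
  have h2 : ∑ a, ∑ f, ric δ A e f * covUp δ A a S f a = (n + 1) * ∑ f, ric δ A e f * μ f := by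
    rw [Finset.sum_comm, Finset.mul_sum]
    refine Finset.sum_congr rfl fun f _ ↦ ?_
    rw [← Finset.mul_sum, h.sum_covUp]
    ring
  rw [h2]
  ring

/-- Leibniz rule. The derivative of the curvature is evaluated by the contracted Bianchi identity.
The derivative of S yields two contractions of the curvature with μ: one is the vanishing
endomorphism trace, the other is minus the Ricci tensor. -/
theorem IsMetrisability.divEnd_curvContr (hδ : ∀ a b f, δ a (δ b f) = δ b (δ a f))
    (hA : ∀ a b c, A a c b = A b c a) (htr : ∀ a b, δ a (A b).trace = δ b (A a).trace)
    (h : IsMetrisability δ A S μ) (e : Fin n) :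
    divEnd δ A (curvContr δ A S) e = ∑ b, ∑ f, (covRic δ A e b f - covRic δ A b e f) * S f b
      - ∑ f, ric δ A e f * μ f := by
  have h0 : ∀ e a, curvContr δ A S e a = ∑ b, (curv δ A e b * S) a b := fun e a ↦ rfl
  have h1 : ∀ a, δ a (curvContr δ A S e a) = ∑ b, (covEnd δ A a (curv δ A e b) * S) a b
      + ∑ b, (curv δ A e b * covUp δ A a S) a b - ∑ g, A a a g * curvContr δ A S e g
      - ∑ b, (curv δ A e b * S * (A a)ᵀ) a b := by
    intro a
    have e1 : ∀ b, dM δ a (curv δ A e b * S) = covEnd δ A a (curv δ A e b) * S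
        + curv δ A e b * covUp δ A a S - A a * (curv δ A e b * S) - curv δ A e b * S * (A a)ᵀ := fun b ↦ by
      rw [dM_mul, covEnd, covUp]; noncomm_ring
    have e2 : ∑ g, A a a g * curvContr δ A S e g = ∑ b, (A a * (curv δ A e b * S)) a b := by
      simp only [h0, Finset.mul_sum]
      rw [Finset.sum_comm]
      rfl
    rw [e2, h0, map_sum]
    simp only [← Finset.sum_add_distrib, ← Finset.sum_sub_distrib]
    exact Finset.sum_congr rfl fun b _ ↦ congrFun (congrFun (e1 b) a) b
  have h2 : ∑ a, ∑ b, (curv δ A e b * covUp δ A a S) a b = - ∑ f, ric δ A e f * μ f := by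
    have e1 : ∀ a b, (curv δ A e b * covUp δ A a S) a b =
        curv δ A e b a a * μ b + if a = b then ∑ f, curv δ A e b a f * μ f else 0 := fun a b ↦ by
      simp only [Matrix.mul_apply, h a, mul_add, mul_ite, mul_zero, Finset.sum_add_distrib,
        Finset.sum_ite_eq, Finset.mem_univ, if_true]
      split_ifs <;> simp
    simp only [e1, Finset.sum_add_distrib, Finset.sum_ite_eq, Finset.mem_univ, if_true]
    rw [Finset.sum_comm]
    simp only [← Finset.sum_mul, trace_curv htr, zero_mul, Finset.sum_const_zero, zero_add]
    rw [Finset.sum_comm]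
    simp only [← Finset.sum_mul, sum_curv_eq_neg_ric, neg_mul, Finset.sum_neg_distrib]
  have h3 : ∑ a, ∑ b, (covEnd δ A a (curv δ A e b) * S) a b =
      ∑ b, ∑ f, (∑ a, covEnd δ A a (curv δ A e b) a f) * S f b := by
    simp only [Matrix.mul_apply, Finset.sum_mul]
    rw [Finset.sum_comm]
    refine Finset.sum_congr rfl fun b _ ↦ ?_
    rw [Finset.sum_comm]
  -- This sum and the next are the Christoffel terms left by the contracted Bianchi identity; they
  -- cancel those from `divEnd` and from the Leibniz rule.
  have h4 : ∑ b, ∑ f, (∑ a, ∑ g, A e a g * curv δ A b a g f) * S f b =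
      - ∑ a, ∑ g, A a g e * curvContr δ A S g a := by
    have e1 : ∀ g a, curvContr δ A S g a = - ∑ b, ∑ f, curv δ A b g a f * S f b := fun g a ↦ by
      simp only [curvContr, ← Finset.sum_neg_distrib]
      refine Finset.sum_congr rfl fun b _ ↦ Finset.sum_congr rfl fun f _ ↦ ?_
      rw [curv_antisymm, Matrix.neg_apply, neg_mul]
    simp only [e1, mul_neg, Finset.sum_neg_distrib, neg_neg, Finset.mul_sum, Finset.sum_mul, ← Finset.sum_product']
    refine Finset.sum_bij' (fun x _ ↦ ⟨x.2.2.2, x.2.2.1, x.1, x.2.1⟩)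
      (fun x _ ↦ ⟨x.2.2.1, x.2.2.2, x.2.1, x.1⟩)
      (by simp) (by simp) (by simp) (by simp) (fun x _ ↦ ?_)
    simp only
    rw [hA e]
    ring
  have h5 : ∑ b, ∑ f, (∑ a, ∑ g, A b a g * curv δ A a e g f) * S f b =
      - ∑ a, ∑ b, (curv δ A e b * S * (A a)ᵀ) a b := by
    have e1 : ∀ b g f, curv δ A e b g f = - curv δ A b e g f := fun b g f ↦ by
      rw [curv_antisymm, Matrix.neg_apply]
    simp only [Matrix.mul_apply, e1, Matrix.transpose_apply, neg_mul, Finset.sum_neg_distrib, neg_neg,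
      Finset.sum_mul, ← Finset.sum_product']
    refine Finset.sum_bij' (fun x _ ↦ ⟨x.2.2.2, x.2.2.1, x.1, x.2.1⟩)
      (fun x _ ↦ ⟨x.2.2.1, x.2.2.2, x.2.1, x.1⟩)
      (by simp) (by simp) (by simp) (by simp) (fun x _ ↦ ?_)
    simp only
    rw [hA x.1]
    ring
  simp only [divEnd, h1, Finset.sum_add_distrib, Finset.sum_sub_distrib]
  rw [h2, h3]
  simp only [sum_covEnd_curv hδ hA, sub_mul, Finset.sum_sub_distrib, h4, h5]
  ring

/-- The last equation of the prolongation, in terms of the divergence of `μ`. -/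
theorem IsMetrisability.deriv_div (hδ : ∀ a b f, δ a (δ b f) = δ b (δ a f))
    (hA : ∀ a b c, A a c b = A b c a) (htr : ∀ a b, δ a (A b).trace = δ b (A a).trace)
    (hS : ∀ a b, S a b = S b a) (h : IsMetrisability δ A S μ) (e : Fin n) :
    ((n : R) - 1) * δ e (∑ b, covVec δ A b μ b) + 2 * (n + 1) * ∑ f, ric δ A e f * μ f
      + 2 * ∑ b, ∑ f, covRic δ A b e f * S f b - ∑ b, ∑ f, covRic δ A e b f * S f b = 0 := by
  have h1 := divEnd_covVec (μ := μ) hδ hA e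
  have h2 : divEnd δ A (fun a d ↦ (n : R) * covVec δ A a μ d) e = _ :=
    congrArg (fun T ↦ divEnd δ A T e)
      (funext fun a ↦ funext fun d ↦ h.natCast_mul_covVec hδ hA hS a d)
  rw [divEnd_natCast_mul, divEnd_add, divEnd_sub, divEnd_scalar] at h2
  have h3 : divEnd δ A (fun a d ↦ ricMul δ A S a d) e = _ := h.divEnd_ricMul e
  have h4 : divEnd δ A (fun a d ↦ curvContr δ A S a d) e = _ := h.divEnd_curvContr hδ hA htr e
  rw [h3, h4] at h2
  simp only [sub_mul, Finset.sum_sub_distrib] at h2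
  -- In n times the commutator identity, n div(∇μ) is replaced by the divergence of the right-hand
  -- side of `natCast_mul_covVec`.
  linear_combination (n : R) * h1 + h2

/-- This completes (n - 1) div μ to n(n - 1)ρ, since Ric = (n - 1)P. Symmetry of the Ricci tensor
merges the two terms in μ. -/
theorem IsMetrisability.deriv_ric_contr (hA : ∀ a b c, A a c b = A b c a)
    (htr : ∀ a b, δ a (A b).trace = δ b (A a).trace) (h : IsMetrisability δ A S μ) (e : Fin n) :
    δ e (∑ b, ∑ f, ric δ A b f * S f b) = ∑ b, ∑ f, covRic δ A e b f * S f b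
      + 2 * ∑ f, ric δ A e f * μ f := by
  have e1 : ∀ b f, δ e (ric δ A b f) = covRic δ A e b f + ∑ g, A e g b * ric δ A g f
      + ∑ g, A e g f * ric δ A b g := fun b f ↦ by rw [covRic]; ring
  have e2 : ∀ b f, δ e (S f b) = covUp δ A e S f b - ∑ g, A e f g * S g b - ∑ g, S f g * A e b g :=
    fun b f ↦ by
      simp only [covUp, Matrix.add_apply, Matrix.mul_apply, Matrix.transpose_apply, dM, Matrix.map_apply]
      ring
  have e3 : ∑ b, ∑ f, ric δ A b f * covUp δ A e S f b = 2 * ∑ f, ric δ A e f * μ f := by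
    simp only [h e, mul_add, mul_ite, mul_zero, Finset.sum_add_distrib, Finset.sum_ite_eq,
      Finset.mem_univ, if_true]
    rw [Finset.sum_comm (f := fun b f ↦ if e = b then ric δ A b f * μ f else 0)]
    simp only [Finset.sum_ite_eq, Finset.mem_univ, if_true]
    rw [two_mul]
    exact congrArg₂ _ (Finset.sum_congr rfl fun b _ ↦ by rw [ric_symm hA htr]) rfl
  simp only [map_sum, Derivation.leibniz, smul_eq_mul, e1, e2, mul_add, mul_sub,
    Finset.sum_add_distrib, Finset.sum_sub_distrib, Finset.mul_sum]
  rw [e3]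
  have e4 : ∑ b, ∑ f, ∑ g, S f b * (A e g b * ric δ A g f) =
      ∑ b, ∑ f, ∑ g, ric δ A b f * (S f g * A e b g) := by
    simp only [← Finset.sum_product']
    refine Finset.sum_bij' (fun x _ ↦ ⟨x.2.2, x.2.1, x.1⟩) (fun x _ ↦ ⟨x.2.2, x.2.1, x.1⟩)
      (by simp) (by simp) (by simp) (by simp) (fun x _ ↦ ?_)
    simp only
    ring
  have e5 : ∑ b, ∑ f, ∑ g, S f b * (A e g f * ric δ A b g) =
      ∑ b, ∑ f, ∑ g, ric δ A b f * (A e f g * S g b) := by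
    refine Finset.sum_congr rfl fun b _ ↦ ?_
    rw [Finset.sum_comm]
    exact Finset.sum_congr rfl fun _ _ ↦ Finset.sum_congr rfl fun _ _ ↦ by ring
  rw [e4, e5]
  simp only [mul_comm (S _ _) (covRic δ A _ _ _), Finset.mul_sum]
  ring

/-- The last equation of the prolongation. -/
theorem IsMetrisability.deriv_last (hδ : ∀ a b f, δ a (δ b f) = δ b (δ a f))
    (hA : ∀ a b c, A a c b = A b c a) (htr : ∀ a b, δ a (A b).trace = δ b (A a).trace)
    (hS : ∀ a b, S a b = S b a) (h : IsMetrisability δ A S μ) (e : Fin n) :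
    ((n : R) - 1) * δ e (∑ b, covVec δ A b μ b) + δ e (∑ b, ∑ f, ric δ A b f * S f b) =
      2 * (∑ b, ∑ f, covRic δ A e b f * S f b - ∑ b, ∑ f, covRic δ A b e f * S f b)
        - 2 * n * ∑ f, ric δ A e f * μ f := by
  rw [h.deriv_ric_contr hA htr]
  linear_combination h.deriv_div hδ hA htr hS e

end TensorCalculus

end ProjMetric
end

noncomputable section

namespace ProjMetric

variable {n : ℕ} {M : Type*} [TopologicalSpace M] [ChartedSpace (EuclideanSpace ℝ (Fin n)) M]
variable [IsManifold (𝓡 n) ∞ M]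

/-! ### The prolonged system in a chart -/

/-- The ring of functions that are smooth on the domain of the chart at `p`. -/
def smoothRing (p : M) : Subring (M → ℝ) where
  carrier := {f | ∀ x ∈ dom n p, SmoothFn n f x}
  mul_mem' hf hg x hx := (hf x hx).mul (hg x hx)
  one_mem' _ _ := contMDiffAt_const
  add_mem' hf hg x hx := ContMDiffAt.add (hf x hx) (hg x hx)
  zero_mem' _ _ := contMDiffAt_const
  neg_mem' hf x hx := ContMDiffAt.neg (hf x hx)

theorem coe_sum_apply {p : M} {ι : Type*} (s : Finset ι) (f : ι → smoothRing (n := n) p) (x : M) :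
    (∑ i ∈ s, f i).1 x = ∑ i ∈ s, (f i).1 x := by
  rw [AddSubmonoidClass.coe_finsetSum, Finset.sum_apply]

/-- The derivation `∂ₐ` of the ring of functions that are smooth on the domain of a chart. -/
def pdDer (p : M) (a : Fin n) : Derivation ℤ (smoothRing (n := n) p) (smoothRing (n := n) p) :=
  Derivation.mk' (AddMonoidHom.toIntLinearMap
    { toFun := fun f ↦ ⟨pd p a f.1, fun _ hx ↦ (f.2 _ hx).pd hx a⟩
      map_zero' := Subtype.ext <| funext fun x ↦ pd_const p a 0 x
      map_add' := fun f g ↦ Subtype.ext <| funext fun x ↦ by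
        by_cases hx : x ∈ dom n p
        · exact pd_add (f.2 x hx).diff (g.2 x hx).diff p a
        · change pd p a _ x = pd p a _ x + pd p a _ x
          simp [pd_of_notMem hx] })
    fun f g ↦ Subtype.ext <| funext fun x ↦ by
      by_cases hx : x ∈ dom n p
      · exact pd_mul (f.2 x hx).diff (g.2 x hx).diff p a
      · change pd p a _ x = f.1 x * pd p a _ x + g.1 x * pd p a _ x
        simp [pd_of_notMem hx]

theorem pdDer_coe (p : M) (a : Fin n) (f : smoothRing (n := n) p) : (pdDer p a f).1 = pd p a f.1 := rfl

theorem pdDer_comm (p : M) (a b : Fin n) (f : smoothRing (n := n) p) :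
    pdDer p a (pdDer p b f) = pdDer p b (pdDer p a f) := by
  refine Subtype.ext <| funext fun x ↦ ?_
  by_cases hx : x ∈ dom n p
  · exact pd_comm hx (f.2 x hx) a b
  · change pd p a _ x = pd p b _ x
    rw [pd_of_notMem hx, pd_of_notMem hx]

variable [T2Space M]

/-- The connection matrices with entries in the ring of functions. -/
def chrRing {D : Conn n M} (hD : IsSmoothTorsionFree D) (p : M) (a : Fin n) :
    Matrix (Fin n) (Fin n) (smoothRing (n := n) p) :=
  Matrix.of fun c b ↦ ⟨christoffel D p c a b, fun _ hx ↦ smoothFn_christoffel hD.smooth hx c a b⟩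

section

variable {D : Conn n M} (p : M)

theorem coe_curv (hD : IsSmoothTorsionFree D) (a b c d : Fin n) :
    (TensorCalculus.curv (pdDer p) (chrRing hD p) a b c d).1 = riem D p a b c d := by
  funext x
  change (pd p a (christoffel D p c b d) x - pd p b (christoffel D p c a d) x
    + (∑ e, chrRing hD p a c e * chrRing hD p b e d : smoothRing p).1 x)
    - (∑ e, chrRing hD p b c e * chrRing hD p a e d : smoothRing p).1 x = _
  rw [coe_sum_apply, coe_sum_apply]
  rfl

theorem coe_ric (hD : IsSmoothTorsionFree D) (hn : 2 ≤ n) (a b : Fin n) (x : M) :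
    (TensorCalculus.ric (pdDer p) (chrRing hD p) a b).1 x = ((n : ℝ) - 1) * schouten D p a b x := by
  have h : (n : ℝ) - 1 ≠ 0 := by
    have : (2 : ℝ) ≤ n := by exact_mod_cast hn
    linarith
  rw [TensorCalculus.ric, coe_sum_apply, schouten]
  simp only [coe_curv]
  field_simp

theorem schouten_eq_ric (hD : IsSmoothTorsionFree D) (hn : 2 ≤ n) (a b : Fin n) :
    schouten D p a b = fun x ↦ ((n : ℝ) - 1)⁻¹ * (TensorCalculus.ric (pdDer p) (chrRing hD p) a b).1 x := by
  have h : (n : ℝ) - 1 ≠ 0 := by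
    have : (2 : ℝ) ≤ n := by exact_mod_cast hn
    linarith
  funext x
  rw [coe_ric p hD hn, inv_mul_cancel_left₀ h]

variable {p}

theorem smoothFn_schouten (hD : IsSmoothTorsionFree D) (hn : 2 ≤ n) {x : M} (hx : x ∈ dom n p) (a b : Fin n) :
    SmoothFn n (schouten D p a b) x := by
  rw [schouten_eq_ric p hD hn]
  exact SmoothFn.mul contMDiffAt_const ((TensorCalculus.ric (pdDer p) (chrRing hD p) a b).2 x hx)

theorem coe_covRic (hD : IsSmoothTorsionFree D) (hn : 2 ≤ n) {x : M} (hx : x ∈ dom n p) (e b f : Fin n) :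
    (TensorCalculus.covRic (pdDer p) (chrRing hD p) e b f).1 x =
      ((n : ℝ) - 1) * covSchouten D p e b f x := by
  have h1 : (TensorCalculus.covRic (pdDer p) (chrRing hD p) e b f).1 x =
      pd p e (TensorCalculus.ric (pdDer p) (chrRing hD p) b f).1 x
      - (∑ g, chrRing hD p e g b * TensorCalculus.ric (pdDer p) (chrRing hD p) g f : smoothRing p).1 x
      - (∑ g, chrRing hD p e g f * TensorCalculus.ric (pdDer p) (chrRing hD p) b g : smoothRing p).1 x := rfl
  have h2 : (TensorCalculus.ric (pdDer p) (chrRing hD p) b f).1 =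
      fun x ↦ ((n : ℝ) - 1) * schouten D p b f x := funext (coe_ric p hD hn b f)
  rw [h1, h2, coe_sum_apply, coe_sum_apply, pd_const_mul _ (smoothFn_schouten hD hn hx b f).diff]
  have h3 : ∀ c d g h, (chrRing hD p e c d * TensorCalculus.ric (pdDer p) (chrRing hD p) g h).1 x =
      ((n : ℝ) - 1) * (christoffel D p c e d x * schouten D p g h x) := fun c d g h ↦ by
    change christoffel D p c e d x * (TensorCalculus.ric (pdDer p) (chrRing hD p) g h).1 x = _
    rw [coe_ric p hD hn]; ring
  simp only [h3, ← Finset.mul_sum, covSchouten]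
  ring

/-! ### The parallel volume form and the prolongation of the top equation. -/

variable {ε : ∀ x : M, (TangentSpace (𝓡 n) x) [⋀^Fin n]→ₗ[ℝ] ℝ}

/-- The trace Γ^c_{ac} is the logarithmic derivative of the component of ε, and second derivatives
of that component commute. -/
theorem pd_sum_christoffel (hD : IsSmoothTorsionFree D) (hε : IsParallelVolumeForm D ε) {x : M} (hx : x ∈ dom n p) (a b : Fin n) :
    pd p a (fun y ↦ ∑ c, christoffel D p c b c y) x = pd p b (fun y ↦ ∑ c, christoffel D p c a c y) x := by
  have hs : ∀ a, SmoothFn n (fun y ↦ ∑ c, christoffel D p c a c y) x := fun a ↦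
    SmoothFn.sum fun c _ ↦ smoothFn_christoffel hD.smooth hx c a c
  have hE := hε.smoothFn_volComp hx
  have h1 : ∀ a b, pd p a (pd p b (volComp ε p)) x =
      (∑ c, christoffel D p c b c x) * ((∑ c, christoffel D p c a c x) * volComp ε p x)
      + volComp ε p x * pd p a (fun y ↦ ∑ c, christoffel D p c b c y) x := fun a b ↦ by
    rw [pd_congr_dom hx (fun y hy ↦ hε.pd_volComp hy b), pd_mul (hs b).diff hE.diff, hε.pd_volComp hx]
  have h2 := pd_comm hx hE a b
  rw [h1, h1] at h2
  refine mul_left_cancel₀ (volComp_ne_zero hε.ne_zero hx) ?_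
  linear_combination h2

theorem deriv_trace_chrRing (hD : IsSmoothTorsionFree D) (hε : IsParallelVolumeForm D ε) (a b : Fin n) :
    pdDer p a (chrRing hD p b).trace = pdDer p b (chrRing hD p a).trace := by
  refine Subtype.ext <| funext fun x ↦ ?_
  have h : ∀ a, (chrRing hD p a).trace.1 = fun y ↦ ∑ c, christoffel D p c a c y := fun a ↦ funext fun y ↦
    coe_sum_apply _ _ _
  rw [pdDer_coe, pdDer_coe, h, h]
  by_cases hx : x ∈ dom n p
  · exact pd_sum_christoffel hD hε hx a b
  · rw [pd_of_notMem hx, pd_of_notMem hx]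

theorem chrRing_symm (hD : IsSmoothTorsionFree D) (a b c : Fin n) : chrRing hD p a c b = chrRing hD p b c a :=
  Subtype.ext <| funext fun x ↦ christoffel_symm hD.torsion_eq_zero p c a b x

variable (D p) in
/-- The last component of a solution of the prolonged system. -/
def lastComp (S : Fin n → Fin n → M → ℝ) (μ : Fin n → M → ℝ) (x : M) : ℝ :=
  1 / (n : ℝ) * (∑ b, (pd p b (μ b) x + ∑ d, christoffel D p b b d x * μ d x)
    + ∑ b, ∑ c, schouten D p b c x * S b c x)

variable {S : Fin n → Fin n → M → ℝ} {μ : Fin n → M → ℝ}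

/-- The top equation implies the other two for this choice of last component. The algebraic
identities are applied in the ring of functions smooth on the chart, where coordinate derivatives
are commuting derivations, and are then evaluated at x. -/
theorem prolongation (hD : IsSmoothTorsionFree D) (hn : 2 ≤ n) (hε : IsParallelVolumeForm D ε)
    (hS : ∀ x ∈ dom n p, ∀ b c, SmoothFn n (S b c) x) (hμ : ∀ x ∈ dom n p, ∀ b, SmoothFn n (μ b) x)
    (hμ0 : ∀ x ∉ dom n p, ∀ b, μ b x = 0) (hsymm : ∀ b c, S b c = S c b)
    (top : ∀ x ∈ dom n p, ∀ a b c, pd p a (S b c) x + ∑ d, christoffel D p b a d x * S d c x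
      + ∑ d, christoffel D p c a d x * S b d x = kron a b * μ c x + kron a c * μ b x)
    {x : M} (hx : x ∈ dom n p) :
    (∀ a b, pd p a (μ b) x + ∑ d, christoffel D p b a d x * μ d x - kron a b * lastComp D p S μ x
      + ∑ c, schouten D p a c x * S b c x
      - 1 / (n : ℝ) * ∑ c, ∑ d, weyl D p a c b d x * S c d x = 0) ∧
    ∀ a, pd p a (lastComp D p S μ) x + 2 * ∑ b, schouten D p a b x * μ b x
      - 1 / (n : ℝ) * ∑ b, ∑ c, 4 * cottonYork D p a b c x * S b c x = 0 := by
  have hn0 : (n : ℝ) ≠ 0 := by positivity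
  have hn1 : (n : ℝ) - 1 ≠ 0 := by
    have : (2 : ℝ) ≤ n := by exact_mod_cast hn
    linarith
  let SR : Matrix (Fin n) (Fin n) (smoothRing (n := n) p) := Matrix.of fun b c ↦ ⟨S b c, fun x hx ↦ hS x hx b c⟩
  let μR : Fin n → smoothRing (n := n) p := fun b ↦ ⟨μ b, fun x hx ↦ hμ x hx b⟩
  have hSR : ∀ a b, SR a b = SR b a := fun a b ↦ Subtype.ext (hsymm a b)
  have hmet : TensorCalculus.IsMetrisability (pdDer p) (chrRing hD p) SR μR := fun a b c ↦ by
    refine Subtype.ext <| funext fun y ↦ ?_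
    have h1 : (TensorCalculus.covUp (pdDer p) (chrRing hD p) a SR b c).1 y = pd p a (S b c) y
        + (∑ d, chrRing hD p a b d * SR d c : smoothRing p).1 y
        + (∑ d, SR b d * chrRing hD p a c d : smoothRing p).1 y := rfl
    have h2 : ((if a = b then μR c else 0) + if a = c then μR b else 0 : smoothRing p).1 y =
        kron a b * μ c y + kron a c * μ b y := by
      simp only [kron]
      split_ifs <;> simp [μR]
    rw [h1, h2, coe_sum_apply, coe_sum_apply]
    by_cases hy : y ∈ dom n p
    · rw [← top y hy a b c]
      exact congrArg₂ _ rfl (Finset.sum_congr rfl fun d _ ↦ mul_comm _ _)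
    -- Equality in `smoothRing` is equality on all of `M`; off the chart every term is zero by
    -- default.
    · rw [pd_of_notMem hy, hμ0 y hy, hμ0 y hy, Finset.sum_eq_zero, Finset.sum_eq_zero]
      · ring
      · intro d _
        change S b d y * christoffel D p c a d y = 0
        rw [christoffel_of_notMem D hy, mul_zero]
      · intro d _
        change christoffel D p b a d y * S d c y = 0
        rw [christoffel_of_notMem D hy, zero_mul]
  have hcov : ∀ a b y, (TensorCalculus.covVec (pdDer p) (chrRing hD p) a μR b).1 y =
      pd p a (μ b) y + ∑ d, christoffel D p b a d y * μ d y := fun a b y ↦ by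
    change pd p a (μ b) y + (∑ d, chrRing hD p a b d * μR d : smoothRing p).1 y = _
    rw [coe_sum_apply]
    rfl
  have hmid := hmet.natCast_mul_covVec (pdDer_comm p) (chrRing_symm hD) hSR
  have hlast := hmet.deriv_last (pdDer_comm p) (chrRing_symm hD) (deriv_trace_chrRing hD hε) hSR
  have hdiv : ∀ y, (∑ b, TensorCalculus.covVec (pdDer p) (chrRing hD p) b μR b : smoothRing p).1 y =
      ∑ b, (pd p b (μ b) y + ∑ d, christoffel D p b b d y * μ d y) := fun y ↦ by
    rw [coe_sum_apply]; simp only [hcov]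
  have hricS : ∀ y, (∑ b, ∑ f, TensorCalculus.ric (pdDer p) (chrRing hD p) b f * SR f b : smoothRing p).1 y =
      ((n : ℝ) - 1) * ∑ b, ∑ f, schouten D p b f y * S b f y := fun y ↦ by
    rw [coe_sum_apply, Finset.mul_sum]
    refine Finset.sum_congr rfl fun b _ ↦ ?_
    rw [coe_sum_apply, Finset.mul_sum]
    refine Finset.sum_congr rfl fun f _ ↦ ?_
    change (TensorCalculus.ric (pdDer p) (chrRing hD p) b f).1 y * S f b y = _
    rw [coe_ric p hD hn, hsymm f b]; ring
  refine ⟨fun a b ↦ ?_, fun a ↦ ?_⟩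
  · have h1 := congrFun (congrArg Subtype.val (hmid a b)) x
    have h2 : ((n : smoothRing (n := n) p) * TensorCalculus.covVec (pdDer p) (chrRing hD p) a μR b).1 x =
        n * (pd p a (μ b) x + ∑ d, christoffel D p b a d x * μ d x) := by
      rw [← hcov]; rfl
    have h3 : ((if a = b then ∑ b, TensorCalculus.covVec (pdDer p) (chrRing hD p) b μR b else 0)
        - TensorCalculus.ricMul (pdDer p) (chrRing hD p) SR a b
        + TensorCalculus.curvContr (pdDer p) (chrRing hD p) SR a b : smoothRing p).1 x =
        kron a b * ∑ b, (pd p b (μ b) x + ∑ d, christoffel D p b b d x * μ d x)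
        - ((n : ℝ) - 1) * ∑ c, schouten D p a c x * S b c x + ∑ c, ∑ d, riem D p a c b d x * S c d x := by
      refine congrArg₂ (fun u v : ℝ ↦ u + v) (congrArg₂ (fun u v : ℝ ↦ u - v) ?_ ?_) ?_
      · simp only [kron]
        split_ifs
        · rw [hdiv, one_mul]
        · simp
      · rw [TensorCalculus.ricMul, coe_sum_apply, Finset.mul_sum]
        refine Finset.sum_congr rfl fun f _ ↦ ?_
        change (TensorCalculus.ric (pdDer p) (chrRing hD p) a f).1 x * S f b x = _
        rw [coe_ric p hD hn, hsymm f b]; ring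
      · rw [TensorCalculus.curvContr, coe_sum_apply]
        refine Finset.sum_congr rfl fun c _ ↦ ?_
        rw [coe_sum_apply]
        refine Finset.sum_congr rfl fun d _ ↦ ?_
        change (TensorCalculus.curv (pdDer p) (chrRing hD p) a c b d).1 x * S d c x = _
        rw [coe_curv, hsymm d c]
    rw [h2, h3] at h1
    -- The Schouten terms of the Weyl tensor supply the part P·S of nρ and change the coefficient n
    -- - 1 of the Ricci term to n.
    have h4 : ∑ c, ∑ d, weyl D p a c b d x * S c d x = ∑ c, ∑ d, riem D p a c b d x * S c d x
        - kron a b * ∑ c, ∑ d, schouten D p c d x * S c d x + ∑ d, schouten D p a d x * S b d x := by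
      simp only [weyl, sub_mul, add_mul, Finset.sum_add_distrib, Finset.sum_sub_distrib, Finset.mul_sum,
        mul_assoc]
      congr 1
      rw [Finset.sum_comm]
      simp [kron]
    rw [h4, lastComp]
    field_simp
    linear_combination h1
  · have h1 := congrFun (congrArg Subtype.val (hlast a)) x
    have h5 : ∀ e : Fin n → Fin n → Fin n × Fin n × Fin n,
        (∑ b, ∑ f, TensorCalculus.covRic (pdDer p) (chrRing hD p) (e b f).1 (e b f).2.1 (e b f).2.2 * SR f b
          : smoothRing p).1 x = ((n : ℝ) - 1) *
            ∑ b, ∑ f, covSchouten D p (e b f).1 (e b f).2.1 (e b f).2.2 x * S b f x := fun e ↦ by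
      rw [coe_sum_apply, Finset.mul_sum]
      refine Finset.sum_congr rfl fun b _ ↦ ?_
      rw [coe_sum_apply, Finset.mul_sum]
      refine Finset.sum_congr rfl fun f _ ↦ ?_
      change (TensorCalculus.covRic (pdDer p) (chrRing hD p) _ _ _).1 x * S f b x = _
      rw [coe_covRic hD hn hx, hsymm f b]; ring
    have h6 : (∑ f, TensorCalculus.ric (pdDer p) (chrRing hD p) a f * μR f : smoothRing p).1 x =
        ((n : ℝ) - 1) * ∑ b, schouten D p a b x * μ b x := by
      rw [coe_sum_apply, Finset.mul_sum]
      refine Finset.sum_congr rfl fun b _ ↦ ?_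
      change (TensorCalculus.ric (pdDer p) (chrRing hD p) a b).1 x * μ b x = _
      rw [coe_ric p hD hn]; ring
    have h2 : (((n : smoothRing (n := n) p) - 1) * pdDer p a (∑ b, TensorCalculus.covVec (pdDer p) (chrRing hD p) b μR b)
        + pdDer p a (∑ b, ∑ f, TensorCalculus.ric (pdDer p) (chrRing hD p) b f * SR f b)).1 x =
        (n : ℝ) * (n - 1) * pd p a (lastComp D p S μ) x := by
      -- Division by n - 1 turns the Ricci contraction into that with P, so the left side of
      -- `deriv_last` is n(n - 1)∂ρ.
      have e1 : lastComp D p S μ = fun y ↦ 1 / (n : ℝ) *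
          ((∑ b, TensorCalculus.covVec (pdDer p) (chrRing hD p) b μR b : smoothRing p).1 y
          + ((n : ℝ) - 1)⁻¹ *
            (∑ b, ∑ f, TensorCalculus.ric (pdDer p) (chrRing hD p) b f * SR f b : smoothRing p).1 y) := by
        funext y
        rw [hdiv, hricS, lastComp, inv_mul_cancel_left₀ hn1]
      rw [e1, pd_const_mul, pd_add, pd_const_mul]
      · have e2 : ((n : smoothRing (n := n) p) - 1).1 x = (n : ℝ) - 1 := rfl
        change ((n : smoothRing (n := n) p) - 1).1 x * pd p a _ x + pd p a _ x = _
        rw [e2]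
        field_simp
      · exact (Subtype.property (∑ b, ∑ f, TensorCalculus.ric (pdDer p) (chrRing hD p) b f * SR f b) x hx).diff
      · exact (Subtype.property (∑ b, TensorCalculus.covVec (pdDer p) (chrRing hD p) b μR b) x hx).diff
      · exact (SmoothFn.mul contMDiffAt_const (Subtype.property (∑ b, ∑ f, TensorCalculus.ric (pdDer p) (chrRing hD p) b f * SR f b) x hx)).diff
      · exact (ContMDiffAt.add (Subtype.property (∑ b, TensorCalculus.covVec (pdDer p) (chrRing hD p) b μR b) x hx) (SmoothFn.mul contMDiffAt_const (Subtype.property (∑ b, ∑ f, TensorCalculus.ric (pdDer p) (chrRing hD p) b f * SR f b) x hx))).mdifferentiableAt (by simp)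
    have h3 : (2 * (∑ b, ∑ f, TensorCalculus.covRic (pdDer p) (chrRing hD p) a b f * SR f b
        - ∑ b, ∑ f, TensorCalculus.covRic (pdDer p) (chrRing hD p) b a f * SR f b)
        - 2 * (n : smoothRing (n := n) p) * ∑ f, TensorCalculus.ric (pdDer p) (chrRing hD p) a f * μR f).1 x =
        2 * (((n : ℝ) - 1) * ∑ b, ∑ f, covSchouten D p a b f x * S b f x
          - ((n : ℝ) - 1) * ∑ b, ∑ f, covSchouten D p b a f x * S b f x)
        - 2 * n * (((n : ℝ) - 1) * ∑ b, schouten D p a b x * μ b x) := by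
      rw [← h6, ← h5 fun b f ↦ (a, b, f), ← h5 fun b f ↦ (b, a, f)]
      rfl
    rw [h2, h3] at h1
    have h4 : ∑ b, ∑ c, 4 * cottonYork D p a b c x * S b c x =
        2 * (∑ b, ∑ f, covSchouten D p a b f x * S b f x - ∑ b, ∑ f, covSchouten D p b a f x * S b f x) := by
      simp only [← Finset.sum_sub_distrib, Finset.mul_sum, cottonYork]
      exact Finset.sum_congr rfl fun b _ ↦ Finset.sum_congr rfl fun c _ ↦ by ring
    rw [h4]
    have h7 : (n : ℝ) * pd p a (lastComp D p S μ) x =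
        2 * (∑ b, ∑ f, covSchouten D p a b f x * S b f x - ∑ b, ∑ f, covSchouten D p b a f x * S b f x)
        - 2 * n * ∑ b, schouten D p a b x * μ b x :=
      mul_left_cancel₀ hn1 (by linear_combination h1)
    field_simp
    linear_combination h7

theorem smoothFn_lastComp (hD : IsSmoothTorsionFree D) (hn : 2 ≤ n) {x : M} (hx : x ∈ dom n p)
    (hS : ∀ b c, SmoothFn n (S b c) x) (hμ : ∀ b, SmoothFn n (μ b) x) :
    SmoothFn n (lastComp D p S μ) x := by
  refine SmoothFn.mul contMDiffAt_const (ContMDiffAt.add ?_ ?_)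
  · exact SmoothFn.sum fun b _ ↦ ContMDiffAt.add ((hμ b).pd hx b)
      (SmoothFn.sum fun d _ ↦ (smoothFn_christoffel hD.smooth hx b b d).mul (hμ d))
  · exact SmoothFn.sum fun b _ ↦ SmoothFn.sum fun c _ ↦ (smoothFn_schouten hD hn hx b c).mul (hS b c)

end

end ProjMetric
end

noncomputable section

namespace ProjMetric

variable {n : ℕ} {M : Type*} [TopologicalSpace M] [ChartedSpace (EuclideanSpace ℝ (Fin n)) M]
variable [IsManifold (𝓡 n) ∞ M]

open Matrix

/-! ### The curvature is a tensor -/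

theorem jac_apply_eq {p q x : M} (hq : x ∈ dom n q) (c b : Fin n) :
    (jac q p x : Matrix (Fin n) (Fin n) ℝ) c b = pd p b (coordFn q c) x :=
  (mvfderiv_coordFn hq c _).symm

theorem jac_eventuallyEq {p q x : M} (hq : x ∈ dom n q) (c b : Fin n) :
    (fun y ↦ (jac q p y : Matrix (Fin n) (Fin n) ℝ) c b) =ᶠ[nhds x] pd p b (coordFn q c) :=
  Filter.eventually_of_mem (dom_mem_nhds hq) fun _ hy ↦ jac_apply_eq hy c b

theorem smoothMat_jac {p q x : M} (hp : x ∈ dom n p) (hq : x ∈ dom n q) :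
    SmoothMat n (fun y ↦ (jac q p y : Matrix (Fin n) (Fin n) ℝ)) x := fun c b ↦
  ((smoothFn_coordFn hq c).pd hp b).congr_of_eventuallyEq (jac_eventuallyEq hq c b)

theorem pd_jac {p q x : M} (hq : x ∈ dom n q) (a b c : Fin n) :
    pd p a (fun y ↦ (jac q p y : Matrix (Fin n) (Fin n) ℝ) c b) x = pd p a (pd p b (coordFn q c)) x :=
  pd_congr (jac_eventuallyEq hq c b) p a

theorem pd_jac_comm {p q x : M} (hp : x ∈ dom n p) (hq : x ∈ dom n q) (a b c : Fin n) :
    pd p a (fun y ↦ (jac q p y : Matrix (Fin n) (Fin n) ℝ) c b) x =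
      pd p b (fun y ↦ (jac q p y : Matrix (Fin n) (Fin n) ℝ) c a) x := by
  rw [pd_jac hq, pd_jac hq, pd_comm hp (smoothFn_coordFn hq c)]

theorem pd_change {p q x : M} (hq : x ∈ dom n q) (f : M → ℝ) (a : Fin n) :
    pd p a f x = ∑ j, (jac q p x : Matrix (Fin n) (Fin n) ℝ) j a * pd q j f x :=
  mvfderiv_apply hq f _

theorem pdM_add {G H : M → Matrix (Fin n) (Fin n) ℝ} {x : M} (hG : SmoothMat n G x)
    (hH : SmoothMat n H x) (p : M) (a : Fin n) :
    pdM p a (fun y ↦ G y + H y) x = pdM p a G x + pdM p a H x := by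
  ext i j
  exact pd_add (hG i j).diff (hH i j).diff p a

theorem pdM_sum {ι : Type*} {s : Finset ι} {G : ι → M → Matrix (Fin n) (Fin n) ℝ} {x : M}
    (hG : ∀ i ∈ s, SmoothMat n (G i) x) (p : M) (a : Fin n) :
    pdM p a (fun y ↦ ∑ i ∈ s, G i y) x = ∑ i ∈ s, pdM p a (G i) x := by
  ext i j
  simp only [pdM, Matrix.of_apply, Matrix.sum_apply]
  exact pd_sum (fun k hk ↦ (hG k hk i j).diff) p a

theorem SmoothMat.pdM {G : M → Matrix (Fin n) (Fin n) ℝ} {p x : M} (hx : x ∈ dom n p)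
    (hG : SmoothMat n G x) (a : Fin n) : SmoothMat n (pdM p a G) x := fun i j ↦ (hG i j).pd hx a

theorem SmoothMat.sum {ι : Type*} {s : Finset ι} {G : ι → M → Matrix (Fin n) (Fin n) ℝ} {x : M}
    (hG : ∀ i ∈ s, SmoothMat n (G i) x) : SmoothMat n (fun y ↦ ∑ i ∈ s, G i y) x := fun i j ↦ by
  simp only [Matrix.sum_apply]
  exact SmoothFn.sum fun k hk ↦ hG k hk i j

theorem pdM_comm {G : M → Matrix (Fin n) (Fin n) ℝ} {p x : M} (hx : x ∈ dom n p)
    (hG : SmoothMat n G x) (a b : Fin n) : pdM p a (pdM p b G) x = pdM p b (pdM p a G) x := by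
  ext i j
  exact pd_comm hx (hG i j) a b

/-- The curvature as a matrix. -/
def riemMat (D : Conn n M) (p : M) (a b : Fin n) (x : M) : Matrix (Fin n) (Fin n) ℝ :=
  Matrix.of fun c d ↦ riem D p a b c d x

theorem riemMat_eq (D : Conn n M) (p : M) (a b : Fin n) (x : M) :
    riemMat D p a b x = pdM p a (chr D p b) x - pdM p b (chr D p a) x + chr D p a x * chr D p b x
      - chr D p b x * chr D p a x := rfl

variable [T2Space M]

theorem smoothMat_chr {D : Conn n M} (hD : IsSmoothTorsionFree D) {p x : M} (hx : x ∈ dom n p) (a : Fin n) :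
    SmoothMat n (chr D p a) x := fun c b ↦ smoothFn_christoffel hD.smooth hx c a b

/-- The connection matrices of the frame of the chart at `q` in the coordinate directions of the
chart at `p`. -/
def chrAlong (D : Conn n M) (q p : M) (a : Fin n) (x : M) : Matrix (Fin n) (Fin n) ℝ :=
  ∑ i, (jac q p x : Matrix (Fin n) (Fin n) ℝ) i a • chr D q i x

-- The transformation law of the Christoffel symbols as a gauge transformation, with the Jacobian as
-- gauge.
omit [T2Space M] in
theorem jac_mul_chr (D : Conn n M) {p q x : M} (hp : x ∈ dom n p) (hq : x ∈ dom n q) (a : Fin n) :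
    jac q p x * chr D p a x = pdM p a (fun y ↦ jac q p y) x + chrAlong D q p a x * jac q p x := by
  ext c j
  have h := christoffel_change D hp hq a j c
  simp only [← jac_apply_eq hq, ← pd_jac hq] at h
  have h2 : ((jac q p x : Matrix (Fin n) (Fin n) ℝ) * chr D p a x) c j =
      ∑ l, christoffel D p l a j x * (jac q p x : Matrix (Fin n) (Fin n) ℝ) c l := by
    rw [Matrix.mul_apply]
    exact Finset.sum_congr rfl fun l _ ↦ mul_comm _ _
  have h3 : (chrAlong D q p a x * (jac q p x : Matrix (Fin n) (Fin n) ℝ)) c j = ∑ i, ∑ b, christoffel D q c i b x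
      * (jac q p x : Matrix (Fin n) (Fin n) ℝ) i a * (jac q p x : Matrix (Fin n) (Fin n) ℝ) b j := by
    simp only [Matrix.mul_apply, chrAlong, Matrix.sum_apply, Matrix.smul_apply, smul_eq_mul, Finset.sum_mul]
    rw [Finset.sum_comm]
    refine Finset.sum_congr rfl fun i _ ↦ Finset.sum_congr rfl fun b _ ↦ ?_
    simp only [chr, Matrix.of_apply]
    ring
  rw [h2, Matrix.add_apply, h3, h, pd_jac hq, ← pd_jac hq]
  rfl

theorem smoothMat_chrAlong {D : Conn n M} (hD : IsSmoothTorsionFree D) {p q x : M} (hp : x ∈ dom n p)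
    (hq : x ∈ dom n q) (a : Fin n) : SmoothMat n (chrAlong D q p a) x :=
  SmoothMat.sum fun i _ ↦ SmoothMat.smul (smoothMat_jac hp hq i a) (smoothMat_chr hD hq i)

/-- Gauge covariance of the curvature: the gauge law is differentiated and skew-symmetrised, so that
the second derivatives of the Jacobian cancel. -/
theorem jac_mul_riemMat_aux {D : Conn n M} (hD : IsSmoothTorsionFree D) {p q x : M} (hp : x ∈ dom n p)
    (hq : x ∈ dom n q) (a b : Fin n) :
    jac q p x * riemMat D p a b x = (pdM p a (chrAlong D q p b) x - pdM p b (chrAlong D q p a) x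
      + chrAlong D q p a x * chrAlong D q p b x - chrAlong D q p b x * chrAlong D q p a x) * jac q p x := by
  have hJ := smoothMat_jac hp hq
  have hev : ∀ a, (fun y ↦ (jac q p y : Matrix (Fin n) (Fin n) ℝ) * chr D p a y) =ᶠ[nhds x]
      fun y ↦ pdM p a (fun y ↦ jac q p y) y + chrAlong D q p a y * jac q p y := fun a ↦ by
    filter_upwards [dom_mem_nhds hp, dom_mem_nhds hq] with y hy1 hy2 using jac_mul_chr D hy1 hy2 a
  have key : ∀ a b, pdM p b (fun y ↦ jac q p y) x * chr D p a x + jac q p x * pdM p b (chr D p a) x =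
      pdM p b (pdM p a (fun y ↦ jac q p y)) x + (pdM p b (chrAlong D q p a) x * jac q p x
        + chrAlong D q p a x * pdM p b (fun y ↦ jac q p y) x) := fun a b ↦ by
    have h1 := pdM_congr (hev a) p b
    rwa [pdM_mul hJ (smoothMat_chr hD hp a), pdM_add (hJ.pdM hp a) ((smoothMat_chrAlong hD hp hq a).mul hJ),
      pdM_mul (smoothMat_chrAlong hD hp hq a) hJ] at h1
  have hdJ : ∀ a, pdM p a (fun y ↦ jac q p y) x = jac q p x * chr D p a x - chrAlong D q p a x * jac q p x :=
    fun a ↦ eq_sub_of_add_eq (jac_mul_chr D hp hq a).symm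
  have k1 := key a b
  have k2 := key b a
  rw [pdM_comm hp hJ] at k1
  rw [hdJ] at k1 k2
  have k3 := congrArg₂ (· - ·) k2 k1
  rw [riemMat_eq, ← sub_eq_zero]
  rw [← sub_eq_zero] at k3
  rw [← k3]
  noncomm_ring

theorem jac_mul_riemMat {D : Conn n M} (hD : IsSmoothTorsionFree D) {p q x : M} (hp : x ∈ dom n p)
    (hq : x ∈ dom n q) (a b : Fin n) :
    jac q p x * riemMat D p a b x = (∑ i, ∑ j, ((jac q p x : Matrix (Fin n) (Fin n) ℝ) i a
      * (jac q p x : Matrix (Fin n) (Fin n) ℝ) j b) • riemMat D q i j x) * jac q p x := by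
  rw [jac_mul_riemMat_aux hD hp hq]
  congr 1
  -- The last sum contains derivatives of the Jacobian; these are symmetric in a and b and disappear
  -- on skew-symmetrisation.
  have h1 : ∀ a b, pdM p a (chrAlong D q p b) x =
      ∑ i, ∑ j, ((jac q p x : Matrix (Fin n) (Fin n) ℝ) i a * (jac q p x : Matrix (Fin n) (Fin n) ℝ) j b) •
        pdM q i (chr D q j) x
      + ∑ i, pd p a (fun y ↦ (jac q p y : Matrix (Fin n) (Fin n) ℝ) i b) x • chr D q i x := fun a b ↦ by
    have e1 : chrAlong D q p b = fun y ↦ ∑ i, (jac q p y : Matrix (Fin n) (Fin n) ℝ) i b • chr D q i y := rfl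
    rw [e1, pdM_sum fun i _ ↦ SmoothMat.smul (smoothMat_jac hp hq i b) (smoothMat_chr hD hq i)]
    have e2 : ∀ i, pdM p a (chr D q i) x = ∑ j, (jac q p x : Matrix (Fin n) (Fin n) ℝ) j a • pdM q j (chr D q i) x :=
      fun i ↦ by
        ext c d
        simp only [Matrix.sum_apply, Matrix.smul_apply, smul_eq_mul]
        exact pd_change hq _ a
    have e3 : ∀ i, pdM p a (fun y ↦ (jac q p y : Matrix (Fin n) (Fin n) ℝ) i b • chr D q i y) x = _ := fun i ↦
      pdM_smul (smoothMat_jac hp hq i b) (smoothMat_chr hD hq i) p a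
    simp only [e3, e2, Finset.sum_add_distrib, Finset.smul_sum, smul_smul]
    rw [Finset.sum_comm]
    simp only [mul_comm]
  have h2 : ∀ a b, chrAlong D q p a x * chrAlong D q p b x =
      ∑ i, ∑ j, ((jac q p x : Matrix (Fin n) (Fin n) ℝ) i a * (jac q p x : Matrix (Fin n) (Fin n) ℝ) j b) •
        (chr D q i x * chr D q j x) := fun a b ↦ by
    simp only [chrAlong, Finset.sum_mul, Finset.mul_sum, Matrix.smul_mul, Matrix.mul_smul, smul_smul]
    exact Finset.sum_comm.trans (Finset.sum_congr rfl fun i _ ↦ Finset.sum_congr rfl fun j _ ↦ by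
      rw [mul_comm])
  have h3 : ∀ F : Fin n → Fin n → Matrix (Fin n) (Fin n) ℝ,
      ∑ i, ∑ j, ((jac q p x : Matrix (Fin n) (Fin n) ℝ) i b * (jac q p x : Matrix (Fin n) (Fin n) ℝ) j a) • F i j
      = ∑ i, ∑ j, ((jac q p x : Matrix (Fin n) (Fin n) ℝ) i a * (jac q p x : Matrix (Fin n) (Fin n) ℝ) j b) • F j i :=
    fun F ↦ by
      rw [Finset.sum_comm]
      simp only [mul_comm]
  rw [h1, h1, h2, h2, h3, h3]
  simp only [pd_jac_comm hp hq a b, riemMat_eq, smul_sub, smul_add, Finset.sum_add_distrib, Finset.sum_sub_distrib]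
  abel

/-- The Schouten tensor as a matrix. -/
def schoutenMat (D : Conn n M) (p x : M) : Matrix (Fin n) (Fin n) ℝ := Matrix.of fun a b ↦ schouten D p a b x

/-- Contraction of the tensor law of the curvature; the Jacobian meets its inverse in the contracted
pair. -/
theorem schoutenMat_change {D : Conn n M} (hD : IsSmoothTorsionFree D) {p q x : M} (hp : x ∈ dom n p)
    (hq : x ∈ dom n q) :
    schoutenMat D p x = (jac q p x)ᵀ * schoutenMat D q x * jac q p x := by
  ext a b
  have hinv : (jac p q x : Matrix (Fin n) (Fin n) ℝ) * jac q p x = 1 := by rw [jac_mul_jac hq, jac_self hp]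
  have hinv' : (jac q p x : Matrix (Fin n) (Fin n) ℝ) * jac p q x = 1 := by rw [jac_mul_jac hp, jac_self hq]
  have h1 : ∀ c, riemMat D p c a x = (jac p q x : Matrix (Fin n) (Fin n) ℝ) *
      ((∑ i, ∑ j, ((jac q p x : Matrix (Fin n) (Fin n) ℝ) i c
      * (jac q p x : Matrix (Fin n) (Fin n) ℝ) j a) • riemMat D q i j x) * jac q p x) := fun c ↦ by
    rw [← jac_mul_riemMat hD hp hq, ← mul_assoc, hinv, one_mul]
  have h2 : ∑ c, riemMat D p c a x c b = ∑ j, ∑ l, (jac q p x : Matrix (Fin n) (Fin n) ℝ) j a *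
      (jac q p x : Matrix (Fin n) (Fin n) ℝ) l b * ∑ i, riemMat D q i j x i l := by
    have e1 : ∀ c, riemMat D p c a x c b = ∑ i, ∑ k, (jac q p x : Matrix (Fin n) (Fin n) ℝ) i c *
        (jac p q x : Matrix (Fin n) (Fin n) ℝ) c k * ∑ j, ∑ l, (jac q p x : Matrix (Fin n) (Fin n) ℝ) j a *
        (jac q p x : Matrix (Fin n) (Fin n) ℝ) l b * riemMat D q i j x k l := fun c ↦ by
      rw [h1]
      simp only [Matrix.mul_apply, Matrix.sum_apply, Matrix.smul_apply, smul_eq_mul, Finset.sum_mul, Finset.mul_sum,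
        ← Finset.sum_product']
      refine Finset.sum_bij' (fun x _ ↦ ⟨x.2.1.1, x.1, x.2.1.2, x.2.2⟩)
        (fun x _ ↦ ⟨x.2.1, (x.1, x.2.2.1), x.2.2.2⟩)
        (by simp) (by simp) (by simp) (by simp) (fun x _ ↦ ?_)
      simp only
      ring
    simp only [e1]
    rw [Finset.sum_comm]
    have e2 : ∀ i, ∑ c, ∑ k, (jac q p x : Matrix (Fin n) (Fin n) ℝ) i c *
        (jac p q x : Matrix (Fin n) (Fin n) ℝ) c k * (∑ j, ∑ l, (jac q p x : Matrix (Fin n) (Fin n) ℝ) j a *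
        (jac q p x : Matrix (Fin n) (Fin n) ℝ) l b * riemMat D q i j x k l) =
        ∑ j, ∑ l, (jac q p x : Matrix (Fin n) (Fin n) ℝ) j a *
        (jac q p x : Matrix (Fin n) (Fin n) ℝ) l b * riemMat D q i j x i l := fun i ↦ by
      rw [Finset.sum_comm]
      simp only [← Finset.sum_mul]
      have e3 : ∀ k, ∑ c, (jac q p x : Matrix (Fin n) (Fin n) ℝ) i c *
        (jac p q x : Matrix (Fin n) (Fin n) ℝ) c k = if i = k then 1 else 0 := fun k ↦ by
          rw [← Matrix.mul_apply, hinv', Matrix.one_apply]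
      simp only [e3, ite_mul, one_mul, zero_mul, Finset.sum_ite_eq, Finset.mem_univ, if_true]
    simp only [e2]
    rw [Finset.sum_comm]
    refine Finset.sum_congr rfl fun j _ ↦ ?_
    rw [Finset.sum_comm]
    simp only [Finset.mul_sum]
  have h3 : schoutenMat D p x a b = 1 / ((n : ℝ) - 1) * ∑ c, riemMat D p c a x c b := rfl
  have h4 : ∀ j l, schoutenMat D q x j l = 1 / ((n : ℝ) - 1) * ∑ c, riemMat D q c j x c l := fun _ _ ↦ rfl
  rw [h3, h2]
  simp only [Matrix.mul_apply, h4, Matrix.transpose_apply, Finset.mul_sum, Finset.sum_mul]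
  rw [Finset.sum_comm]
  exact Finset.sum_congr rfl fun _ _ ↦ Finset.sum_congr rfl fun _ _ ↦ Finset.sum_congr rfl fun _ _ ↦ by ring

omit [T2Space M] in
theorem trace_change {p q x : M} (hp : x ∈ dom n p) (hq : x ∈ dom n q)
    (L : TangentSpace (𝓡 n) x →L[ℝ] TangentSpace (𝓡 n) x) :
    ∑ b, coordCov p b x (L (coordVec p b x)) = ∑ b, coordCov q b x (L (coordVec q b x)) := by
  have h : ∀ {p : M} (hp : x ∈ dom n p), ∑ b, coordCov p b x (L (coordVec p b x)) =
      LinearMap.trace ℝ _ (L : TangentSpace (𝓡 n) x →ₗ[ℝ] TangentSpace (𝓡 n) x) := fun {p} hp ↦ by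
    rw [LinearMap.trace_eq_matrix_trace ℝ (coordBasis hp)]
    simp only [Matrix.trace, Matrix.diag, LinearMap.toMatrix_apply, coordBasis_repr, coordBasis_apply]
    rfl
  rw [h hp, h hq]

end ProjMetric
end

noncomputable section

namespace ProjMetric

variable {n : ℕ} {M : Type*} [TopologicalSpace M] [ChartedSpace (EuclideanSpace ℝ (Fin n)) M]
variable [IsManifold (𝓡 n) ∞ M]

open Matrix

/-! ### Solutions of the tractor equation from solutions of its first component -/

variable [T2Space M] {D : Conn n M}

/-- The divergence is the trace of the endomorphism ∇μ and P·σ is the trace of a matrix product;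
neither depends on the chart. Hence ρ is a global function. -/
theorem lastComp_change (hD : IsSmoothTorsionFree D)
    (σ : ∀ x : M, LinearMap.BilinForm ℝ (TangentSpace (𝓡 n) x →L[ℝ] ℝ)) {μ : ∀ x : M, TangentSpace (𝓡 n) x}
    {p q x : M} (hp : x ∈ dom n p) (hq : x ∈ dom n q) (hμ : DiffSec μ x) :
    lastComp D p (fun b c y ↦ σ y (coordCov p b y) (coordCov p c y)) (fun b y ↦ coordCov p b y (μ y)) x =
      lastComp D q (fun b c y ↦ σ y (coordCov q b y) (coordCov q c y)) (fun b y ↦ coordCov q b y (μ y)) x := by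
  have h1 : ∀ p : M, ∑ b, ∑ c, schouten D p b c x * σ x (coordCov p b x) (coordCov p c x) =
      (schoutenMat D p x * (upMat (σ x) p)ᵀ).trace := fun p ↦ by
    simp only [Matrix.trace, Matrix.diag, Matrix.mul_apply, Matrix.transpose_apply, upMat, Matrix.of_apply,
      schoutenMat]
  rw [lastComp, lastComp, h1, h1, schoutenMat_change hD hp hq, upMat_change hp q]
  simp only [← conn_apply_coordVec D hp hμ, ← conn_apply_coordVec D hq hμ]
  rw [trace_change hp hq (D μ x)]
  congr 2
  rw [Matrix.transpose_mul, Matrix.transpose_mul, Matrix.transpose_transpose, mul_assoc, mul_assoc,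
    Matrix.trace_mul_comm]
  simp only [mul_assoc]

/-- The prolongation of a pair `(σ, μ)`. -/
def prolong (hn : 2 ≤ n) (hD : IsSmoothTorsionFree D)
    (σ : ∀ x : M, LinearMap.BilinForm ℝ (TangentSpace (𝓡 n) x →L[ℝ] ℝ)) (μ : ∀ x : M, TangentSpace (𝓡 n) x)
    (symm : ∀ x α β, σ x α β = σ x β α)
    (hσ : ∀ p, ∀ x ∈ dom n p, ∀ b c, SmoothFn n (fun y ↦ σ y (coordCov p b y) (coordCov p c y)) x)
    (hμ : ∀ p, ∀ x ∈ dom n p, ∀ b, SmoothFn n (fun y ↦ coordCov p b y (μ y)) x) : TractorSection n M where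
  σ := σ
  μ := μ
  ρ x := lastComp D x (fun b c y ↦ σ y (coordCov x b y) (coordCov x c y)) (fun b y ↦ coordCov x b y (μ y)) x
  symm := symm
  smooth_σ p b c x hx := (hσ p x hx b c).contMDiffWithinAt
  smooth_μ p b x hx := (hμ p x hx b).contMDiffWithinAt
  smooth_ρ x := by
    have hx := mem_dom_self (n := n) x
    refine (smoothFn_lastComp hD hn hx (hσ x x hx) (hμ x x hx)).congr_of_eventuallyEq ?_
    exact diag_eventuallyEq (F := fun p ↦ lastComp D p (fun b c y ↦ σ y (coordCov p b y) (coordCov p c y))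
      (fun b y ↦ coordCov p b y (μ y)))
      (fun p q y hp hq ↦ lastComp_change hD σ hp hq ((smoothSec_iff hp).2 (hμ p y hp)).diff) hx

/-- Reduces the full system to its top slot. -/
theorem isSolution_prolong {ε : ∀ x : M, (TangentSpace (𝓡 n) x) [⋀^Fin n]→ₗ[ℝ] ℝ} (hn : 2 ≤ n)
    (hD : IsSmoothTorsionFree D) (hε : IsParallelVolumeForm D ε)
    {σ : ∀ x : M, LinearMap.BilinForm ℝ (TangentSpace (𝓡 n) x →L[ℝ] ℝ)} {μ : ∀ x : M, TangentSpace (𝓡 n) x}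
    (symm : ∀ x α β, σ x α β = σ x β α)
    (hσ : ∀ p, ∀ x ∈ dom n p, ∀ b c, SmoothFn n (fun y ↦ σ y (coordCov p b y) (coordCov p c y)) x)
    (hμ : ∀ p, ∀ x ∈ dom n p, ∀ b, SmoothFn n (fun y ↦ coordCov p b y (μ y)) x)
    (top : ∀ p, ∀ x ∈ dom n p, ∀ a b c, (prolong hn hD σ μ symm hσ hμ).tractorσ D p a b c x = 0) :
    (prolong hn hD σ μ symm hσ hμ).IsSolution D := by
  have key := fun (p x : M) (hx : x ∈ dom n p) ↦ prolongation (p := p) hD hn hε (hσ p) (hμ p)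
    (fun x hx b ↦ by rw [coordCov_of_notMem hx]; rfl) (fun b c ↦ funext fun y ↦ symm _ _ _)
    (fun x hx a b c ↦ by
      have := top p x hx a b c
      simp only [TractorSection.tractorσ, TractorSection.covσ] at this
      exact (sub_eq_zero.1 ((sub_sub _ _ _).symm.trans this))) hx
  have hρ : ∀ p, ∀ x ∈ dom n p, (prolong hn hD σ μ symm hσ hμ).ρ =ᶠ[nhds x]
      lastComp D p (fun b c y ↦ σ y (coordCov p b y) (coordCov p c y)) (fun b y ↦ coordCov p b y (μ y)) :=
    fun p x hx ↦ diag_eventuallyEq (F := fun p ↦ lastComp D p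
      (fun b c y ↦ σ y (coordCov p b y) (coordCov p c y)) (fun b y ↦ coordCov p b y (μ y)))
      (fun p q y hp hq ↦ lastComp_change hD σ hp hq ((smoothSec_iff hp).2 (hμ p y hp)).diff) hx
  refine ⟨top, fun p x hx a b ↦ ?_, fun p x hx a ↦ ?_⟩
  · have := (key p x hx).1 a b
    rw [← (hρ p x hx).self_of_nhds] at this
    exact this
  · have := (key p x hx).2 a
    rw [← pd_congr (hρ p x hx)] at this
    exact this

end ProjMetric
end

noncomputable section

namespace ProjMetric

variable {n : ℕ} {M : Type*} [TopologicalSpace M] [ChartedSpace (EuclideanSpace ℝ (Fin n)) M]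
variable [IsManifold (𝓡 n) ∞ M]

open Matrix

/-! ### From solutions to metrics -/

variable {D : Conn n M} {ε : ∀ x : M, (TangentSpace (𝓡 n) x) [⋀^Fin n]→ₗ[ℝ] ℝ}

theorem posDef_upMat {p x : M} (hp : x ∈ dom n p) {B : LinearMap.BilinForm ℝ (TangentSpace (𝓡 n) x →L[ℝ] ℝ)}
    (symm : ∀ α β, B α β = B β α) (pos : ∀ α, α ≠ 0 → 0 < B α α) : (upMat B p).PosDef := by
  refine Matrix.posDef_iff_dotProduct_mulVec.2 ⟨Matrix.IsHermitian.ext fun i j ↦ symm _ _, fun v hv ↦ ?_⟩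
  have h1 : star v ⬝ᵥ upMat B p *ᵥ v = B (∑ a, v a • coordCov p a x) (∑ a, v a • coordCov p a x) := by
    simp only [dotProduct, Matrix.mulVec, upMat, Matrix.of_apply, map_sum, map_smul, LinearMap.sum_apply,
      LinearMap.smul_apply, smul_eq_mul, star_trivial, Finset.mul_sum]
    rw [Finset.sum_comm]
    exact Finset.sum_congr rfl fun a _ ↦ Finset.sum_congr rfl fun b _ ↦ by ring
  rw [h1]
  refine pos _ fun h0 ↦ hv (funext fun b ↦ ?_)
  have := congrArg (fun α : TangentSpace (𝓡 n) x →L[ℝ] ℝ ↦ α (coordVec p b x)) h0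
  simpa [_root_.sum_apply, coordCov_coordVec hp, kron] using this

theorem posDef_loMat {p x : M} (hp : x ∈ dom n p) {B : TangentSpace (𝓡 n) x →L[ℝ] TangentSpace (𝓡 n) x →L[ℝ] ℝ}
    (symm : ∀ v w, B v w = B w v) (pos : ∀ v, v ≠ 0 → 0 < B v v) : (loMat B p).PosDef := by
  refine Matrix.posDef_iff_dotProduct_mulVec.2 ⟨Matrix.IsHermitian.ext fun i j ↦ symm _ _, fun v hv ↦ ?_⟩
  have h1 : star v ⬝ᵥ loMat B p *ᵥ v = B (∑ a, v a • coordVec p a x) (∑ a, v a • coordVec p a x) := by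
    simp only [dotProduct, Matrix.mulVec, loMat, Matrix.of_apply, map_sum, map_smul, _root_.sum_apply,
      _root_.smul_apply, smul_eq_mul, star_trivial, Finset.mul_sum]
    rw [Finset.sum_comm]
    exact Finset.sum_congr rfl fun a _ ↦ Finset.sum_congr rfl fun b _ ↦ by ring
  rw [h1]
  refine pos _ fun h0 ↦ hv (funext fun b ↦ ?_)
  have := congrArg (coordCov p b x) h0
  simpa [coordCov_coordVec hp, kron] using this

theorem upForm_symm {q x : M} {A : Matrix (Fin n) (Fin n) ℝ} (hA : A.PosDef) (α β : TangentSpace (𝓡 n) x →L[ℝ] ℝ) :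
    upForm q A α β = upForm q A β α := by
  have hT : Aᵀ = A := hA.isHermitian
  rw [upForm_apply, upForm_apply, dotProduct_comm, ← Matrix.vecMul_transpose, hT, Matrix.dotProduct_mulVec]

theorem upForm_pos {q x : M} (hq : x ∈ dom n q) {A : Matrix (Fin n) (Fin n) ℝ} (hA : A.PosDef)
    {α : TangentSpace (𝓡 n) x →L[ℝ] ℝ} (hα : α ≠ 0) : 0 < upForm q A α α := by
  rw [upForm_apply]
  refine hA.dotProduct_mulVec_pos fun h0 ↦ hα ?_
  rw [← sum_apply_coordVec_smul hq α]
  exact Finset.sum_eq_zero fun i _ ↦ by rw [show α (coordVec q i x) = 0 from congrFun h0 i, zero_smul]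

theorem loForm_symm {q x : M} {A : Matrix (Fin n) (Fin n) ℝ} (hA : A.PosDef) (v w : TangentSpace (𝓡 n) x) :
    loForm q A v w = loForm q A w v := by
  have hT : Aᵀ = A := hA.isHermitian
  rw [loForm_apply, loForm_apply, dotProduct_comm, ← Matrix.vecMul_transpose, hT, Matrix.dotProduct_mulVec]

theorem loForm_pos {q x : M} (hq : x ∈ dom n q) {A : Matrix (Fin n) (Fin n) ℝ} (hA : A.PosDef)
    {v : TangentSpace (𝓡 n) x} (hv : v ≠ 0) : 0 < loForm q A v v := by
  rw [loForm_apply]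
  refine hA.dotProduct_mulVec_pos fun h0 ↦ hv ?_
  rw [← sum_coordCov_smul hq v]
  exact Finset.sum_eq_zero fun i _ ↦ by rw [show coordCov q i x v = 0 from congrFun h0 i, zero_smul]

/-- The matrix `Γₐ + ∂ₐ ⊗ v`. -/
def tracelessShift (A : Matrix (Fin n) (Fin n) ℝ) (a : Fin n) (v : Fin n → ℝ) : Matrix (Fin n) (Fin n) ℝ :=
  A + vecMulVec (Pi.single a 1) v

theorem chr_projChange (D : Conn n M) (h : M → ℝ) {p x : M} (hx : x ∈ dom n p) (a : Fin n) :
    chr (projChange D h) p a x =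
      tracelessShift (chr D p a x) a (fun b ↦ pd p b h x) + pd p a h x • (1 : Matrix (Fin n) (Fin n) ℝ) := by
  ext c b
  simp only [chr, tracelessShift, Matrix.of_apply, Matrix.add_apply, christoffel_projChange D h hx,
    vecMulVec_apply, Matrix.smul_apply, smul_eq_mul, kron, Pi.single_apply, Matrix.one_apply]
  ring

/-- With u = ∂ₐ and μ = -Sv, this is how the right-hand side of the top equation is absorbed into
the connection matrix. -/
theorem vecMulVec_add_vecMulVec {S : Matrix (Fin n) (Fin n) ℝ} (hS : Sᵀ = S) (u v : Fin n → ℝ) :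
    vecMulVec u (S *ᵥ v) + vecMulVec (S *ᵥ v) u = vecMulVec u v * S + S * (vecMulVec u v)ᵀ := by
  rw [vecMulVec_mul, transpose_vecMulVec, mul_vecMulVec, ← Matrix.mulVec_transpose, hS]

/-- The first tractor equation for `μ = -σ(·, v)`. -/
theorem pdM_upMat_iff {S : M → Matrix (Fin n) (Fin n) ℝ} {x : M} (hS : (S x)ᵀ = S x) {v : Fin n → ℝ} {p : M}
    {a : Fin n} {A : Matrix (Fin n) (Fin n) ℝ} :
    pdM p a S x + A * S x + S x * Aᵀ
        = vecMulVec (Pi.single a 1) (-(S x *ᵥ v)) + vecMulVec (-(S x *ᵥ v)) (Pi.single a 1) ↔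
      pdM p a S x = -(tracelessShift A a v * S x) - S x * (tracelessShift A a v)ᵀ := by
  have h := vecMulVec_add_vecMulVec hS (Pi.single a 1) v
  rw [Matrix.vecMulVec_neg, Matrix.neg_vecMulVec, ← neg_add, h, tracelessShift, add_mul,
    Matrix.transpose_add, mul_add]
  constructor
  · intro h1
    rw [eq_sub_of_add_eq (eq_sub_of_add_eq h1)]
    abel
  · intro h1
    rw [h1]
    abel

namespace TractorSection

variable (s : TractorSection n M)

theorem smoothFn_compσ {p x : M} (hx : x ∈ dom n p) (b c : Fin n) : SmoothFn n (s.compσ p b c) x :=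
  (s.smooth_σ p b c).contMDiffAt (dom_mem_nhds hx)

theorem det_eq (p x : M) : s.det ε p x = volComp ε p x ^ 2 * (upMat (s.σ x) p).det := rfl

theorem det_change {p q x : M} (hp : x ∈ dom n p) (hq : x ∈ dom n q) : s.det ε p x = s.det ε q x := by
  rw [det_eq, det_eq, volComp_change hq, upMat_change hp q, Matrix.det_mul, Matrix.det_mul,
    Matrix.det_transpose]
  ring

theorem upMat_transpose (p x : M) : (upMat (s.σ x) p)ᵀ = upMat (s.σ x) p :=
  Matrix.ext fun _ _ ↦ s.symm _ _ _

theorem smoothMat_upMat {p x : M} (hx : x ∈ dom n p) : SmoothMat n (fun y ↦ upMat (s.σ y) p) x :=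
  fun b c ↦ s.smoothFn_compσ hx b c

theorem smoothFn_det (hε : IsParallelVolumeForm D ε) {p x : M} (hx : x ∈ dom n p) :
    SmoothFn n (s.det ε p) x := by
  have h := hε.smoothFn_volComp hx
  refine SmoothFn.mul (f := fun y ↦ volComp ε p y ^ 2) ?_ (SmoothFn.det (s.smoothMat_upMat hx))
  simp only [sq]
  exact h.mul h

variable {s}

theorem det_pos (hs : s.IsPosDef) (hε : IsParallelVolumeForm D ε) {p x : M} (hx : x ∈ dom n p) :
    0 < s.det ε p x :=
  mul_pos (even_two.pow_pos (volComp_ne_zero hε.ne_zero hx)) (posDef_upMat hx (s.symm x) (hs x)).det_pos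

theorem IsSolution.pdM_upMat (hs : s.IsSolution D) {p x : M} (hx : x ∈ dom n p) (a : Fin n) :
    pdM p a (fun y ↦ upMat (s.σ y) p) x + chr D p a x * upMat (s.σ x) p + upMat (s.σ x) p * (chr D p a x)ᵀ
      = vecMulVec (Pi.single a 1) (fun b ↦ s.compμ p b x) + vecMulVec (fun b ↦ s.compμ p b x) (Pi.single a 1) := by
  ext b c
  have h := hs.top p x hx a b c
  simp only [tractorσ, covσ] at h
  have h1 : (chr D p a x * upMat (s.σ x) p) b c = ∑ d, christoffel D p b a d x * s.compσ p d c x := rfl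
  have h2 : (upMat (s.σ x) p * (chr D p a x)ᵀ) b c = ∑ d, christoffel D p c a d x * s.compσ p b d x := by
    rw [Matrix.mul_apply]
    exact Finset.sum_congr rfl fun d _ ↦ mul_comm _ _
  have h3 : pdM p a (fun y ↦ upMat (s.σ y) p) x b c = pd p a (s.compσ p b c) x := rfl
  rw [Matrix.add_apply, Matrix.add_apply, Matrix.add_apply, h1, h2, h3]
  simp only [vecMulVec_apply, Pi.single_apply, kron] at h ⊢
  simp only [eq_comm (a := b), eq_comm (a := c)]
  linear_combination h

/-- Jacobi's formula gives -2(Γ^b_{ab} + vₐ) as logarithmic derivative of the determinant of the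
matrix of σ; the factor ε² contributes 2Γ^b_{ab}, because ε is parallel. -/
theorem IsSolution.pd_det (hs : s.IsSolution D) (hε : IsParallelVolumeForm D ε) {p x : M} (hx : x ∈ dom n p)
    {v : Fin n → ℝ} (hv : ∀ b, s.compμ p b x = - ∑ c, s.compσ p b c x * v c) (a : Fin n) :
    pd p a (s.det ε p) x = - 2 * v a * s.det ε p x := by
  have h1 := hs.pdM_upMat hx a
  have h2 : (fun b ↦ s.compμ p b x) = -(upMat (s.σ x) p *ᵥ v) := funext hv
  rw [h2, pdM_upMat_iff (S := fun y ↦ upMat (s.σ y) p) (s.upMat_transpose p x)] at h1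
  have h3 := pd_det_of_eq (s.smoothMat_upMat hx) p a (A := -(tracelessShift (chr D p a x) a v)ᵀ)
    (h1.trans (by simp only [Matrix.transpose_neg, Matrix.transpose_transpose, Matrix.neg_mul,
      Matrix.mul_neg]; abel))
  have h4 : (tracelessShift (chr D p a x) a v).trace = ∑ b, christoffel D p b a b x + v a := by
    rw [tracelessShift, Matrix.trace_add, trace_vecMulVec]
    simp only [single_dotProduct, one_mul]
    rfl
  rw [Matrix.trace_neg, Matrix.trace_transpose, h4] at h3
  have hE := hε.smoothFn_volComp hx
  have h5 : s.det ε p = fun y ↦ (volComp ε p y * volComp ε p y) * (upMat (s.σ y) p).det := funext fun y ↦ by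
    rw [det_eq]; ring
  rw [h5, pd_mul (hE.mul hE).diff (SmoothFn.det (s.smoothMat_upMat hx)).diff, pd_mul hE.diff hE.diff,
    hε.pd_volComp hx, h3]
  ring

variable (s ε) in
/-- The function `h` with `e^{-2h} = det σ`. -/
def logDet (x : M) : ℝ := -1 / 2 * Real.log (s.det ε x x)

theorem logDet_eventuallyEq {p x : M} (hx : x ∈ dom n p) :
    s.logDet ε =ᶠ[nhds x] fun y ↦ -1 / 2 * Real.log (s.det ε p y) :=
  diag_eventuallyEq (F := fun p y ↦ -1 / 2 * Real.log (s.det ε p y))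
    (fun p q y hp hq ↦ by rw [s.det_change hp hq]) hx

theorem smoothFn_logDet (hs : s.IsPosDef) (hε : IsParallelVolumeForm D ε) (x : M) :
    SmoothFn n (s.logDet ε) x := by
  have hx := mem_dom_self (n := n) x
  refine ContMDiffAt.congr_of_eventuallyEq ?_ (logDet_eventuallyEq hx)
  exact SmoothFn.mul contMDiffAt_const
    (SmoothFn.comp (Real.contDiffAt_log.2 (det_pos hs hε hx).ne') (s.smoothFn_det hε hx))

theorem pd_logDet (hs : s.IsPosDef) (hε : IsParallelVolumeForm D ε) {p x : M} (hx : x ∈ dom n p) (a : Fin n) :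
    pd p a (s.logDet ε) x = -1 / 2 * ((s.det ε p x)⁻¹ * pd p a (s.det ε p) x) := by
  have h := (det_pos hs hε hx).ne'
  rw [pd_congr (logDet_eventuallyEq hx), pd_const_mul _
    (SmoothFn.comp (Real.contDiffAt_log.2 h) (s.smoothFn_det hε hx)).diff,
    pd_comp (Real.hasDerivAt_log h) (s.smoothFn_det hε hx).diff]

/-- The trace of the first tractor equation. -/
theorem IsSolution.compμ_eq (hs : s.IsSolution D) (hp : s.IsPosDef) (hε : IsParallelVolumeForm D ε) {p x : M}
    (hx : x ∈ dom n p) (b : Fin n) :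
    s.compμ p b x = - ∑ c, s.compσ p b c x * pd p c (s.logDet ε) x := by
  have hu : IsUnit (upMat (s.σ x) p).det := ((Matrix.isUnit_iff_isUnit_det _).1
    (posDef_upMat hx (s.symm x) (hp x)).isUnit)
  -- The covector v solves μ = -σ(v, ·) by invertibility of σ; `pd_det` then identifies it with dh.
  let v : Fin n → ℝ := -((upMat (s.σ x) p)⁻¹ *ᵥ fun b ↦ s.compμ p b x)
  have hv : ∀ b, s.compμ p b x = - ∑ c, s.compσ p b c x * v c := fun b ↦ by
    have : (fun b ↦ s.compμ p b x) = -(upMat (s.σ x) p *ᵥ v) := by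
      rw [Matrix.mulVec_neg, neg_neg, Matrix.mulVec_mulVec, Matrix.mul_nonsing_inv _ hu, Matrix.one_mulVec]
    exact congrFun this b
  have h2 : ∀ c, pd p c (s.logDet ε) x = v c := fun c ↦ by
    rw [pd_logDet hp hε hx, hs.pd_det hε hx hv]
    have := (det_pos hp hε hx).ne'
    field_simp
  rw [hv]
  simp only [h2]

variable (s ε) in
/-- The matrix of `det(σ) σ`. -/
def invMetricMat (p x : M) : Matrix (Fin n) (Fin n) ℝ := s.det ε p x • upMat (s.σ x) p

theorem posDef_invMetricMat (hs : s.IsPosDef) (hε : IsParallelVolumeForm D ε) {p x : M} (hx : x ∈ dom n p) :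
    (s.invMetricMat ε p x).PosDef := (posDef_upMat hx (s.symm x) (hs x)).smul (det_pos hs hε hx)

theorem isUnit_det_invMetricMat (hs : s.IsPosDef) (hε : IsParallelVolumeForm D ε) {p x : M} (hx : x ∈ dom n p) :
    IsUnit (s.invMetricMat ε p x).det :=
  (Matrix.isUnit_iff_isUnit_det _).1 (posDef_invMetricMat hs hε hx).isUnit

theorem smoothMat_invMetricMat (hε : IsParallelVolumeForm D ε) {p x : M} (hx : x ∈ dom n p) :
    SmoothMat n (s.invMetricMat ε p) x := (s.smoothMat_upMat hx).smul (s.smoothFn_det hε hx)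

theorem loMat_loForm_invMetricMat {p q x : M} (hp : x ∈ dom n p) (hq : x ∈ dom n q) :
    loMat (loForm q (s.invMetricMat ε q x)⁻¹ : TangentSpace (𝓡 n) x →L[ℝ] TangentSpace (𝓡 n) x →L[ℝ] ℝ) p
      = (s.invMetricMat ε p x)⁻¹ := by
  refine loMat_loForm_inv hp hq ?_
  rw [invMetricMat, invMetricMat, s.det_change hq hp, upMat_change hp q, Matrix.mul_smul, Matrix.smul_mul]

/-- The metric with inverse `det(σ) σ`. -/
def toMetric (hs : s.IsPosDef) (hε : IsParallelVolumeForm D ε) : Metric n M :=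
  metricOfComponents (fun x ↦ loForm x (s.invMetricMat ε x x)⁻¹)
    (fun x ↦ loForm_symm (posDef_invMetricMat hs hε (mem_dom_self x)).inv)
    (fun x _ hv ↦ loForm_pos (mem_dom_self x) (posDef_invMetricMat hs hε (mem_dom_self x)).inv hv)
    (fun x a b ↦ by
      have hx := mem_dom_self (n := n) x
      refine ((smoothMat_invMetricMat hε hx).inv (isUnit_det_invMetricMat hs hε hx).ne_zero a b)
        |>.congr_of_eventuallyEq (Filter.eventually_of_mem (dom_mem_nhds hx) fun y hy ↦ ?_)
      exact congrFun (congrFun (loMat_loForm_invMetricMat (s := s) (ε := ε) hy (mem_dom_self y)) a) b)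

theorem compMetric_toMetric (hs : s.IsPosDef) (hε : IsParallelVolumeForm D ε) {p x : M} (hx : x ∈ dom n p)
    (a b : Fin n) : compMetric (toMetric hs hε) p a b x = (s.invMetricMat ε p x)⁻¹ a b :=
  congrFun (congrFun (loMat_loForm_invMetricMat (s := s) (ε := ε) hx (mem_dom_self x)) a) b

theorem hasInverseDetSmul_toMetric (hs : s.IsPosDef) (hε : IsParallelVolumeForm D ε) :
    HasInverseDetSmul ε s (toMetric hs hε) := fun p x hx a b ↦ by
  have h := congrFun (congrFun (Matrix.nonsing_inv_mul _ (isUnit_det_invMetricMat hs hε hx)) a) b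
  rw [Matrix.one_apply] at h
  rw [kron, ← h, Matrix.mul_apply]
  exact Finset.sum_congr rfl fun c _ ↦ by rw [compMetric_toMetric hs hε hx]; rfl

/-- The top equation makes σ parallel for Γₐ + ∂ₐ⊗dh. The factor det(σ) has logarithmic derivative
-2dh, which shared equally between the two indices supplies the missing multiple of the identity.
Thus det(σ)σ, and with it its inverse, is parallel for the changed connection. -/
theorem isMetricConnection_projChange (hD : IsSmoothTorsionFree D) (hs : s.IsSolution D) (hp : s.IsPosDef)
    (hε : IsParallelVolumeForm D ε) :
    IsMetricConnection (projChange D (s.logDet ε)) (toMetric hp hε) := by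
  refine isMetricConnection_of_pd_compMetric
    (isSmoothTorsionFree_projChange hD (smoothFn_logDet hp hε)) fun p x hx a b c ↦ ?_
  have hu := isUnit_det_invMetricMat hp hε hx
  have h0 : ∀ v w, compMetric (toMetric hp hε) p v w =ᶠ[nhds x] fun y ↦ (s.invMetricMat ε p y)⁻¹ v w := fun v w ↦
    Filter.eventually_of_mem (dom_mem_nhds hx) fun y hy ↦ compMetric_toMetric hp hε hy v w
  have h1 := hs.pdM_upMat hx a
  have h2 : (fun b ↦ s.compμ p b x) = -(upMat (s.σ x) p *ᵥ fun c ↦ pd p c (s.logDet ε) x) :=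
    funext (hs.compμ_eq hp hε hx)
  have h3 := hs.pd_det hε hx (hs.compμ_eq hp hε hx) a
  rw [h2, pdM_upMat_iff (S := fun y ↦ upMat (s.σ y) p) (s.upMat_transpose p x)] at h1
  have h4 : pdM p a (s.invMetricMat ε p) x = -(chr (projChange D (s.logDet ε)) p a x * s.invMetricMat ε p x)
      - s.invMetricMat ε p x * (chr (projChange D (s.logDet ε)) p a x)ᵀ := by
    have e1 : pdM p a (s.invMetricMat ε p) x = _ := pdM_smul (s.smoothFn_det hε hx) (s.smoothMat_upMat hx) p a
    rw [e1, h1, h3, chr_projChange D _ hx, invMetricMat]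
    simp only [Matrix.transpose_add, Matrix.transpose_smul, Matrix.transpose_one, add_mul, mul_add,
      Matrix.mul_smul, Matrix.smul_mul, one_mul, mul_one, smul_sub, smul_neg, smul_smul]
    module
  have h5 := pdM_inv (smoothMat_invMetricMat hε hx) hu.ne_zero p a
  rw [h4, Matrix.mul_sub, Matrix.sub_mul, Matrix.mul_neg, Matrix.neg_mul, ← mul_assoc, ← mul_assoc, mul_assoc _ _ (_)⁻¹,
    Matrix.mul_nonsing_inv _ hu, mul_one, Matrix.nonsing_inv_mul _ hu, one_mul] at h5
  have h6 : pd p a (compMetric (toMetric hp hε) p b c) x = pdM p a (fun y ↦ (s.invMetricMat ε p y)⁻¹) x b c :=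
    pd_congr (h0 b c) p a
  rw [h6, h5]
  simp only [Matrix.neg_apply, Matrix.sub_apply, Matrix.mul_apply, Matrix.transpose_apply,
    compMetric_toMetric hp hε hx]
  simp only [chr, Matrix.of_apply]
  rw [neg_sub, sub_neg_eq_add]
  exact congrArg₂ _ rfl (Finset.sum_congr rfl fun d _ ↦ mul_comm _ _)

end TractorSection

theorem projectivelyEquivalent_projChange (D : Conn n M) {h : M → ℝ} (hh : ∀ x, SmoothFn n h x) :
    ProjectivelyEquivalent D (projChange D h) := by
  refine ⟨geodesicsReparametrise_of_christoffel hh fun p x hx c a b ↦ christoffel_projChange D h hx c a b,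
    geodesicsReparametrise_of_christoffel (h := fun x ↦ - h x) (fun x ↦ ContMDiffAt.neg (hh x))
      fun p x hx c a b ↦ ?_⟩
  rw [christoffel_projChange D h hx, pd_neg, pd_neg]
  ring

end ProjMetric
end

noncomputable section

namespace ProjMetric

variable {n : ℕ} {M : Type*} [TopologicalSpace M] [ChartedSpace (EuclideanSpace ℝ (Fin n)) M]
variable [IsManifold (𝓡 n) ∞ M]

open Matrix

/-! ### From metrics to solutions -/

/-- Polarisation on the vectors e_a + t e_b. A basis vector gives B^c_{aa} = 0 for c ≠ a; the values
t = ±1 then give 2B^b_{ab} = B^a_{aa} and B^c_{ab} = 0 for c different from a and b. -/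
theorem eq_of_forall_parallel {B : Fin n → Fin n → Fin n → ℝ} (symm : ∀ c a b, B c a b = B c b a)
    (h : ∀ v : Fin n → ℝ, ∃ l : ℝ, ∀ k, ∑ i, ∑ j, B k i j * v i * v j = l * v k) (c a b : Fin n) :
    B c a b = kron c b * (B a a a / 2) + kron c a * (B b b b / 2) := by
  have key : ∀ (a b : Fin n) (t : ℝ), ∃ l : ℝ, ∀ k, B k a a + 2 * t * B k a b + t ^ 2 * B k b b =
      l * (kron k a + t * kron k b) := fun a b t ↦ by
    obtain ⟨l, hl⟩ := h fun i ↦ kron i a + t * kron i b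
    refine ⟨l, fun k ↦ ?_⟩
    rw [← hl k]
    simp only [kron, mul_add, add_mul, Finset.sum_add_distrib, mul_ite, ite_mul, mul_one, mul_zero, zero_mul,
      Finset.sum_ite_eq', Finset.mem_univ, if_true]
    rw [symm k b a]
    ring
  have diag : ∀ c a, c ≠ a → B c a a = 0 := fun c a hca ↦ by
    obtain ⟨l, hl⟩ := key a a 0
    simpa [kron, hca] using hl c
  by_cases hab : a = b
  · subst hab
    by_cases hca : c = a
    · subst hca; simp [kron]
    · simp [kron, hca, diag c a hca]
  obtain ⟨l, hl⟩ := key a b 1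
  obtain ⟨m, hm⟩ := key a b (-1)
  have hba : b ≠ a := fun h ↦ hab h.symm
  have l1 := hl a
  have l2 := hl b
  have m1 := hm a
  have m2 := hm b
  simp only [kron, hab, hba, if_true, if_false, diag a b hab, diag b a hba] at l1 l2 m1 m2
  by_cases hca : c = a
  · subst hca
    simp only [kron, hab, if_true, if_false]
    linarith
  by_cases hcb : c = b
  · subst hcb
    simp only [kron, hba, if_true, if_false]
    linarith
  have l3 := hl c
  simp only [kron, hca, hcb, if_false, diag c a hca, diag c b hcb] at l3 ⊢
  linarith

theorem exists_christoffel_eq [T2Space M] {D D' : Conn n M} (hD : IsSmoothTorsionFree D)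
    (hD' : IsSmoothTorsionFree D') (h : GeodesicsReparametrise D D') {p x : M} (hx : x ∈ dom n p) :
    ∃ υ : Fin n → ℝ, ∀ c a b, christoffel D' p c a b x =
      christoffel D p c a b x + kron c b * υ a + kron c a * υ b := by
  have h1 := eq_of_forall_parallel (B := fun c a b ↦ christoffel D' p c a b x - christoffel D p c a b x)
    (fun c a b ↦ by rw [christoffel_symm hD.torsion_eq_zero, christoffel_symm hD'.torsion_eq_zero])
    (h.exists_parallel hD hx)
  refine ⟨fun a ↦ (christoffel D' p a a a x - christoffel D p a a a x) / 2, fun c a b ↦ ?_⟩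
  linear_combination h1 c a b

section

variable {D D' : Conn n M} {ε : ∀ x : M, (TangentSpace (𝓡 n) x) [⋀^Fin n]→ₗ[ℝ] ℝ} (g : Metric n M)

theorem posDef_metric {p x : M} (hx : x ∈ dom n p) : (loMat (g.inner x) p).PosDef :=
  posDef_loMat hx (g.symm x) (g.pos x)

theorem smoothMat_metric {p x : M} (hx : x ∈ dom n p) : SmoothMat n (fun y ↦ loMat (g.inner y) p) x :=
  fun a b ↦ smoothFn_compMetric g hx a b

variable (ε) in
/-- The ratio of the squares of two volume forms. -/
def volRatio (p x : M) : ℝ := (loMat (g.inner x) p).det / volComp ε p x ^ 2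

variable {g}

theorem volRatio_change (hε : IsParallelVolumeForm D ε) {p q x : M} (hp : x ∈ dom n p) (hq : x ∈ dom n q) :
    volRatio ε g p x = volRatio ε g q x := by
  have h1 := volComp_ne_zero hε.ne_zero hp
  have h2 := volComp_ne_zero hε.ne_zero hq
  have h3 := volComp_change (ε := ε) (p := p) hq
  rw [volRatio, volRatio, loMat_change hq p, Matrix.det_mul, Matrix.det_mul, Matrix.det_transpose,
    div_eq_div_iff (pow_ne_zero 2 h1) (pow_ne_zero 2 h2), h3]
  ring

theorem volRatio_pos (hε : IsParallelVolumeForm D ε) {p x : M} (hx : x ∈ dom n p) : 0 < volRatio ε g p x :=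
  div_pos (posDef_metric g hx).det_pos (even_two.pow_pos (volComp_ne_zero hε.ne_zero hx))

theorem IsMetricConnection.pdM_metric (h : IsMetricConnection D' g) {p x : M} (hx : x ∈ dom n p) (a : Fin n) :
    pdM p a (fun y ↦ loMat (g.inner y) p) x =
      (chr D' p a x)ᵀ * loMat (g.inner x) p + loMat (g.inner x) p * chr D' p a x := by
  ext b c
  refine (h.pd_compMetric hx a b c).trans ?_
  rw [Matrix.add_apply, Matrix.mul_apply, Matrix.mul_apply]
  exact congrArg₂ _ rfl (Finset.sum_congr rfl fun d _ ↦ mul_comm _ _)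

theorem SmoothFn.sq {f : M → ℝ} {x : M} (hf : SmoothFn n f x) : SmoothFn n (fun y ↦ f y ^ 2) x := by
  simp only [_root_.sq]
  exact hf.mul hf

theorem smoothFn_log_volRatio (hε : IsParallelVolumeForm D ε) {p x : M} (hx : x ∈ dom n p) :
    SmoothFn n (fun y ↦ Real.log (volRatio ε g p y)) x := by
  have hE := volComp_ne_zero hε.ne_zero hx
  refine SmoothFn.comp (Real.contDiffAt_log.2 (volRatio_pos hε hx).ne') ?_
  rw [show volRatio ε g p = fun y ↦ (loMat (g.inner y) p).det * (volComp ε p y ^ 2)⁻¹ from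
    funext fun y ↦ div_eq_mul_inv _ _]
  exact (SmoothFn.det (smoothMat_metric g hx)).mul
    (SmoothFn.comp (contDiffAt_inv ℝ (pow_ne_zero 2 hE)) (hε.smoothFn_volComp hx).sq)

/-- Each volume form is parallel for its own connection, so its logarithmic derivative is the trace
of that connection; the factor 2 comes from the squares. -/
theorem pd_log_volRatio (hε : IsParallelVolumeForm D ε) (h : IsMetricConnection D' g) {p x : M}
    (hx : x ∈ dom n p) (a : Fin n) :
    pd p a (fun y ↦ Real.log (volRatio ε g p y)) x =
      2 * ((chr D' p a x).trace - (chr D p a x).trace) := by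
  have hE := volComp_ne_zero hε.ne_zero hx
  have hG := (posDef_metric g hx).det_pos.ne'
  have hsE := hε.smoothFn_volComp hx
  have hsG := SmoothFn.det (smoothMat_metric g hx)
  have h1 : ∀ y ∈ dom n p, Real.log (volRatio ε g p y) =
      Real.log ((loMat (g.inner y) p).det) - 2 * Real.log (volComp ε p y) := fun y hy ↦ by
    rw [volRatio, Real.log_div (posDef_metric g hy).det_pos.ne'
      (pow_ne_zero 2 (volComp_ne_zero hε.ne_zero hy)), Real.log_pow]
    norm_num
  have hlE := SmoothFn.comp (Real.contDiffAt_log.2 hE) hsE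
  have hlG := SmoothFn.comp (f := fun y ↦ (loMat (g.inner y) p).det) (Real.contDiffAt_log.2 hG) hsG
  rw [pd_congr_dom hx h1, pd_sub hlG.diff (SmoothFn.mul contMDiffAt_const hlE).diff, pd_const_mul _ hlE.diff,
    pd_comp (f := fun y ↦ (loMat (g.inner y) p).det) (Real.hasDerivAt_log hG) hsG.diff, pd_comp (Real.hasDerivAt_log hE) hsE.diff, hε.pd_volComp hx,
    pd_det_of_eq (smoothMat_metric g hx) p a (h.pdM_metric hx a)]
  have h2 : (chr D p a x).trace = ∑ b, christoffel D p b a b x := rfl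
  rw [h2]
  field_simp

variable (ε g) in
/-- The function `h` such that the Levi-Civita connection is `Γ + δ ⊗ dh + dh ⊗ δ`. -/
def projPotential (x : M) : ℝ := 1 / (2 * ((n : ℝ) + 1)) * Real.log (volRatio ε g x x)

theorem projPotential_eventuallyEq (hε : IsParallelVolumeForm D ε) {p x : M} (hx : x ∈ dom n p) :
    projPotential ε g =ᶠ[nhds x] fun y ↦ 1 / (2 * ((n : ℝ) + 1)) * Real.log (volRatio ε g p y) :=
  diag_eventuallyEq (F := fun p y ↦ 1 / (2 * ((n : ℝ) + 1)) * Real.log (volRatio ε g p y))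
    (fun p q y hp hq ↦ by rw [volRatio_change hε hp hq]) hx

theorem smoothFn_projPotential (hε : IsParallelVolumeForm D ε) (x : M) : SmoothFn n (projPotential ε g) x := by
  have hx := mem_dom_self (n := n) x
  refine ContMDiffAt.congr_of_eventuallyEq ?_ (projPotential_eventuallyEq hε hx)
  exact SmoothFn.mul contMDiffAt_const (smoothFn_log_volRatio hε hx)

/-- The one-form υ of the projective change is exact: the trace of δ⊗υ + υ⊗δ is (n + 1)υ, and by
`pd_log_volRatio` it is half the differential of log(det g / ε²). This explains the constant in
`projPotential`. -/
theorem chr_eq_of_geodesicsReparametrise [T2Space M] (hD : IsSmoothTorsionFree D) (hε : IsParallelVolumeForm D ε)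
    (h : IsMetricConnection D' g) (hg : GeodesicsReparametrise D D') {p x : M} (hx : x ∈ dom n p) (a : Fin n) :
    chr D' p a x = tracelessShift (chr D p a x) a (fun b ↦ pd p b (projPotential ε g) x)
      + pd p a (projPotential ε g) x • (1 : Matrix (Fin n) (Fin n) ℝ) := by
  obtain ⟨υ, hυ⟩ := exists_christoffel_eq hD h.smoothTorsionFree hg hx
  have h1 : ∀ a, chr D' p a x = tracelessShift (chr D p a x) a υ + υ a • (1 : Matrix (Fin n) (Fin n) ℝ) := fun a ↦ by
    ext c b
    simp only [chr, tracelessShift, Matrix.of_apply, Matrix.add_apply, hυ, vecMulVec_apply, Matrix.smul_apply,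
      smul_eq_mul, kron, Pi.single_apply, Matrix.one_apply]
    ring
  have h2 : ∀ a, pd p a (projPotential ε g) x = υ a := fun a ↦ by
    rw [pd_congr (projPotential_eventuallyEq hε hx), pd_const_mul _ (smoothFn_log_volRatio hε hx).diff,
      pd_log_volRatio hε h hx, h1 a, tracelessShift, Matrix.trace_add, Matrix.trace_add, trace_vecMulVec,
      Matrix.trace_smul, Matrix.trace_one]
    simp only [single_dotProduct, one_mul, Fintype.card_fin, smul_eq_mul]
    have : (n : ℝ) + 1 ≠ 0 := by positivity
    field_simp
    ring
  simp only [h2]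
  exact h1 a

variable (ε g) in
/-- The metric, rescaled. -/
def scaledMetricMat (p x : M) : Matrix (Fin n) (Fin n) ℝ :=
  Real.exp (-2 * projPotential ε g x) • loMat (g.inner x) p

theorem posDef_scaledMetricMat {p x : M} (hx : x ∈ dom n p) : (scaledMetricMat ε g p x).PosDef :=
  (posDef_metric g hx).smul (Real.exp_pos _)

theorem smoothFn_exp_projPotential (hε : IsParallelVolumeForm D ε) (x : M) :
    SmoothFn n (fun y ↦ Real.exp (-2 * projPotential ε g y)) x :=
  SmoothFn.comp (φ := fun t ↦ Real.exp (-2 * t)) ((contDiff_const.mul contDiff_id).exp.contDiffAt)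
    (smoothFn_projPotential hε x)

theorem smoothMat_scaledMetricMat (hε : IsParallelVolumeForm D ε) {p x : M} (hx : x ∈ dom n p) :
    SmoothMat n (scaledMetricMat ε g p) x :=
  SmoothMat.smul (smoothFn_exp_projPotential hε x) (smoothMat_metric g hx)

/-- The factor e^{-2h} removes the multiple dh of the identity from the Levi-Civita connection
matrix. What is left is the form in which `pdM_upMat_iff` recognises the top equation for the
inverse. -/
theorem pdM_scaledMetricMat [T2Space M] (hD : IsSmoothTorsionFree D) (hε : IsParallelVolumeForm D ε)
    (h : IsMetricConnection D' g) (hg : GeodesicsReparametrise D D') {p x : M} (hx : x ∈ dom n p) (a : Fin n) :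
    pdM p a (scaledMetricMat ε g p) x =
      (tracelessShift (chr D p a x) a fun b ↦ pd p b (projPotential ε g) x)ᵀ * scaledMetricMat ε g p x
      + scaledMetricMat ε g p x * tracelessShift (chr D p a x) a fun b ↦ pd p b (projPotential ε g) x := by
  have e1 : pdM p a (scaledMetricMat ε g p) x = _ :=
    pdM_smul (smoothFn_exp_projPotential hε x) (smoothMat_metric g hx) p a
  have e2 : pd p a (fun y ↦ Real.exp (-2 * projPotential ε g y)) x =
      -2 * pd p a (projPotential ε g) x * Real.exp (-2 * projPotential ε g x) := by
    have hd := (smoothFn_projPotential (g := g) hε x)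
    rw [pd_comp (Real.hasDerivAt_exp _) (SmoothFn.mul contMDiffAt_const hd).diff, pd_const_mul _ hd.diff]
    ring
  rw [e1, e2, h.pdM_metric hx, chr_eq_of_geodesicsReparametrise hD hε h hg hx, scaledMetricMat]
  simp only [Matrix.transpose_add, Matrix.transpose_smul, Matrix.transpose_one, add_mul, mul_add,
    Matrix.mul_smul, Matrix.smul_mul, one_mul, mul_one, smul_smul, smul_add]
  module

variable (ε g) in
/-- The rescaled inverse of the metric. -/
def scaledInverse (x : M) : LinearMap.BilinForm ℝ (TangentSpace (𝓡 n) x →L[ℝ] ℝ) :=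
  upForm x (scaledMetricMat ε g x x)⁻¹

theorem upMat_scaledInverse {p x : M} (hx : x ∈ dom n p) :
    upMat (scaledInverse ε g x) p = (scaledMetricMat ε g p x)⁻¹ := by
  refine upMat_upForm_inv hx (mem_dom_self x) ?_
  rw [scaledMetricMat, scaledMetricMat, loMat_change (mem_dom_self x) p, Matrix.mul_smul, Matrix.smul_mul]

theorem scaledInverse_symm (x : M) (α β : TangentSpace (𝓡 n) x →L[ℝ] ℝ) :
    scaledInverse ε g x α β = scaledInverse ε g x β α :=
  upForm_symm (posDef_scaledMetricMat (mem_dom_self x)).inv _ _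

theorem smoothFn_scaledInverse (hε : IsParallelVolumeForm D ε) (p x : M) (hx : x ∈ dom n p) (b c : Fin n) :
    SmoothFn n (fun y ↦ scaledInverse ε g y (coordCov p b y) (coordCov p c y)) x :=
  ((smoothMat_scaledMetricMat hε hx).inv (posDef_scaledMetricMat hx).det_pos.ne' b c).congr_of_eventuallyEq
    (Filter.eventually_of_mem (dom_mem_nhds hx) fun _ hy ↦
      congrFun (congrFun (upMat_scaledInverse hy) b) c)

variable (ε g) in
/-- The vector field `-σ(·, dh)`. -/
def scaledGradient (x : M) : TangentSpace (𝓡 n) x :=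
  ∑ b, (-scaledInverse ε g x (coordCov x b x) (mvfderiv (𝓡 n) (projPotential ε g) x)) • coordVec x b x

theorem coordCov_scaledGradient {p x : M} (hx : x ∈ dom n p) (b : Fin n) :
    coordCov p b x (scaledGradient ε g x) = - ∑ c, scaledInverse ε g x (coordCov p b x) (coordCov p c x)
      * pd p c (projPotential ε g) x := by
  have h1 : coordCov p b x (scaledGradient ε g x) =
      -scaledInverse ε g x (coordCov p b x) (mvfderiv (𝓡 n) (projPotential ε g) x) := by
    conv_rhs => rw [← sum_apply_coordVec_smul (mem_dom_self x) (coordCov p b x)]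
    simp only [scaledGradient, map_sum, map_smul, LinearMap.sum_apply, LinearMap.smul_apply, smul_eq_mul,
      ← Finset.sum_neg_distrib]
    exact Finset.sum_congr rfl fun i _ ↦ by ring
  rw [h1]
  conv_lhs => rw [← sum_apply_coordVec_smul hx (mvfderiv (𝓡 n) (projPotential ε g) x)]
  simp only [map_sum, map_smul, smul_eq_mul]
  exact congrArg _ (Finset.sum_congr rfl fun i _ ↦ mul_comm _ _)

theorem smoothFn_scaledGradient (hε : IsParallelVolumeForm D ε) (p x : M) (hx : x ∈ dom n p) (b : Fin n) :
    SmoothFn n (fun y ↦ coordCov p b y (scaledGradient ε g y)) x := by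
  refine ContMDiffAt.congr_of_eventuallyEq (f := fun y ↦ - ∑ c,
    scaledInverse ε g y (coordCov p b y) (coordCov p c y) * pd p c (projPotential ε g) y) ?_
    (Filter.eventually_of_mem (dom_mem_nhds hx) fun y hy ↦ coordCov_scaledGradient hy b)
  exact ContMDiffAt.neg (SmoothFn.sum fun c _ ↦ (smoothFn_scaledInverse hε p x hx b c).mul
    ((smoothFn_projPotential hε x).pd hx c))

variable [T2Space M]

variable (g) in
/-- The solution of the tractor equation that corresponds to the metric `g`. -/
def toSection (hn : 2 ≤ n) (hD : IsSmoothTorsionFree D) (hε : IsParallelVolumeForm D ε) : TractorSection n M :=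
  prolong hn hD (scaledInverse ε g) (scaledGradient ε g) scaledInverse_symm (smoothFn_scaledInverse hε)
    (smoothFn_scaledGradient hε)

theorem isPosDef_toSection (hn : 2 ≤ n) (hD : IsSmoothTorsionFree D) (hε : IsParallelVolumeForm D ε) :
    (toSection g hn hD hε).IsPosDef := fun x _ hα ↦
  upForm_pos (mem_dom_self x) (posDef_scaledMetricMat (mem_dom_self x)).inv hα

theorem isSolution_toSection (hn : 2 ≤ n) (hD : IsSmoothTorsionFree D) (hε : IsParallelVolumeForm D ε)
    (h : IsMetricConnection D' g) (hg : GeodesicsReparametrise D D') :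
    (toSection g hn hD hε).IsSolution D := by
  refine isSolution_prolong hn hD hε _ _ _ fun p x hx a b c ↦ ?_
  set s := toSection g hn hD hε with hs
  change s.tractorσ D p a b c x = 0
  have hσ : ∀ y ∈ dom n p, upMat (s.σ y) p = (scaledMetricMat ε g p y)⁻¹ := fun y hy ↦ upMat_scaledInverse hy
  have h1 := pdM_inv_of_eq (smoothMat_scaledMetricMat hε hx) (posDef_scaledMetricMat hx).det_pos.ne'
    (pdM_scaledMetricMat hD hε h hg hx a)
  rw [← hσ x hx, ← pdM_congr (G := fun y ↦ upMat (s.σ y) p)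
    (Filter.eventually_of_mem (dom_mem_nhds hx) hσ),
    ← pdM_upMat_iff (S := fun y ↦ upMat (s.σ y) p) (s.upMat_transpose p x)] at h1
  have h2 : (fun b ↦ s.compμ p b x) = -(upMat (s.σ x) p *ᵥ fun c ↦ pd p c (projPotential ε g) x) :=
    funext fun b ↦ coordCov_scaledGradient hx b
  rw [← h2] at h1
  have h3 := congrFun (congrFun h1 b) c
  have h4 : (chr D p a x * upMat (s.σ x) p) b c = ∑ d, christoffel D p b a d x * s.compσ p d c x := rfl
  have h5 : (upMat (s.σ x) p * (chr D p a x)ᵀ) b c = ∑ d, christoffel D p c a d x * s.compσ p b d x := by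
    rw [Matrix.mul_apply]
    exact Finset.sum_congr rfl fun d _ ↦ mul_comm _ _
  have h6 : pdM p a (fun y ↦ upMat (s.σ y) p) x b c = pd p a (s.compσ p b c) x := rfl
  rw [Matrix.add_apply, Matrix.add_apply, Matrix.add_apply, h4, h5, h6] at h3
  simp only [TractorSection.tractorσ, TractorSection.covσ]
  simp only [vecMulVec_apply, Pi.single_apply, kron] at h3 ⊢
  simp only [eq_comm (a := b), eq_comm (a := c)] at h3
  linear_combination h3

/-- For σ = e^{2h}g⁻¹ one has det(σ) = ε² e^{2nh} / det g, and det g = ε² e^{2(n+1)h} by the choice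
of h. -/
theorem det_toSection (hn : 2 ≤ n) (hD : IsSmoothTorsionFree D) (hε : IsParallelVolumeForm D ε) {p x : M}
    (hx : x ∈ dom n p) : (toSection g hn hD hε).det ε p x = Real.exp (-2 * projPotential ε g x) := by
  have hE := volComp_ne_zero hε.ne_zero hx
  have hG := (posDef_metric g hx).det_pos
  have h1 : (toSection g hn hD hε).det ε p x = volComp ε p x ^ 2 * ((scaledMetricMat ε g p x)⁻¹).det := by
    rw [← upMat_scaledInverse hx]; rfl
  have h2 : volRatio ε g p x = Real.exp (-2 * projPotential ε g x) ^ (-((n : ℤ) + 1)) := by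
    have e1 : projPotential ε g x = 1 / (2 * ((n : ℝ) + 1)) * Real.log (volRatio ε g p x) :=
      (projPotential_eventuallyEq hε hx).self_of_nhds
    rw [← Real.rpow_intCast, ← Real.exp_mul, e1]
    conv_lhs => rw [← Real.exp_log (volRatio_pos (g := g) hε hx)]
    congr 1
    push_cast
    have : (n : ℝ) + 1 ≠ 0 := by positivity
    field_simp
  have h3 : (loMat (g.inner x) p).det = volRatio ε g p x * volComp ε p x ^ 2 := by
    rw [volRatio, div_mul_cancel₀ _ (pow_ne_zero 2 hE)]
  rw [h1, Matrix.det_nonsing_inv, Ring.inverse_eq_inv', scaledMetricMat, Matrix.det_smul, Fintype.card_fin, h3, h2]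
  have he := (Real.exp_pos (-2 * projPotential ε g x)).ne'
  generalize Real.exp (-2 * projPotential ε g x) = t at he
  rw [_root_.zpow_neg, zpow_add₀ he, zpow_natCast, zpow_one]
  field_simp

theorem toMetric_toSection (hn : 2 ≤ n) (hD : IsSmoothTorsionFree D) (hε : IsParallelVolumeForm D ε) {p x : M}
    (hx : x ∈ dom n p) (a b : Fin n) :
    compMetric (TractorSection.toMetric (isPosDef_toSection (g := g) hn hD hε) hε) p a b x = compMetric g p a b x := by
  rw [TractorSection.compMetric_toMetric _ hε hx]
  have h1 : (toSection g hn hD hε).invMetricMat ε p x = (loMat (g.inner x) p)⁻¹ := by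
    have e1 : upMat ((toSection g hn hD hε).σ x) p = (scaledMetricMat ε g p x)⁻¹ := upMat_scaledInverse hx
    rw [TractorSection.invMetricMat, det_toSection hn hD hε hx, e1]
    refine (Matrix.inv_eq_left_inv ?_).symm
    rw [Matrix.smul_mul, ← Matrix.mul_smul]
    exact Matrix.nonsing_inv_mul _ (isUnit_iff_ne_zero.2 (posDef_scaledMetricMat hx).det_pos.ne')
  rw [h1, Matrix.nonsing_inv_nonsing_inv _ (isUnit_iff_ne_zero.2 (posDef_metric g hx).det_pos.ne')]
  rfl

end

/-! ### Uniqueness and the bijection. -/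

theorem metric_ext {g g' : Metric n M} (h : ∀ p : M, ∀ x ∈ dom n p, ∀ a b, compMetric g p a b x = compMetric g' p a b x) :
    g = g' := by
  have : g.inner = g'.inner := by
    funext x
    ext v w
    rw [inner_apply g (mem_dom_self x), inner_apply g' (mem_dom_self x)]
    simp only [h x x (mem_dom_self x)]
  cases g
  cases g'
  simp only at this
  subst this
  rfl

namespace TractorSection

variable {D : Conn n M} {ε : ∀ x : M, (TangentSpace (𝓡 n) x) [⋀^Fin n]→ₗ[ℝ] ℝ} {s t : TractorSection n M}

theorem eq_of_toMetric_eq (hn : 2 ≤ n) (hε : IsParallelVolumeForm D ε) (hs : s.IsSolution D) (hsp : s.IsPosDef)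
    (ht : t.IsSolution D) (htp : t.IsPosDef) (h : toMetric hsp hε = toMetric htp hε) : s = t := by
  have h1 : ∀ p : M, ∀ x ∈ dom n p, s.invMetricMat ε p x = t.invMetricMat ε p x := fun p x hx ↦ by
    have e1 : (s.invMetricMat ε p x)⁻¹ = (t.invMetricMat ε p x)⁻¹ := by
      ext a b
      rw [← compMetric_toMetric hsp hε hx, ← compMetric_toMetric htp hε hx, h]
    rw [← Matrix.nonsing_inv_nonsing_inv _ (isUnit_det_invMetricMat hsp hε hx), e1,
      Matrix.nonsing_inv_nonsing_inv _ (isUnit_det_invMetricMat htp hε hx)]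
  -- The determinant of det(σ)σ contributes det(σ)ⁿ and one more factor det(σ) after multiplication
  -- by ε². As (n + 1)-st powers are injective on positive numbers, the metric determines det(σ).
  have hpow : ∀ (s : TractorSection n M) (p x : M),
      volComp ε p x ^ 2 * (s.invMetricMat ε p x).det = s.det ε p x ^ (n + 1) := fun s p x ↦ by
    rw [invMetricMat, Matrix.det_smul, Fintype.card_fin, pow_succ, s.det_eq p x]
    ring
  have h2 : ∀ p : M, ∀ x ∈ dom n p, s.det ε p x = t.det ε p x := fun p x hx ↦ by
    rw [← pow_left_inj₀ (det_pos hsp hε hx).le (det_pos htp hε hx).le n.succ_ne_zero, ← hpow, ← hpow, h1 p x hx]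
  have h3 : ∀ p : M, ∀ x ∈ dom n p, upMat (s.σ x) p = upMat (t.σ x) p := fun p x hx ↦ by
    have e1 := h1 p x hx
    rw [invMetricMat, invMetricMat, h2 p x hx] at e1
    exact smul_right_injective _ (det_pos htp hε hx).ne' e1
  have hσ : s.σ = t.σ := by
    funext x
    have hx := mem_dom_self (n := n) x
    refine LinearMap.ext₂ fun α β ↦ ?_
    rw [← sum_apply_coordVec_smul hx α, ← sum_apply_coordVec_smul hx β]
    simp only [map_sum, map_smul, LinearMap.sum_apply, LinearMap.smul_apply]
    have e1 : ∀ i j, s.σ x (coordCov x i x) (coordCov x j x) = t.σ x (coordCov x i x) (coordCov x j x) := fun i j ↦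
      congrFun (congrFun (h3 x x hx) i) j
    simp only [e1]
  have hlog : s.logDet ε = t.logDet ε := funext fun x ↦ by
    rw [logDet, logDet, h2 x x (mem_dom_self x)]
  have hcσ : ∀ p b c, s.compσ p b c = t.compσ p b c := fun p b c ↦ by
    funext x
    rw [compσ, compσ, hσ]
  have hμ : s.μ = t.μ := by
    funext x
    have hx := mem_dom_self (n := n) x
    refine eq_of_coordCov_eq hx fun b ↦ ?_
    have e1 := hs.compμ_eq hsp hε hx b
    rw [hlog] at e1
    simp only [hcσ, ← ht.compμ_eq htp hε hx b] at e1
    exact e1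
  have hcμ : ∀ p b, s.compμ p b = t.compμ p b := fun p b ↦ by
    funext x
    rw [compμ, compμ, hμ]
  refine TractorSection.ext hσ hμ (funext fun x ↦ ?_)
  have hx := mem_dom_self (n := n) x
  -- Any diagonal component of the middle equation determines ρ, once σ and μ agree; an index exists
  -- because n is positive.
  let a : Fin n := ⟨0, by omega⟩
  have e1 := hs.middle x x hx a a
  have e2 := ht.middle x x hx a a
  simp only [tractorμ, covμ, hcσ, hcμ, kron, if_true] at e1 e2
  linarith

end TractorSection

/-- The metric connection that corresponds to a solution. -/
def toMetricConnection {D : Conn n M} {ε : ∀ x : M, (TangentSpace (𝓡 n) x) [⋀^Fin n]→ₗ[ℝ] ℝ}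
    (hD : IsSmoothTorsionFree D) (hε : IsParallelVolumeForm D ε) (s : PosDefSolutions D) : MetricConnections D :=
  ⟨TractorSection.toMetric s.2.2 hε, projChange D (s.1.logDet ε),
    TractorSection.isMetricConnection_projChange hD s.2.1 s.2.2 hε,
    projectivelyEquivalent_projChange D (TractorSection.smoothFn_logDet s.2.2 hε)⟩

theorem toMetricConnection_bijective [T2Space M] {D : Conn n M}
    {ε : ∀ x : M, (TangentSpace (𝓡 n) x) [⋀^Fin n]→ₗ[ℝ] ℝ} (hn : 2 ≤ n)
    (hD : IsSmoothTorsionFree D) (hε : IsParallelVolumeForm D ε) :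
    Function.Bijective (toMetricConnection hD hε) := by
  refine ⟨fun s t h ↦ ?_, fun ⟨g, D', hg, hp⟩ ↦ ?_⟩
  · exact Subtype.ext (TractorSection.eq_of_toMetric_eq hn hε s.2.1 s.2.2 t.2.1 t.2.2 (congrArg Subtype.val h))
  · exact ⟨⟨toSection g hn hD hε, isSolution_toSection hn hD hε hg hp.1, isPosDef_toSection hn hD hε⟩,
      Subtype.ext (metric_ext fun p x hx a b ↦ toMetric_toSection hn hD hε hx a b)⟩

end ProjMetric
end

theorem mainTheorem5 {n : ℕ} (hn : 2 ≤ n) {M : Type*} [TopologicalSpace M] [T2Space M]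
    [SecondCountableTopology M] [ChartedSpace (EuclideanSpace ℝ (Fin n)) M]
    [IsManifold (𝓡 n) ∞ M] (D : ProjMetric.Conn n M) (hD : ProjMetric.IsSmoothTorsionFree D)
    (ε : ∀ x : M, (TangentSpace (𝓡 n) x) [⋀^Fin n]→ₗ[ℝ] ℝ)
    (hε : ProjMetric.IsParallelVolumeForm D ε) :
    ∃ e : ProjMetric.PosDefSolutions D ≃ ProjMetric.MetricConnections D,
      ∀ s : ProjMetric.PosDefSolutions D, ProjMetric.HasInverseDetSmul ε s.1 (e s).1 :=
  ⟨Equiv.ofBijective _ (ProjMetric.toMetricConnection_bijective hn hD hε), fun s ↦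
    ProjMetric.TractorSection.hasInverseDetSmul_toMetric s.2.2 hε⟩
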